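/- Let $N\ge 1$, let $\Omega\subset\mathbb{R}^N$ be open and bounded, and let $m\ge 2$, $m'=m/(m-1)$ and $\kappa\ge 0$. Let $\alpha:\mathbb{R}\to\mathbb{R}$ be an increasing Lipschitz function with $\alpha(0)=0$ and $\alpha'\ge\lambda$ almost everywhere for some constant $\lambda>0$. Let $f:\mathbb{R}\to\mathbb{R}$ be a Lipschitz function with $f\ge\sigma$ for some constant $\sigma>0$, and assume that for some constant $L_2>0$ $$|f(a)-f(b)|\le L_2\,|\alpha(a)-\alpha(b)|\qquad\text{for all } a,b\in\mathbb{R}.$$ For $M>0$ put $Q=\Omega\times(0,M)$ and consider the problem $$\frac{\partial\alpha(v)}{\partial s}-\operatorname{div}\big(|\nabla v|^{m-2}\nabla v\big)=\kappa\,\frac{f(v)}{\big(\int_\Omega f(v)\,dx\big)^2}\ \text{ in } Q,\qquad \alpha(v(\cdot,0))=\alpha(v_0)\ \text{ in }\Omega,\qquad v=0\ \text{ on }\partial\Omega\times(0,M).\tag{P}$$ For $v_0\in L^\infty(\Omega)$, a bounded weak solution of (P) with initial datum $v_0$ is a function $v\in L^\infty(Q)\cap L^m(0,M;W^{1,m}_0(\Omega))$,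 with $v\in L^\infty(t,M;W^{1,m}(\Omega))$ for every $t>0$, for which there is $\xi=\frac{\partial\alpha(v)}{\partial s}\in L^{m'}(0,M;W^{-1,m'}(\Omega))$ such that $$\int_0^M\langle\xi,w\rangle\,ds+\int_Q|\nabla v|^{m-2}\nabla v\cdot\nabla w=\kappa\int_Q\frac{f(v)}{\big(\int_\Omega f(v)\,dx\big)^2}\,w$$ for all $w\in L^m(0,M;W^{1,m}_0(\Omega))\cap L^\infty(Q)$, and $$\int_0^M\langle\xi,w\rangle\,ds=-\int_0^M\!\!\int_\Omega[\alpha(v)-\alpha(v_0)]\,\partial_s w\,dx\,ds$$ for all $w\in W^{1,1}(0,M;L^1(\Omega))\cap L^m(0,M;W^{1,m}_0(\Omega))$ with $w(\cdot,M)=0$. Then there is a constant $K>0$, depending only on $N,\Omega,m,\kappa,\alpha,f,L_2$, such that for all $M>0$, all $v_0,u_0\in L^\infty(\Omega)$ and all bounded weak solutions $v,u$ of (P) with initial data $v_0,u_0$, respectively, $$\|\alpha(v(s))-\alpha(u(s))\|_{L^1(\Omega)}\le e^{Ks}\,\|\alpha(v_0)-\alpha(u_0)\|_{L^1(\Omega)}\qquad\text{for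 almost every } s\in(0,M).$$ Moreover, whenever $\alpha(v)$ and $\alpha(u)$ have representatives in $C([0,M];L^1(\Omega))$, these representatives satisfy the inequality for every $s\in[0,M]$. -/

import Mathlib

open MeasureTheory Set Filter Topology
open scoped ENNReal NNReal

namespace Thermistor

/-- The Euclidean space `ℝ^N`. -/
abbrev Space (N : ℕ) : Type := EuclideanSpace ℝ (Fin N)

/-- Lebesgue measure on the space-time cylinder `Q = (0, M) × Ω`; the first coordinate is time. -/
noncomputable def cylinder {N : ℕ} (Ω : Set (Space N)) (M : ℝ) : Measure (ℝ × Space N) :=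
  (volume.restrict (Ioo 0 M)).prod (volume.restrict Ω)

/-- `φ ∈ C_c^∞(Ω)`. -/
def IsTestFunction {N : ℕ} (Ω : Set (Space N)) (φ : Space N → ℝ) : Prop :=
  ContDiff ℝ ((⊤ : ℕ∞) : WithTop ℕ∞) φ ∧ HasCompactSupport φ ∧ tsupport φ ⊆ Ω

/-- `w ∈ W_0^{1,m}(Ω)` with weak gradient `G`: the pair `(w, G)` belongs to the closure of
`{(φ, ∇φ) : φ ∈ C_c^∞(Ω)}` in `L^m(Ω) × L^m(Ω; ℝ^N)`. -/
def MemW0 {N : ℕ} (Ω : Set (Space N)) (m : ℝ) (w : Space N → ℝ) (G : Space N → Space N) : Prop :=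
  MemLp w (ENNReal.ofReal m) (volume.restrict Ω) ∧
  MemLp G (ENNReal.ofReal m) (volume.restrict Ω) ∧
  ∃ φ : ℕ → Space N → ℝ, (∀ n, IsTestFunction Ω (φ n)) ∧
    Tendsto (fun n => eLpNorm (fun x => φ n x - w x) (ENNReal.ofReal m) (volume.restrict Ω))
      atTop (𝓝 0) ∧
    Tendsto (fun n => eLpNorm (fun x => gradient (φ n) x - G x) (ENNReal.ofReal m)
      (volume.restrict Ω)) atTop (𝓝 0)

/-- `w ∈ L^m(0, M; W_0^{1,m}(Ω))` with spatial weak gradient `G`. -/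
def MemLmW0 {N : ℕ} (Ω : Set (Space N)) (M m : ℝ)
    (w : ℝ → Space N → ℝ) (G : ℝ → Space N → Space N) : Prop :=
  MemLp (fun z : ℝ × Space N => w z.1 z.2) (ENNReal.ofReal m) (cylinder Ω M) ∧
  MemLp (fun z : ℝ × Space N => G z.1 z.2) (ENNReal.ofReal m) (cylinder Ω M) ∧
  ∀ᵐ s ∂(volume.restrict (Ioo 0 M)), MemW0 Ω m (w s) (G s)

/-- `w ∈ L^∞(Q)`. -/
def MemLinfty {N : ℕ} (Ω : Set (Space N)) (M : ℝ) (w : ℝ → Space N → ℝ) : Prop :=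
  MemLp (fun z : ℝ × Space N => w z.1 z.2) ∞ (cylinder Ω M)

/-- `w ∈ W^{1,1}(0, M; L^1(Ω))` with time derivative `wt` and `w(·, M) = 0`: the derivative `wt`
is in `L^1(Q)` and `w(s) = - ∫_s^M wt(τ) dτ` for a.e. `s`. -/
def MemW11End {N : ℕ} (Ω : Set (Space N)) (M : ℝ) (w wt : ℝ → Space N → ℝ) : Prop :=
  MemLp (fun z : ℝ × Space N => wt z.1 z.2) 1 (cylinder Ω M) ∧
  ∀ᵐ z ∂(cylinder Ω M), w z.1 z.2 = - ∫ τ in z.1..M, wt τ z.2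

/-- An element `ξ = ξ₀ - div ξ₁` of `L^{m'}(0, M; W^{-1,m'}(Ω))`, the dual space of
`L^m(0, M; W_0^{1,m}(Ω))`, is given by `ξ₀ ∈ L^{m'}(Q)` and `ξ₁ ∈ L^{m'}(Q; ℝ^N)`,
where `m' = m / (m - 1)`. -/
def MemDual {N : ℕ} (Ω : Set (Space N)) (M m : ℝ)
    (ξ₀ : ℝ → Space N → ℝ) (ξ₁ : ℝ → Space N → Space N) : Prop :=
  MemLp (fun z : ℝ × Space N => ξ₀ z.1 z.2) (ENNReal.ofReal (m / (m - 1))) (cylinder Ω M) ∧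
  MemLp (fun z : ℝ × Space N => ξ₁ z.1 z.2) (ENNReal.ofReal (m / (m - 1))) (cylinder Ω M)

/-- The pairing `∫_0^M ⟨ξ(s), w(s)⟩ ds` of `ξ = ξ₀ - div ξ₁` in `L^{m'}(0, M; W^{-1,m'}(Ω))` with
`w ∈ L^m(0, M; W_0^{1,m}(Ω))`, whose gradient is `G`. -/
noncomputable def pairing {N : ℕ} (Ω : Set (Space N)) (M : ℝ)
    (ξ₀ : ℝ → Space N → ℝ) (ξ₁ : ℝ → Space N → Space N)
    (w : ℝ → Space N → ℝ) (G : ℝ → Space N → Space N) : ℝ :=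
  ∫ z, (ξ₀ z.1 z.2 * w z.1 z.2 + inner ℝ (ξ₁ z.1 z.2) (G z.1 z.2)) ∂(cylinder Ω M)

/-- `v` is a bounded weak solution on `(0, M) × Ω`, with initial datum `v₀`, of
`∂_s α(v) - div(|∇v|^(m-2) ∇v) = κ f(v) / (∫_Ω f(v) dx)²`, `v = 0` on the lateral boundary.
Here `Gv` is the spatial gradient of `v` and `ξ = ξ₀ - div ξ₁` is `∂_s α(v)`. -/
def IsBoundedWeakSolution {N : ℕ} (Ω : Set (Space N)) (M m κ : ℝ) (α f : ℝ → ℝ)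
    (v₀ : Space N → ℝ) (v : ℝ → Space N → ℝ) : Prop :=
  MemLinfty Ω M v ∧
  ∃ Gv : ℝ → Space N → Space N,
    MemLmW0 Ω M m v Gv ∧
    -- `v ∈ L^∞(t, M; W^{1,m}(Ω))` for every `t > 0`
    (∀ t : ℝ, 0 < t → ∃ C : ℝ≥0, ∀ᵐ s ∂(volume.restrict (Ioo t M)),
      eLpNorm (v s) (ENNReal.ofReal m) (volume.restrict Ω) +
        eLpNorm (Gv s) (ENNReal.ofReal m) (volume.restrict Ω) ≤ C) ∧
    ∃ (ξ₀ : ℝ → Space N → ℝ) (ξ₁ : ℝ → Space N → Space N),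
      MemDual Ω M m ξ₀ ξ₁ ∧
      -- the equation, tested with `w ∈ L^m(0, M; W_0^{1,m}(Ω)) ∩ L^∞(Q)`
      (∀ (w : ℝ → Space N → ℝ) (G : ℝ → Space N → Space N),
        MemLmW0 Ω M m w G → MemLinfty Ω M w →
        pairing Ω M ξ₀ ξ₁ w G +
            ∫ z, ‖Gv z.1 z.2‖ ^ (m - 2) * inner ℝ (Gv z.1 z.2) (G z.1 z.2) ∂(cylinder Ω M) =
          κ * ∫ z, f (v z.1 z.2) / (∫ y in Ω, f (v z.1 y)) ^ 2 * w z.1 z.2 ∂(cylinder Ω M)) ∧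
      -- `ξ` is the time derivative of `α(v)`, with initial value `α(v₀)`
      (∀ (w wt : ℝ → Space N → ℝ) (G : ℝ → Space N → Space N),
        MemLmW0 Ω M m w G → MemW11End Ω M w wt →
        pairing Ω M ξ₀ ξ₁ w G =
          - ∫ z, (α (v z.1 z.2) - α (v₀ z.2)) * wt z.1 z.2 ∂(cylinder Ω M))

/-- `α` is Lipschitz continuous and increasing, `α(0) = 0`, and `α' ≥ lam > 0`
(a Lipschitz function is differentiable almost everywhere). -/
structure AlphaAssumption (α : ℝ → ℝ) : Prop where
  lipschitz : ∃ C : ℝ≥0, LipschitzWith C α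
  increasing : Monotone α
  map_zero : α 0 = 0
  deriv_ge : ∃ lam : ℝ, 0 < lam ∧ ∀ᵐ s : ℝ, lam ≤ deriv α s

/-- `f` is Lipschitz continuous and bounded below by a positive constant `σ`. -/
structure ResistanceAssumption (f : ℝ → ℝ) : Prop where
  lipschitz : ∃ C : ℝ≥0, LipschitzWith C f
  lower_bound : ∃ σ : ℝ, 0 < σ ∧ ∀ s : ℝ, σ ≤ f s

/-- `b` is a representative in `C([0, M]; L^1(Ω))` of `s ↦ α(v(s))`. -/
def IsContinuousRepr {N : ℕ} (Ω : Set (Space N)) (M : ℝ) (α : ℝ → ℝ) (v : ℝ → Space N → ℝ)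
    (b : ℝ → Lp ℝ 1 (volume.restrict Ω)) : Prop :=
  ContinuousOn b (Icc 0 M) ∧
  ∀ᵐ s ∂(volume.restrict (Ioo 0 M)), ∀ᵐ x ∂(volume.restrict Ω), b s x = α (v s x)

/-- The distance `‖g - h‖_{L^1(Ω)}`, with values in `[0, ∞]`. -/
noncomputable def distL1 {N : ℕ} (Ω : Set (Space N)) (g h : Space N → ℝ) : ℝ≥0∞ :=
  eLpNorm (fun x => g x - h x) 1 (volume.restrict Ω)

end Thermistor

/-! Formally, one subtracts the two equations and tests with sign(v - u). The elliptic part is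
nonnegative because ξ ↦ |ξ|^(m-2) ξ is monotone. The time part is the derivative of ‖α(v) - α(u)‖₁,
since α is increasing. The difference of the sources is bounded in L¹ by K ‖α(v) - α(u)‖₁, and
Gronwall's lemma concludes.

The obstacle is the time part: ∂_s α(v) is only an element of a dual space, and no chain rule is
available for the pairing of ∂_s(α(v) - α(u)) with a function of v - u. The remedy is Kruzhkov's
doubling, in the time variable only. For a frozen time τ, k = u(τ) is a time-independent element of
W_0^{1,m}(Ω), and v is tested with ζ(t) H(v(t) - k), where H = `regSign ε`. With Steklov averages
the chain rule becomes the convexity inequality `entropy_sub_le`, which points in the right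
direction and requires no derivative of α(v). The outcome is the entropy inequality
`RegularSolution.kato`.

This inequality for v(t) against u(τ), integrated over τ, is added to the one for u(τ) against v(t).
Space is not doubled, so both gradients are taken at the same x and the elliptic terms combine,
pointwise, to a nonnegative quantity (`le_katoIntegrand_add`). Letting ε → 0 gives
`integral_double_nonpos`. The test function is then ψ(τ) ρ(t - τ) with ρ concentrating at 0 from the
right, so that t > τ: the term with v₀ drops out and the one with u₀ becomes an average of |α(v(t))
- α(u₀)| over small t (`integral_double_mollifier_le`). As ρ concentrates, continuity of
translations in L¹ identifies the diagonal term. The averages converge to ‖α(v₀) - α(u₀)‖₁ because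
the initial datum is attained in L¹ (`exists_integral_mollifier_le`), which follows from the same
entropy inequality with k a test function close to v₀.

The source estimate `integral_abs_source_sub_le` uses only the lower bound ∫ f(v) ≥ σ|Ω| and the
Lipschitz bound of f relative to α, so K does not depend on the solutions. Gronwall's lemma is built
into the choice of ψ, a solution of ψ' = -Kψ - χ. The statement for continuous representatives
follows because a continuous function vanishing almost everywhere on an interval vanishes on all of
it. -/

namespace Thermistor

/-! ### The regularised sign function. -/

/-- A smooth increasing approximation of the sign function. -/
noncomputable def regSign (ε r : ℝ) : ℝ := r / √(ε ^ 2 + r ^ 2)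

/-- The derivative of `regSign ε`. -/
noncomputable def regSignDeriv (ε r : ℝ) : ℝ := ε ^ 2 / ((ε ^ 2 + r ^ 2) * √(ε ^ 2 + r ^ 2))

section RegSign

variable {ε : ℝ}

lemma regSign_neg (r : ℝ) : regSign ε (-r) = -regSign ε r := by
  simp [regSign, neg_div]

lemma regSignDeriv_neg (r : ℝ) : regSignDeriv ε (-r) = regSignDeriv ε r := by
  simp [regSignDeriv]

lemma regSign_zero : regSign ε 0 = 0 := by simp [regSign]

lemma regSignDeriv_nonneg (r : ℝ) : 0 ≤ regSignDeriv ε r := by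
  unfold regSignDeriv; positivity

lemma sqrt_reg_pos (hε : 0 < ε) (r : ℝ) : 0 < √(ε ^ 2 + r ^ 2) := Real.sqrt_pos.2 (by positivity)

lemma le_sqrt_reg (ε r : ℝ) : ε ≤ √(ε ^ 2 + r ^ 2) :=
  Real.le_sqrt_of_sq_le (by nlinarith [sq_nonneg r])

lemma abs_le_sqrt_reg (r : ℝ) : |r| ≤ √(ε ^ 2 + r ^ 2) :=
  Real.abs_le_sqrt (by nlinarith [sq_nonneg ε])

lemma contDiff_regSign (hε : 0 < ε) : ContDiff ℝ ((⊤ : ℕ∞) : WithTop ℕ∞) (regSign ε) := by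
  unfold regSign
  refine contDiff_id.div (ContDiff.sqrt (by fun_prop) fun r => ?_) fun r => (sqrt_reg_pos hε r).ne'
  positivity

lemma hasDerivAt_regSign (hε : 0 < ε) (r : ℝ) :
    HasDerivAt (regSign ε) (regSignDeriv ε r) r := by
  have h0 : ε ^ 2 + r ^ 2 ≠ 0 := by positivity
  have hs := sqrt_reg_pos hε r
  have h1 : HasDerivAt (fun r : ℝ => ε ^ 2 + r ^ 2) (2 * r) r := by
    simpa using (hasDerivAt_pow 2 r).const_add (ε ^ 2)
  have h2 := (hasDerivAt_id r).div (h1.sqrt h0) hs.ne'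
  refine h2.congr_deriv ?_
  have hsq : √(ε ^ 2 + r ^ 2) ^ 2 = ε ^ 2 + r ^ 2 := Real.sq_sqrt (by positivity)
  unfold regSignDeriv
  simp only [id]
  set S := √(ε ^ 2 + r ^ 2)
  rw [← hsq]
  field_simp
  linear_combination hsq

lemma continuous_regSign (hε : 0 < ε) : Continuous (regSign ε) := (contDiff_regSign hε).continuous

lemma continuous_regSignDeriv (hε : 0 < ε) : Continuous (regSignDeriv ε) := by
  unfold regSignDeriv
  refine continuous_const.div (by fun_prop) fun r => ?_
  have := sqrt_reg_pos hε r
  positivity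

lemma abs_regSign_le (hε : 0 < ε) (r : ℝ) : |regSign ε r| ≤ 1 := by
  unfold regSign
  rw [abs_div, abs_of_pos (sqrt_reg_pos hε r)]
  exact div_le_one_of_le₀ (abs_le_sqrt_reg r) (sqrt_reg_pos hε r).le

lemma regSignDeriv_le (hε : 0 < ε) (r : ℝ) : regSignDeriv ε r ≤ 1 / ε := by
  unfold regSignDeriv
  have h1 := le_sqrt_reg ε r
  rw [div_le_div_iff₀ (by have := sqrt_reg_pos hε r; positivity) hε, one_mul]
  have : ε ^ 2 ≤ ε ^ 2 + r ^ 2 := by nlinarith [sq_nonneg r]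
  gcongr

lemma monotone_regSign (hε : 0 < ε) : Monotone (regSign ε) :=
  monotone_of_hasDerivAt_nonneg (hasDerivAt_regSign hε) fun r => regSignDeriv_nonneg r

/-- `|r| - r * regSign ε r` lies between `0` and `ε`. -/
lemma abs_sub_mul_regSign (hε : 0 < ε) (r : ℝ) :
    0 ≤ |r| * (1 - |regSign ε r|) ∧ |r| * (1 - |regSign ε r|) ≤ ε := by
  refine ⟨mul_nonneg (abs_nonneg r) (sub_nonneg.2 (abs_regSign_le hε r)), ?_⟩
  unfold regSign
  have hs := sqrt_reg_pos hε r
  rw [abs_div, abs_of_pos hs]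
  have h1 := abs_le_sqrt_reg (ε := ε) r
  have h2 : √(ε ^ 2 + r ^ 2) ≤ ε + |r| := by
    rw [Real.sqrt_le_left (by positivity)]
    nlinarith [abs_nonneg r, sq_abs r]
  rw [show |r| * (1 - |r| / √(ε ^ 2 + r ^ 2)) =
    (|r| / √(ε ^ 2 + r ^ 2)) * (√(ε ^ 2 + r ^ 2) - |r|) by field_simp]
  calc _ ≤ 1 * ε := by
        gcongr
        · exact div_le_one_of_le₀ h1 hs.le
        · linarith
    _ = ε := one_mul ε

/-- A primitive of the integrand is -ε²/√(ε² + s²). The value lies between 0 and ε uniformly in R,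
which is what makes the entropies O(ε)-close to their limit. -/
lemma integral_mul_regSignDeriv (hε : 0 < ε) (R : ℝ) :
    ∫ s in (0 : ℝ)..R, s * regSignDeriv ε s = ε - ε ^ 2 / √(ε ^ 2 + R ^ 2) := by
  have h : ∀ s ∈ uIcc 0 R, HasDerivAt (fun s : ℝ => -(ε ^ 2 / √(ε ^ 2 + s ^ 2)))
      (s * regSignDeriv ε s) s := by
    intro s _
    have h1 : HasDerivAt (fun r : ℝ => ε ^ 2 + r ^ 2) (2 * s) s := by
      simpa using (hasDerivAt_pow 2 s).const_add (ε ^ 2)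
    have hs := sqrt_reg_pos hε s
    have h2 := ((hasDerivAt_const s (ε ^ 2)).div (h1.sqrt (by positivity)) hs.ne').neg
    refine h2.congr_deriv ?_
    have hsq : √(ε ^ 2 + s ^ 2) ^ 2 = ε ^ 2 + s ^ 2 := Real.sq_sqrt (by positivity)
    unfold regSignDeriv
    set S := √(ε ^ 2 + s ^ 2)
    rw [← hsq]
    field_simp
    ring
  rw [intervalIntegral.integral_eq_sub_of_hasDerivAt h
    ((continuous_id.mul (continuous_regSignDeriv hε)).intervalIntegrable _ _)]
  have : √(ε ^ 2 + 0 ^ 2) = ε := by simp [Real.sqrt_sq hε.le]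
  rw [this]
  field_simp
  ring

end RegSign

/-! ### Regularised Kruzhkov entropies. -/

/-- The primitive `∫_k^r regSign ε (s - k) dα(s)`, integrated by parts. -/
noncomputable def entropy (α : ℝ → ℝ) (ε r k : ℝ) : ℝ :=
  regSign ε (r - k) * (α r - α k) - ∫ s in (0 : ℝ)..(r - k), regSignDeriv ε s * (α (s + k) - α k)

section Entropy

variable {ε : ℝ} {α : ℝ → ℝ}

lemma continuous_entropy (hε : 0 < ε) (hα : Continuous α) :
    Continuous (fun p : ℝ × ℝ => entropy α ε p.1 p.2) := by
  unfold entropy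
  have h1 := continuous_regSign hε
  have h2 := continuous_regSignDeriv hε
  refine Continuous.sub (by fun_prop) ?_
  exact intervalIntegral.continuous_parametric_intervalIntegral_of_continuous
    (f := fun (p : ℝ × ℝ) s => regSignDeriv ε s * (α (s + p.2) - α p.2)) (by fun_prop) (by fun_prop)

/-- The left side is ∫_x^y H(s - k) dα(s) with H = `regSign ε`, and H(s - k) is compared with its
value at the endpoint y. This convexity inequality replaces the chain rule in time. In the
integrated-by-parts form only the monotonicity of α is needed: α(s + k) is compared with α(x) under
the weight H' ≥ 0. -/
lemma entropy_sub_le (hε : 0 < ε) (hα : Continuous α) (hm : Monotone α) (x y k : ℝ) :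
    entropy α ε y k - entropy α ε x k ≤ (α y - α x) * regSign ε (y - k) := by
  have h2 := continuous_regSignDeriv hε
  have hi : ∀ a b : ℝ, IntervalIntegrable (fun s => regSignDeriv ε s * (α (s + k) - α k))
      volume a b := fun a b => Continuous.intervalIntegrable (by fun_prop) _ _
  have hsub := intervalIntegral.integral_interval_sub_left (hi 0 (y - k)) (hi 0 (x - k))
  have hH : ∫ s in (x - k)..(y - k), regSignDeriv ε s * (α x - α k) =
      (regSign ε (y - k) - regSign ε (x - k)) * (α x - α k) := by
    rw [intervalIntegral.integral_mul_const, intervalIntegral.integral_eq_sub_of_hasDerivAt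
      (fun s _ => hasDerivAt_regSign hε s) (h2.intervalIntegrable _ _)]
  have key : ∫ s in (x - k)..(y - k), regSignDeriv ε s * (α x - α k) ≤
      ∫ s in (x - k)..(y - k), regSignDeriv ε s * (α (s + k) - α k) := by
    have hc : ∀ a b : ℝ, IntervalIntegrable (fun s => regSignDeriv ε s * (α x - α k))
      volume a b := fun a b => Continuous.intervalIntegrable (by fun_prop) _ _
    rcases le_total x y with hxy | hxy
    · refine intervalIntegral.integral_mono_on (by linarith) (hc _ _) (hi _ _) fun s hs => ?_
      have := hm (show x ≤ s + k by linarith [hs.1])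
      exact mul_le_mul_of_nonneg_left (by linarith) (regSignDeriv_nonneg s)
    · rw [intervalIntegral.integral_symm (y - k), intervalIntegral.integral_symm (y - k), neg_le_neg_iff]
      refine intervalIntegral.integral_mono_on (by linarith) (hi _ _) (hc _ _) fun s hs => ?_
      have := hm (show s + k ≤ x by linarith [hs.2])
      exact mul_le_mul_of_nonneg_left (by linarith) (regSignDeriv_nonneg s)
  unfold entropy
  rw [hH] at key
  linarith

/-- Two errors of size at most Lε are added: replacing H(r - k) by the sign costs |α(r) - α(k)| (1 -
|H|) ≤ L |r - k| (1 - |H|), and the integral left by the integration by parts is at most L |∫ s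
H'(s) ds|. -/
lemma abs_entropy_sub_le (hε : 0 < ε) {L : ℝ≥0} (hL : LipschitzWith L α) (hm : Monotone α)
    (r k : ℝ) : |entropy α ε r k - (|α r - α k|)| ≤ 2 * L * ε := by
  have hLip : ∀ a b, |α a - α b| ≤ L * |a - b| := fun a b => by
    simpa [Real.dist_eq] using hL.dist_le_mul a b
  have h1 : regSign ε (r - k) * (α r - α k) = |regSign ε (r - k)| * |α r - α k| := by
    rw [← abs_mul]
    refine (abs_of_nonneg ?_).symm
    rcases le_total k r with h | h
    · have := monotone_regSign hε (sub_nonneg.2 h)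
      rw [regSign_zero] at this
      exact mul_nonneg this (sub_nonneg.2 (hm h))
    · have := monotone_regSign hε (sub_nonpos.2 h)
      rw [regSign_zero] at this
      exact mul_nonneg_of_nonpos_of_nonpos this (sub_nonpos.2 (hm h))
  have h2 : |(∫ s in (0 : ℝ)..(r - k), regSignDeriv ε s * (α (s + k) - α k))| ≤ L * ε := by
    have hint : |(∫ s in (0 : ℝ)..(r - k), (L : ℝ) * (s * regSignDeriv ε s))| ≤ L * ε := by
      rw [intervalIntegral.integral_const_mul, integral_mul_regSignDeriv hε, abs_mul,
        abs_of_nonneg L.coe_nonneg]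
      have hs := sqrt_reg_pos hε (r - k)
      have h3 : ε ^ 2 / √(ε ^ 2 + (r - k) ^ 2) ≤ ε := by
        rw [div_le_iff₀ hs]
        nth_rewrite 1 [sq]
        exact mul_le_mul_of_nonneg_left (le_sqrt_reg ε _) hε.le
      have h4 : 0 ≤ ε ^ 2 / √(ε ^ 2 + (r - k) ^ 2) := by positivity
      gcongr
      rw [abs_of_nonneg (by linarith)]
      linarith
    have hb : ∀ s, ‖regSignDeriv ε s * (α (s + k) - α k)‖ ≤ L * (|s| * regSignDeriv ε s) := by
      intro s
      rw [norm_mul, Real.norm_of_nonneg (regSignDeriv_nonneg s), Real.norm_eq_abs]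
      have := hLip (s + k) k
      rw [add_sub_cancel_right] at this
      nlinarith [regSignDeriv_nonneg (ε := ε) s]
    have hc := continuous_regSignDeriv hε
    rw [← Real.norm_eq_abs]
    rcases le_total 0 (r - k) with h | h
    · refine le_trans (intervalIntegral.norm_integral_le_abs_of_norm_le
        (g := fun s => (L : ℝ) * (s * regSignDeriv ε s)) ((ae_restrict_iff' measurableSet_uIoc).2 (ae_of_all _ fun s => ?_))
        (Continuous.intervalIntegrable (by fun_prop) _ _)) hint
      intro hs
      rw [uIoc_of_le h] at hs
      have := hb s
      rwa [abs_of_pos hs.1] at this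
    · have hint' : |(∫ s in (0 : ℝ)..(r - k), -((L : ℝ) * (s * regSignDeriv ε s)))| ≤ L * ε := by
        rwa [intervalIntegral.integral_neg, abs_neg]
      refine le_trans (intervalIntegral.norm_integral_le_abs_of_norm_le
        (g := fun s => -((L : ℝ) * (s * regSignDeriv ε s))) ((ae_restrict_iff' measurableSet_uIoc).2 (ae_of_all _ fun s => ?_))
        (Continuous.intervalIntegrable (by fun_prop) _ _)) hint'
      intro hs
      rw [uIoc_of_ge h] at hs
      have := hb s
      rw [abs_of_nonpos hs.2] at this
      linarith
  have h3 : |α r - α k| * (1 - |regSign ε (r - k)|) ≤ L * ε := by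
    have h4 := abs_sub_mul_regSign hε (r - k)
    have h5 := sub_nonneg.2 (abs_regSign_le hε (r - k))
    calc _ ≤ L * |r - k| * (1 - |regSign ε (r - k)|) := by gcongr; exact hLip r k
      _ = L * (|r - k| * (1 - |regSign ε (r - k)|)) := by ring
      _ ≤ L * ε := by gcongr; exact h4.2
  have h6 : 0 ≤ |α r - α k| * (1 - |regSign ε (r - k)|) :=
    mul_nonneg (abs_nonneg _) (sub_nonneg.2 (abs_regSign_le hε (r - k)))
  unfold entropy
  rw [h1]
  rw [abs_le] at h2 ⊢
  constructor <;> nlinarith [h2.1, h2.2]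

lemma abs_entropy_le (hε : 0 < ε) {L : ℝ≥0} (hL : LipschitzWith L α) (hm : Monotone α)
    {r k A B : ℝ} (hr : |r| ≤ A) (hk : |k| ≤ B) :
    |entropy α ε r k| ≤ L * (A + B) + 2 * L * ε := by
  have h1 := abs_entropy_sub_le hε hL hm r k
  have h2 : |α r - α k| ≤ L * |r - k| := by simpa [Real.dist_eq] using hL.dist_le_mul r k
  have h3 : |r - k| ≤ A + B := (abs_sub _ _).trans (add_le_add hr hk)
  have h4 : (L : ℝ) * |r - k| ≤ L * (A + B) := by gcongr
  rw [abs_le] at h1 ⊢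
  have h5 := abs_nonneg (α r - α k)
  constructor <;> linarith [h1.1, h1.2]

end Entropy

/-! ### Monotonicity of the flux, and dominated convergence in L^p. -/

/-- Monotonicity of `ξ ↦ |ξ|^p ξ` with `p ≥ 0`. -/
lemma inner_rpow_smul_sub_nonneg {E : Type*} [NormedAddCommGroup E] [InnerProductSpace ℝ E]
    {p : ℝ} (hp : 0 ≤ p) (a b : E) :
    0 ≤ ‖a‖ ^ p * inner ℝ a (a - b) - ‖b‖ ^ p * inner ℝ b (a - b) := by
  rw [inner_sub_right, inner_sub_right, real_inner_self_eq_norm_sq, real_inner_self_eq_norm_sq,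
    real_inner_comm a b]
  have h := real_inner_le_norm a b
  have ha : 0 ≤ ‖a‖ ^ p := by positivity
  have hb : 0 ≤ ‖b‖ ^ p := by positivity
  have hmono : 0 ≤ (‖a‖ ^ p * ‖a‖ - ‖b‖ ^ p * ‖b‖) * (‖a‖ - ‖b‖) := by
    rcases le_total ‖a‖ ‖b‖ with hab | hab
    · have : ‖a‖ ^ p * ‖a‖ ≤ ‖b‖ ^ p * ‖b‖ := by gcongr
      exact mul_nonneg_of_nonpos_of_nonpos (by linarith) (by linarith)
    · have : ‖b‖ ^ p * ‖b‖ ≤ ‖a‖ ^ p * ‖a‖ := by gcongr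
      exact mul_nonneg (by linarith) (by linarith)
  rw [real_inner_comm] at h
  nlinarith [mul_le_mul_of_nonneg_left h ha, mul_le_mul_of_nonneg_left h hb, real_inner_comm a b]

lemma tendsto_eLpNorm_zero_of_dominated {α E E' : Type*} [MeasurableSpace α]
    [NormedAddCommGroup E] [NormedAddCommGroup E'] {μ : Measure α} {p : ℝ≥0∞} (hp0 : p ≠ 0)
    (hp : p ≠ ∞) {F : ℕ → α → E} (g : α → E') (hF : ∀ n, AEStronglyMeasurable (F n) μ)
    (hg : MemLp g p μ) (hb : ∀ n, ∀ᵐ x ∂μ, ‖F n x‖ ≤ ‖g x‖)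
    (hlim : ∀ᵐ x ∂μ, Tendsto (fun n => F n x) atTop (𝓝 0)) :
    Tendsto (fun n => eLpNorm (F n) p μ) atTop (𝓝 0) := by
  have hpr := ENNReal.toReal_pos hp0 hp
  have h : Tendsto (fun n => ∫⁻ x, ‖F n x‖ₑ ^ p.toReal ∂μ) atTop (𝓝 (∫⁻ _, 0 ∂μ)) := by
    refine tendsto_lintegral_of_dominated_convergence' (fun x => ‖g x‖ₑ ^ p.toReal)
      (fun n => (hF n).enorm.pow_const _) (fun n => ?_) ?_ ?_
    · filter_upwards [hb n] with x hx
      gcongr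
      rw [enorm_le_iff_norm_le]
      exact hx
    · exact (lintegral_rpow_enorm_lt_top_of_eLpNorm_lt_top hp0 hp hg.2).ne
    · filter_upwards [hlim] with x hx
      have h1 : Tendsto (fun n => ‖F n x‖ₑ) atTop (𝓝 0) := by
        have := (continuous_enorm.tendsto (0 : E)).comp hx
        rwa [enorm_zero] at this
      have h2 := (ENNReal.continuous_rpow_const (y := p.toReal)).tendsto 0 |>.comp h1
      rwa [ENNReal.zero_rpow_of_pos hpr] at h2
  rw [lintegral_zero] at h
  have h3 := (ENNReal.continuous_rpow_const (y := 1 / p.toReal)).tendsto 0 |>.comp h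
  rw [ENNReal.zero_rpow_of_pos (by positivity)] at h3
  refine h3.congr fun n => ?_
  rw [eLpNorm_eq_lintegral_rpow_enorm_toReal hp0 hp]
  rfl

/-! ### Calculus of test functions. -/

section TestFunctions

variable {N : ℕ} {Ω : Set (Space N)} {φ ψ : Space N → ℝ}

lemma IsTestFunction.differentiable (h : IsTestFunction Ω φ) : Differentiable ℝ φ :=
  h.1.differentiable (by simp)

lemma IsTestFunction.zero : IsTestFunction Ω (fun _ => 0) := by
  refine ⟨contDiff_const, HasCompactSupport.zero, ?_⟩
  have : tsupport (fun _ : Space N => (0 : ℝ)) = ∅ := by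
    rw [tsupport_eq_empty_iff]; rfl
  simp [this]

lemma IsTestFunction.lincomb (h1 : IsTestFunction Ω φ) (h2 : IsTestFunction Ω ψ) (a b : ℝ) :
    IsTestFunction Ω (fun x => a * φ x + b * ψ x) := by
  refine ⟨(contDiff_const.mul h1.1).add (contDiff_const.mul h2.1),
    (h1.2.1.mul_left).add (h2.2.1.mul_left), ?_⟩
  refine (tsupport_add _ _).trans (union_subset ?_ ?_)
  · exact (tsupport_mul_subset_right).trans h1.2.2
  · exact (tsupport_mul_subset_right).trans h2.2.2

lemma gradient_lincomb (h1 : IsTestFunction Ω φ) (h2 : IsTestFunction Ω ψ) (a b : ℝ)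
    (x : Space N) :
    gradient (fun x => a * φ x + b * ψ x) x = a • gradient φ x + b • gradient ψ x := by
  refine HasGradientAt.gradient ?_
  rw [hasGradientAt_iff_hasFDerivAt]
  have h3 := (h1.differentiable x).hasGradientAt.hasFDerivAt
  have h4 := (h2.differentiable x).hasGradientAt.hasFDerivAt
  refine ((h3.const_mul a).add (h4.const_mul b)).congr_fderiv ?_
  simp

lemma IsTestFunction.comp (h : IsTestFunction Ω φ) {H : ℝ → ℝ}
    (hH : ContDiff ℝ ((⊤ : ℕ∞) : WithTop ℕ∞) H) (h0 : H 0 = 0) :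
    IsTestFunction Ω (fun x => H (φ x)) := by
  refine ⟨hH.comp h.1, h.2.1.comp_left h0, ?_⟩
  exact (closure_mono (Function.support_comp_subset h0 φ)).trans h.2.2

lemma gradient_comp (h : IsTestFunction Ω φ) {H H' : ℝ → ℝ}
    (hH : ∀ r, HasDerivAt H (H' r) r) (x : Space N) :
    gradient (fun x => H (φ x)) x = H' (φ x) • gradient φ x := by
  refine HasGradientAt.gradient ?_
  rw [hasGradientAt_iff_hasFDerivAt]
  have h3 := (h.differentiable x).hasGradientAt.hasFDerivAt
  refine ((hH (φ x)).comp_hasFDerivAt x h3).congr_fderiv ?_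
  simp

lemma IsTestFunction.continuous_gradient (h : IsTestFunction Ω φ) :
    Continuous (gradient φ) := by
  have := h.1.continuous_fderiv (by simp)
  exact (InnerProductSpace.toDual ℝ (Space N)).symm.continuous.comp this

lemma IsTestFunction.hasCompactSupport_gradient (h : IsTestFunction Ω φ) :
    HasCompactSupport (gradient φ) := by
  have := h.2.1.fderiv (𝕜 := ℝ)
  exact this.comp_left (map_zero (InnerProductSpace.toDual ℝ (Space N)).symm)

end TestFunctions

/-! ### The space W_0^{1,m}(Ω): linear structure, closedness, chain rule. -/

section MemW0

variable {N : ℕ} {Ω : Set (Space N)} {m : ℝ} {w w₁ w₂ : Space N → ℝ} {G G₁ G₂ : Space N → Space N}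

lemma ofReal_ne_zero_of_one_le (hm : 1 ≤ m) : ENNReal.ofReal m ≠ 0 := by
  rw [Ne, ENNReal.ofReal_eq_zero]; linarith

lemma IsTestFunction.memW0 {φ : Space N → ℝ} (h : IsTestFunction Ω φ) :
    MemW0 Ω m φ (gradient φ) := by
  refine ⟨h.1.continuous.memLp_of_hasCompactSupport h.2.1,
    h.continuous_gradient.memLp_of_hasCompactSupport h.hasCompactSupport_gradient,
    fun _ => φ, fun _ => h, ?_, ?_⟩ <;> simp

lemma MemW0.zero : MemW0 Ω m (fun _ => 0) (fun _ => 0) := by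
  have h := (IsTestFunction.zero (Ω := Ω)).memW0 (m := m)
  have h0 : gradient (fun _ : Space N => (0 : ℝ)) = fun _ => 0 := by
    ext1 x; exact gradient_fun_const x 0
  rwa [h0] at h

lemma MemW0.congr (h : MemW0 Ω m w₁ G₁) (hw : w₁ =ᵐ[volume.restrict Ω] w₂)
    (hG : G₁ =ᵐ[volume.restrict Ω] G₂) : MemW0 Ω m w₂ G₂ := by
  obtain ⟨h1, h2, φ, hφ, h3, h4⟩ := h
  refine ⟨h1.ae_eq hw, h2.ae_eq hG, φ, hφ, h3.congr fun n => ?_, h4.congr fun n => ?_⟩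
  · refine eLpNorm_congr_ae ?_
    filter_upwards [hw] with x hx
    rw [hx]
  · refine eLpNorm_congr_ae ?_
    filter_upwards [hG] with x hx
    rw [hx]

lemma IsTestFunction.aestronglyMeasurable {φ : Space N → ℝ} (h : IsTestFunction Ω φ)
    (μ : Measure (Space N)) : AEStronglyMeasurable φ μ :=
  h.1.continuous.aestronglyMeasurable

lemma IsTestFunction.aestronglyMeasurable_gradient {φ : Space N → ℝ} (h : IsTestFunction Ω φ)
    (μ : Measure (Space N)) : AEStronglyMeasurable (gradient φ) μ :=
  h.continuous_gradient.aestronglyMeasurable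

/-- A closure is closed: the n-th pair is approximated by a test function up to 1/(n + 1), and the
triangle inequality does the rest. -/
lemma MemW0.of_tendsto (hm : 1 ≤ m) (hw : MemLp w (ENNReal.ofReal m) (volume.restrict Ω))
    (hG : MemLp G (ENNReal.ofReal m) (volume.restrict Ω)) {u : ℕ → Space N → ℝ}
    {V : ℕ → Space N → Space N} (huV : ∀ n, MemW0 Ω m (u n) (V n))
    (hu : Tendsto (fun n => eLpNorm (fun x => u n x - w x) (ENNReal.ofReal m) (volume.restrict Ω))
      atTop (𝓝 0))
    (hV : Tendsto (fun n => eLpNorm (fun x => V n x - G x) (ENNReal.ofReal m) (volume.restrict Ω))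
      atTop (𝓝 0)) : MemW0 Ω m w G := by
  have hp : 1 ≤ ENNReal.ofReal m := by simpa using ENNReal.ofReal_le_ofReal hm
  have key : ∀ n : ℕ, ∃ φ : Space N → ℝ, IsTestFunction Ω φ ∧
      eLpNorm (fun x => φ x - u n x) (ENNReal.ofReal m) (volume.restrict Ω) ≤ (n + 1 : ℝ≥0∞)⁻¹ ∧
      eLpNorm (fun x => gradient φ x - V n x) (ENNReal.ofReal m) (volume.restrict Ω) ≤
        (n + 1 : ℝ≥0∞)⁻¹ := by
    intro n
    obtain ⟨-, -, φ, hφ, h3, h4⟩ := huV n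
    have hpos : (0 : ℝ≥0∞) < (n + 1 : ℝ≥0∞)⁻¹ := by simp
    obtain ⟨j, hj⟩ := ((h3.eventually_le_const hpos).and (h4.eventually_le_const hpos)).exists
    exact ⟨φ j, hφ j, hj⟩
  choose φ hφ h1 h2 using key
  have hlim : Tendsto (fun n : ℕ => (n + 1 : ℝ≥0∞)⁻¹) atTop (𝓝 0) := by
    have := ENNReal.tendsto_inv_nat_nhds_zero.comp (tendsto_add_atTop_nat 1)
    refine this.congr fun n => ?_
    simp
  refine ⟨hw, hG, φ, hφ, ?_, ?_⟩
  · refine tendsto_of_tendsto_of_tendsto_of_le_of_le tendsto_const_nhds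
      (by simpa using hlim.add hu) (fun _ => zero_le) fun n => ?_
    have : (fun x => φ n x - w x) = (fun x => φ n x - u n x) + fun x => u n x - w x := by
      ext x; simp
    rw [this]
    exact (eLpNorm_add_le (((hφ n).aestronglyMeasurable _).sub (huV n).1.1)
      ((huV n).1.1.sub hw.1) hp).trans (add_le_add_left (h1 n) _)
  · refine tendsto_of_tendsto_of_tendsto_of_le_of_le tendsto_const_nhds
      (by simpa using hlim.add hV) (fun _ => zero_le) fun n => ?_
    have : (fun x => gradient (φ n) x - G x) =
        (fun x => gradient (φ n) x - V n x) + fun x => V n x - G x := by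
      ext1 x; simp
    rw [this]
    exact (eLpNorm_add_le (((hφ n).aestronglyMeasurable_gradient _).sub (huV n).2.1.1)
      ((huV n).2.1.1.sub hG.1) hp).trans (add_le_add_left (h2 n) _)

lemma tendsto_eLpNorm_lincomb {α E : Type*} [MeasurableSpace α] [NormedAddCommGroup E]
    [NormedSpace ℝ E] {μ : Measure α} {p : ℝ≥0∞} (hp : 1 ≤ p) {f g : ℕ → α → E} {f₀ g₀ : α → E}
    (hf : ∀ n, AEStronglyMeasurable (f n) μ) (hg : ∀ n, AEStronglyMeasurable (g n) μ)
    (hf₀ : AEStronglyMeasurable f₀ μ) (hg₀ : AEStronglyMeasurable g₀ μ)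
    (h1 : Tendsto (fun n => eLpNorm (fun x => f n x - f₀ x) p μ) atTop (𝓝 0))
    (h2 : Tendsto (fun n => eLpNorm (fun x => g n x - g₀ x) p μ) atTop (𝓝 0)) (a b : ℝ) :
    Tendsto (fun n => eLpNorm (fun x => (a • f n x + b • g n x) - (a • f₀ x + b • g₀ x)) p μ)
      atTop (𝓝 0) := by
  have hlim : Tendsto (fun n => ‖a‖ₑ * eLpNorm (fun x => f n x - f₀ x) p μ +
      ‖b‖ₑ * eLpNorm (fun x => g n x - g₀ x) p μ) atTop (𝓝 0) := by
    simpa using (ENNReal.Tendsto.const_mul h1 (Or.inr enorm_ne_top)).add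
      (ENNReal.Tendsto.const_mul h2 (Or.inr enorm_ne_top))
  refine tendsto_of_tendsto_of_tendsto_of_le_of_le tendsto_const_nhds hlim
    (fun _ => zero_le) fun n => ?_
  have : (fun x => (a • f n x + b • g n x) - (a • f₀ x + b • g₀ x)) =
      a • (fun x => f n x - f₀ x) + b • (fun x => g n x - g₀ x) := by
    ext x; simp only [Pi.add_apply, Pi.smul_apply, smul_sub]; abel
  rw [this]
  refine (eLpNorm_add_le (((hf n).sub hf₀).const_smul a) (((hg n).sub hg₀).const_smul b) hp).trans ?_
  exact add_le_add eLpNorm_const_smul_le eLpNorm_const_smul_le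

lemma MemW0.lincomb (hm : 1 ≤ m) (h1 : MemW0 Ω m w₁ G₁) (h2 : MemW0 Ω m w₂ G₂) (a b : ℝ) :
    MemW0 Ω m (fun x => a * w₁ x + b * w₂ x) (fun x => a • G₁ x + b • G₂ x) := by
  have hp : 1 ≤ ENNReal.ofReal m := by simpa using ENNReal.ofReal_le_ofReal hm
  obtain ⟨hw1, hG1, φ, hφ, h3, h4⟩ := h1
  obtain ⟨hw2, hG2, ψ, hψ, h5, h6⟩ := h2
  refine ⟨(hw1.const_mul a).add (hw2.const_mul b), (hG1.const_smul a).add (hG2.const_smul b),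
    fun n x => a * φ n x + b * ψ n x, fun n => (hφ n).lincomb (hψ n) a b, ?_, ?_⟩
  · exact tendsto_eLpNorm_lincomb hp (fun n => (hφ n).aestronglyMeasurable _)
      (fun n => (hψ n).aestronglyMeasurable _) hw1.1 hw2.1 h3 h5 a b
  · simp_rw [fun n => gradient_lincomb (hφ n) (hψ n) a b]
    exact tendsto_eLpNorm_lincomb hp (fun n => (hφ n).aestronglyMeasurable_gradient _)
      (fun n => (hψ n).aestronglyMeasurable_gradient _) hG1.1 hG2.1 h4 h6 a b

lemma MemW0.sub (hm : 1 ≤ m) (h1 : MemW0 Ω m w₁ G₁) (h2 : MemW0 Ω m w₂ G₂) :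
    MemW0 Ω m (fun x => w₁ x - w₂ x) (fun x => G₁ x - G₂ x) := by
  simpa [sub_eq_add_neg] using h1.lincomb hm h2 1 (-1)

lemma MemW0.const_mul (hm : 1 ≤ m) (h1 : MemW0 Ω m w G) (a : ℝ) :
    MemW0 Ω m (fun x => a * w x) (fun x => a • G x) := by
  simpa using h1.lincomb hm h1 a 0

/-- The chain rule in `W_0^{1,m}` for smooth functions with bounded derivative. -/
lemma MemW0.comp (hm : 1 ≤ m) (h : MemW0 Ω m w G) {H H' : ℝ → ℝ} {C : ℝ}
    (hH : ContDiff ℝ ((⊤ : ℕ∞) : WithTop ℕ∞) H) (h0 : H 0 = 0)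
    (hH' : ∀ r, HasDerivAt H (H' r) r) (hc : Continuous H') (hC : ∀ r, |H' r| ≤ C) :
    MemW0 Ω m (fun x => H (w x)) (fun x => H' (w x) • G x) := by
  have hp : 1 ≤ ENNReal.ofReal m := by simpa using ENNReal.ofReal_le_ofReal hm
  have hp0 := ofReal_ne_zero_of_one_le hm
  have hC0 : 0 ≤ C := (abs_nonneg _).trans (hC 0)
  have hLip : ∀ a b, |H a - H b| ≤ C * |a - b| := by
    intro a b
    have hL : LipschitzWith C.toNNReal H := by
      refine lipschitzWith_of_nnnorm_deriv_le (fun r => (hH' r).differentiableAt) fun r => ?_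
      rw [(hH' r).deriv, ← NNReal.coe_le_coe, Real.coe_toNNReal _ hC0]
      exact hC r
    simpa [Real.dist_eq, Real.coe_toNNReal _ hC0] using hL.dist_le_mul a b
  obtain ⟨hw, hG, φ, hφ, h3, h4⟩ := h
  obtain ⟨ns, hns, hae⟩ := (tendstoInMeasure_of_tendsto_eLpNorm hp0
    (fun n => (hφ n).aestronglyMeasurable _) hw.1 h3).exists_seq_tendsto_ae
  have hHw : AEStronglyMeasurable (fun x => H' (w x)) (volume.restrict Ω) :=
    hc.comp_aestronglyMeasurable hw.1
  have hHφ : ∀ n, AEStronglyMeasurable (fun x => H' (φ n x)) (volume.restrict Ω) :=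
    fun n => hc.comp_aestronglyMeasurable ((hφ n).aestronglyMeasurable _)
  refine ⟨?_, ?_, fun n x => H (φ (ns n) x), fun n => (hφ _).comp hH h0, ?_, ?_⟩
  · refine hw.of_le_mul (c := C) (hH.continuous.comp_aestronglyMeasurable hw.1)
      (ae_of_all _ fun x => ?_)
    simpa [h0] using hLip (w x) 0
  · refine hG.of_le_mul (c := C) (hHw.smul hG.1) (ae_of_all _ fun x => ?_)
    rw [norm_smul]
    exact mul_le_mul_of_nonneg_right (hC _) (norm_nonneg _)
  · have := ENNReal.Tendsto.const_mul (a := ENNReal.ofReal C) (h3.comp hns.tendsto_atTop)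
      (Or.inr ENNReal.ofReal_ne_top)
    rw [mul_zero] at this
    refine tendsto_of_tendsto_of_tendsto_of_le_of_le tendsto_const_nhds this
      (fun _ => zero_le) fun n => ?_
    exact eLpNorm_le_mul_eLpNorm_of_ae_le_mul (ae_of_all _ fun x => hLip _ _) _
  -- The gradient error is split as H'(φ)(∇φ - G) + (H'(φ) - H'(w))G. The first part is at most C
  -- |∇φ - G|. The second tends to zero by dominated convergence, for which the almost everywhere
  -- convergence along the subsequence `ns` is needed.
  · simp_rw [fun n => gradient_comp (hφ n) hH']
    have hA := ENNReal.Tendsto.const_mul (a := ENNReal.ofReal C) (h4.comp hns.tendsto_atTop)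
      (Or.inr ENNReal.ofReal_ne_top)
    rw [mul_zero] at hA
    have hB : Tendsto (fun n => eLpNorm (fun x => (H' (φ (ns n) x) - H' (w x)) • G x)
        (ENNReal.ofReal m) (volume.restrict Ω)) atTop (𝓝 0) := by
      refine tendsto_eLpNorm_zero_of_dominated hp0 ENNReal.ofReal_ne_top (fun x => (2 * C) • G x)
        (fun n => ((hHφ _).sub hHw).smul hG.1) (hG.const_smul (2 * C)) (fun n => ae_of_all _ fun x => ?_) ?_
      · rw [norm_smul, norm_smul, Real.norm_of_nonneg (by positivity : 0 ≤ 2 * C)]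
        gcongr
        have h5 := norm_sub_le (H' (φ (ns n) x)) (H' (w x))
        have h6 := hC (φ (ns n) x)
        have h7 := hC (w x)
        simp only [Real.norm_eq_abs] at h5 ⊢
        linarith
      · filter_upwards [hae] with x hx
        have h5 : Tendsto (fun n => (H' (φ (ns n) x) - H' (w x)) • G x) atTop
            (𝓝 ((H' (w x) - H' (w x)) • G x)) :=
          (((hc.tendsto _).comp hx).sub_const _).smul_const _
        simpa using h5
    have hAB := hA.add hB
    rw [add_zero] at hAB
    refine tendsto_of_tendsto_of_tendsto_of_le_of_le tendsto_const_nhds hAB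
      (fun _ => zero_le) fun n => ?_
    have : (fun x => H' (φ (ns n) x) • gradient (φ (ns n)) x - H' (w x) • G x) =
        (fun x => H' (φ (ns n) x) • (gradient (φ (ns n)) x - G x)) +
          fun x => (H' (φ (ns n) x) - H' (w x)) • G x := by
      ext1 x; simp only [Pi.add_apply, smul_sub, sub_smul]; abel
    rw [this]
    refine (eLpNorm_add_le ((hHφ _).smul (((hφ _).aestronglyMeasurable_gradient _).sub hG.1))
      (((hHφ _).sub hHw).smul hG.1) hp).trans (add_le_add_left ?_ _)
    refine eLpNorm_le_mul_eLpNorm_of_ae_le_mul (ae_of_all _ fun x => ?_) _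
    change ‖H' (φ (ns n) x) • (gradient (φ (ns n)) x - G x)‖ ≤ _
    rw [norm_smul]
    exact mul_le_mul_of_nonneg_right (hC _) (norm_nonneg _)

lemma MemW0.regSign_sub (hm : 1 ≤ m) (h1 : MemW0 Ω m w₁ G₁) (h2 : MemW0 Ω m w₂ G₂) {ε : ℝ}
    (hε : 0 < ε) : MemW0 Ω m (fun x => regSign ε (w₁ x - w₂ x))
      (fun x => regSignDeriv ε (w₁ x - w₂ x) • (G₁ x - G₂ x)) :=
  (h1.sub hm h2).comp hm (contDiff_regSign hε) regSign_zero (hasDerivAt_regSign hε)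
    (continuous_regSignDeriv hε) (C := 1 / ε) fun r => by
      rw [abs_of_nonneg (regSignDeriv_nonneg r)]; exact regSignDeriv_le hε r

end MemW0

/-! ### Time translations and Steklov averages in L^p(ℝ × Ω). -/

section Steklov

variable {N : ℕ} {μ : Measure (Space N)} [IsFiniteMeasure μ]
  {E : Type*} [NormedAddCommGroup E]

/-- Translation in time. -/
def timeShift (N : ℕ) (r : ℝ) : C(ℝ × Space N, ℝ × Space N) :=
  ⟨fun z => (z.1 + r, z.2), by fun_prop⟩

lemma measurePreserving_timeShift (μ : Measure (Space N)) [IsFiniteMeasure μ] (r : ℝ) :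
    MeasurePreserving (timeShift N r) ((volume : Measure ℝ).prod μ) ((volume : Measure ℝ).prod μ) :=
  (measurePreserving_add_right volume r).prod (MeasurePreserving.id μ)

lemma continuous_timeShift : Continuous (timeShift N) := by
  refine ContinuousMap.continuous_of_continuous_uncurry _ ?_
  simp only [timeShift, Function.uncurry_def, ContinuousMap.coe_mk]
  fun_prop

/-- The time translations of an element of `L^p`. -/
noncomputable def shiftLp {p : ℝ≥0∞} {f : ℝ × Space N → E}
    (hf : MemLp f p ((volume : Measure ℝ).prod μ)) (r : ℝ) : Lp E p ((volume : Measure ℝ).prod μ) :=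
  Lp.compMeasurePreserving (timeShift N r) (measurePreserving_timeShift μ r) (hf.toLp f)

lemma coeFn_shiftLp {p : ℝ≥0∞} {f : ℝ × Space N → E}
    (hf : MemLp f p ((volume : Measure ℝ).prod μ)) (r : ℝ) :
    shiftLp hf r =ᵐ[(volume : Measure ℝ).prod μ] fun z => f (z.1 + r, z.2) := by
  unfold shiftLp
  rw [Lp.toLp_compMeasurePreserving]
  exact MemLp.coeFn_toLp _

lemma continuous_shiftLp {p : ℝ≥0∞} [Fact (1 ≤ p)] (hp : p ≠ ∞) {f : ℝ × Space N → E}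
    (hf : MemLp f p ((volume : Measure ℝ).prod μ)) : Continuous (shiftLp hf) :=
  continuous_const.compMeasurePreservingLp continuous_timeShift
    (fun r => measurePreserving_timeShift μ r) hp

/-- Continuity of time translations in `L^p`. -/
lemma tendsto_eLpNorm_timeShift_sub {p : ℝ≥0∞} (h1 : 1 ≤ p) (hp : p ≠ ∞) {f : ℝ × Space N → E}
    (hf : MemLp f p ((volume : Measure ℝ).prod μ)) :
    Tendsto (fun r : ℝ => eLpNorm (fun z => f (z.1 + r, z.2) - f z) p ((volume : Measure ℝ).prod μ))
      (𝓝 0) (𝓝 0) := by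
  have : Fact (1 ≤ p) := ⟨h1⟩
  have h := ((continuous_shiftLp hp hf).tendsto 0)
  rw [Lp.tendsto_Lp_iff_tendsto_eLpNorm'] at h
  refine h.congr fun r => eLpNorm_congr_ae ?_
  filter_upwards [coeFn_shiftLp hf r, coeFn_shiftLp hf 0] with z h2 h3
  simp [h2, h3]

/-- The L¹ norm of a translate does not depend on the shift. This justifies Fubini for the pointwise
averages in `steklov`. -/
lemma integrable_timeShift_prod {f : ℝ × Space N → E} (hm : StronglyMeasurable f)
    (hf : Integrable f ((volume : Measure ℝ).prod μ)) (h : ℝ) :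
    Integrable (fun q : ℝ × (ℝ × Space N) => f (q.2.1 + q.1, q.2.2))
      ((volume.restrict (Ioc 0 h)).prod ((volume : Measure ℝ).prod μ)) := by
  have hmeas : StronglyMeasurable (fun q : ℝ × (ℝ × Space N) => f (q.2.1 + q.1, q.2.2)) :=
    hm.comp_measurable (by fun_prop)
  rw [integrable_prod_iff hmeas.aestronglyMeasurable]
  have hn : ∀ r : ℝ, ∫ z, ‖f (z.1 + r, z.2)‖ ∂((volume : Measure ℝ).prod μ) =
      ∫ z, ‖f z‖ ∂((volume : Measure ℝ).prod μ) := fun r => by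
    have hmp := measurePreserving_timeShift μ r
    have h1 := integral_map (μ := (volume : Measure ℝ).prod μ) hmp.measurable.aemeasurable
      (f := fun z => ‖f z‖) hm.norm.aestronglyMeasurable
    rw [hmp.map_eq] at h1
    exact h1.symm
  refine ⟨ae_of_all _ fun r => ?_, ?_⟩
  · exact (measurePreserving_timeShift μ r).integrable_comp_of_integrable hf
  · simp_rw [hn]
    exact integrable_const _

variable [NormedSpace ℝ E]

/-- The forward time average over an interval of length `h`. -/
noncomputable def steklov (f : ℝ × Space N → E) (h : ℝ) (z : ℝ × Space N) : E :=
  ⨍ r in Ioc 0 h, f (z.1 + r, z.2)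

variable [CompleteSpace E]

/-- The Bochner average of the translates, an element of L^p, is identified with the pointwise
average by comparing integrals over sets s of finite measure: g ↦ ∫_s g is a continuous functional
on L^p, so it commutes with the Bochner integral, and Fubini treats the other side. The Bochner form
gives access to closed convex sets, the pointwise form to explicit computation. -/
lemma coeFn_average_shiftLp {p : ℝ≥0∞} [Fact (1 ≤ p)] (hp : p ≠ ∞) {f : ℝ × Space N → E}
    (hm : StronglyMeasurable f) (hf : MemLp f p ((volume : Measure ℝ).prod μ))
    (hf1 : Integrable f ((volume : Measure ℝ).prod μ)) {h : ℝ} :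
    ((⨍ r in Ioc 0 h, shiftLp hf r : Lp E p ((volume : Measure ℝ).prod μ)) :
      ℝ × Space N → E) =ᵐ[(volume : Measure ℝ).prod μ] steklov f h := by
  have hp1 : 1 ≤ p := Fact.out
  have hprod := integrable_timeShift_prod hm hf1 h
  have hint : IntegrableOn (shiftLp hf) (Ioc 0 h) :=
    (continuous_shiftLp hp hf).integrableOn_Ioc
  refine ae_eq_of_forall_setIntegral_eq_of_sigmaFinite (fun s _ hs => ?_) (fun s _ hs => ?_)
    fun s hms hs => ?_
  · have : IsFiniteMeasure (((volume : Measure ℝ).prod μ).restrict s) := ⟨by simpa using hs⟩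
    exact ((Lp.memLp _).restrict s).integrable hp1
  · refine Integrable.integrableOn ?_
    have := hprod.integral_prod_right
    unfold steklov
    simp_rw [setAverage_eq]
    exact this.smul _
  · obtain ⟨q, hq⟩ : ∃ q, ENNReal.HolderConjugate p q :=
      ⟨p.conjExponent, ENNReal.HolderConjugate.conjExponent hp1⟩
    have : Fact (1 ≤ q) := ⟨hq.symm.one_le⟩
    let B : E →L[ℝ] ℝ →L[ℝ] E := (ContinuousLinearMap.lsmul ℝ ℝ).flip
    let ℓ : Lp E p ((volume : Measure ℝ).prod μ) →L[ℝ] E :=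
      (B.lpPairing ((volume : Measure ℝ).prod μ) p q).flip (indicatorConstLp q hms hs.ne 1)
    have hℓ : ∀ g : Lp E p ((volume : Measure ℝ).prod μ),
        ℓ g = ∫ z in s, g z ∂((volume : Measure ℝ).prod μ) := by
      intro g
      simp only [ℓ, ContinuousLinearMap.flip_apply]
      rw [ContinuousLinearMap.lpPairing_eq_integral, ← integral_indicator hms]
      refine integral_congr_ae ?_
      filter_upwards [indicatorConstLp_coeFn (p := q) (hs := hms) (hμs := hs.ne) (c := (1 : ℝ))]
        with z hz
      rw [hz]
      by_cases hzs : z ∈ s <;> simp [B, hzs]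
    rw [← hℓ, setAverage_eq, map_smul, ← ContinuousLinearMap.integral_comp_comm _ hint]
    unfold steklov
    simp_rw [setAverage_eq]
    rw [integral_smul, integral_integral_swap]
    · congr 1
      refine integral_congr_ae (ae_of_all _ fun r => ?_)
      simp only
      rw [hℓ]
      exact integral_congr_ae (ae_restrict_of_ae (coeFn_shiftLp hf r))
    · have h1 := hprod.swap.restrict (s := s ×ˢ univ)
      rwa [← Measure.prod_restrict, Measure.restrict_univ] at h1

/-- For small h all translates involved lie in a closed ball around f, by continuity of translations
in L^p; balls are convex, so the average lies in it too. -/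
lemma tendsto_eLpNorm_steklov_sub {p : ℝ≥0∞} (h1 : 1 ≤ p) (hp : p ≠ ∞) {f : ℝ × Space N → E}
    (hm : StronglyMeasurable f) (hf : MemLp f p ((volume : Measure ℝ).prod μ))
    (hf1 : Integrable f ((volume : Measure ℝ).prod μ)) :
    Tendsto (fun h => eLpNorm (fun z => steklov f h z - f z) p ((volume : Measure ℝ).prod μ))
      (𝓝[>] 0) (𝓝 0) := by
  have : Fact (1 ≤ p) := ⟨h1⟩
  have hlim : Tendsto (fun h => (⨍ r in Ioc 0 h, shiftLp hf r)) (𝓝[>] 0) (𝓝 (shiftLp hf 0)) := by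
    rw [Metric.tendsto_nhdsWithin_nhds]
    intro ε hε
    obtain ⟨δ, hδ, H⟩ := Metric.continuous_iff.1 (continuous_shiftLp hp hf) 0 (ε / 2) (by positivity)
    refine ⟨δ, hδ, fun h (hh : 0 < h) hd => ?_⟩
    rw [Real.dist_eq, sub_zero, abs_of_pos hh] at hd
    have := Convex.set_average_mem (μ := (volume : Measure ℝ)) (t := Ioc 0 h)
      (convex_closedBall (shiftLp hf 0) (ε / 2)) Metric.isClosed_closedBall (by simpa using hh)
      (by simp) (f := shiftLp hf) (ae_restrict_of_forall_mem measurableSet_Ioc fun r hr => ?_)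
      (continuous_shiftLp hp hf).integrableOn_Ioc
    · exact (Metric.mem_closedBall.1 this).trans_lt (by linarith)
    · refine (H r ?_).le
      rw [Real.dist_eq, sub_zero, abs_of_pos hr.1]
      exact hr.2.trans_lt hd
  rw [Lp.tendsto_Lp_iff_tendsto_eLpNorm'] at hlim
  refine hlim.congr fun h => eLpNorm_congr_ae ?_
  filter_upwards [coeFn_average_shiftLp hp hm hf hf1 (h := h), coeFn_shiftLp hf 0] with z h2 h3
  simp [h2, h3]

lemma memLp_steklov {p : ℝ≥0∞} (h1 : 1 ≤ p) (hp : p ≠ ∞) {f : ℝ × Space N → E}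
    (hm : StronglyMeasurable f) (hf : MemLp f p ((volume : Measure ℝ).prod μ))
    (hf1 : Integrable f ((volume : Measure ℝ).prod μ)) (h : ℝ) :
    MemLp (steklov f h) p ((volume : Measure ℝ).prod μ) := by
  have : Fact (1 ≤ p) := ⟨h1⟩
  exact (Lp.memLp _).ae_eq (coeFn_average_shiftLp hp hm hf hf1)

end Steklov

/-! ### Sections of functions in L^p of a product. -/

section Sections

variable {α β E : Type*} [MeasurableSpace α] [MeasurableSpace β] [NormedAddCommGroup E]
  {μ : Measure α} {ν : Measure β} [SFinite ν]

lemma memLp_prodMk_left {p : ℝ≥0∞} (hp0 : p ≠ 0) (hp : p ≠ ∞) {f : α × β → E}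
    (hf : MemLp f p (μ.prod ν)) : ∀ᵐ s ∂μ, MemLp (fun x => f (s, x)) p ν := by
  have h1 := lintegral_rpow_enorm_lt_top_of_eLpNorm_lt_top hp0 hp hf.2
  rw [lintegral_prod _ (hf.1.enorm.pow_const _)] at h1
  have h2 := ae_lt_top' (hf.1.enorm.pow_const _).lintegral_prod_right' h1.ne
  filter_upwards [h2, hf.1.prodMk_left] with s hs hsm
  exact ⟨hsm, (eLpNorm_lt_top_iff_lintegral_rpow_enorm_lt_top hp0 hp).2 hs⟩

/-- Convergence in `L^p` of a product gives convergence in `L^p` of almost all sections along a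
subsequence. -/
lemma exists_seq_tendsto_eLpNorm_prodMk_left {p : ℝ≥0∞} (hp0 : p ≠ 0) (hp : p ≠ ∞)
    {f : ℕ → α × β → E} (hf : ∀ n, AEStronglyMeasurable (f n) (μ.prod ν))
    (h : Tendsto (fun n => eLpNorm (f n) p (μ.prod ν)) atTop (𝓝 0)) :
    ∃ ns : ℕ → ℕ, ∀ᵐ s ∂μ, Tendsto (fun n => eLpNorm (fun x => f (ns n) (s, x)) p ν) atTop (𝓝 0) := by
  have hpr := ENNReal.toReal_pos hp0 hp
  have h1 : Tendsto (fun n => ∫⁻ z, ‖f n z‖ₑ ^ p.toReal ∂(μ.prod ν)) atTop (𝓝 0) := by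
    have h3 := (ENNReal.continuous_rpow_const (y := p.toReal)).tendsto 0 |>.comp h
    rw [ENNReal.zero_rpow_of_pos hpr] at h3
    refine h3.congr fun n => ?_
    rw [Function.comp_apply, eLpNorm_eq_lintegral_rpow_enorm_toReal hp0 hp, ← ENNReal.rpow_mul,
      one_div_mul_cancel hpr.ne', ENNReal.rpow_one]
  -- A summable rate makes the series of the section integrals finite for almost every s, so its
  -- terms tend to zero.
  have key : ∀ k : ℕ, ∃ n, ∫⁻ z, ‖f n z‖ₑ ^ p.toReal ∂(μ.prod ν) ≤ 2⁻¹ ^ k := fun k =>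
    (h1.eventually_le_const (by simp [ENNReal.pow_pos] : (0 : ℝ≥0∞) < 2⁻¹ ^ k)).exists
  choose ns hns using key
  refine ⟨ns, ?_⟩
  have h2 : ∫⁻ s, ∑' k, ∫⁻ x, ‖f (ns k) (s, x)‖ₑ ^ p.toReal ∂ν ∂μ ≠ ∞ := by
    rw [lintegral_tsum fun k => ((hf (ns k)).enorm.pow_const _).lintegral_prod_right']
    refine ne_top_of_le_ne_top (b := ∑' k : ℕ, (2⁻¹ : ℝ≥0∞) ^ k) (by simp) ?_
    refine ENNReal.tsum_le_tsum fun k => ?_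
    rw [← lintegral_prod _ ((hf (ns k)).enorm.pow_const _)]
    exact hns k
  have h3 := ae_lt_top' (AEMeasurable.tsum
    fun k => ((hf (ns k)).enorm.pow_const _).lintegral_prod_right') h2
  filter_upwards [h3] with s hs
  have h4 := ENNReal.tendsto_atTop_zero_of_tsum_ne_top hs.ne
  have h5 := (ENNReal.continuous_rpow_const (y := 1 / p.toReal)).tendsto 0 |>.comp h4
  rw [ENNReal.zero_rpow_of_pos (by positivity)] at h5
  refine h5.congr fun n => ?_
  rw [eLpNorm_eq_lintegral_rpow_enorm_toReal hp0 hp]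
  rfl

end Sections

/-! ### Steklov averages of W_0^{1,m}-valued functions. -/

section SteklovMemW0

variable {N : ℕ} {Ω : Set (Space N)} {m : ℝ}

/-- The elements of `L^m(ℝ; W_0^{1,m}(Ω))`. -/
def timeW0 (Ω : Set (Space N)) (m : ℝ) :
    Set (Lp (ℝ × Space N) (ENNReal.ofReal m) ((volume : Measure ℝ).prod (volume.restrict Ω))) :=
  {W | ∀ᵐ s : ℝ, MemW0 Ω m (fun x => (W (s, x)).1) (fun x => (W (s, x)).2)}

lemma convex_timeW0 (hm : 1 ≤ m) : Convex ℝ (timeW0 Ω m) := by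
  intro W hW V hV a b _ _ _
  have h : ((a • W + b • V : Lp (ℝ × Space N) (ENNReal.ofReal m) _) : ℝ × Space N → ℝ × Space N)
      =ᵐ[(volume : Measure ℝ).prod (volume.restrict Ω)] fun z => a • W z + b • V z := by
    filter_upwards [Lp.coeFn_add (a • W) (b • V), Lp.coeFn_smul a W, Lp.coeFn_smul b V]
      with z h1 h2 h3
    rw [h1, Pi.add_apply, h2, h3]; rfl
  simp only [timeW0, mem_ofPred_eq] at hW hV ⊢
  filter_upwards [hW, hV, Measure.ae_ae_of_ae_prod h] with s h1 h2 h3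
  refine (h1.lincomb hm h2 a b).congr ?_ ?_ <;>
  · filter_upwards [h3] with x hx
    rw [hx]
    simp

/-- Convergence in L^m of the product passes to almost all time slices along a subsequence, and
W_0^{1,m}(Ω) is closed slice by slice. -/
lemma isClosed_timeW0 [Fact (1 ≤ ENNReal.ofReal m)] (hm : 1 ≤ m) : IsClosed (timeW0 Ω m) := by
  refine IsSeqClosed.isClosed fun W V hW hWV => ?_
  have hp0 := ofReal_ne_zero_of_one_le hm
  rw [Lp.tendsto_Lp_iff_tendsto_eLpNorm'] at hWV
  obtain ⟨ns, hns⟩ := exists_seq_tendsto_eLpNorm_prodMk_left hp0 ENNReal.ofReal_ne_top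
    (fun n => (Lp.aestronglyMeasurable (W n)).sub (Lp.aestronglyMeasurable V)) hWV
  simp only [timeW0, mem_ofPred_eq] at hW ⊢
  filter_upwards [hns, ae_all_iff.2 hW, memLp_prodMk_left hp0 ENNReal.ofReal_ne_top (Lp.memLp V)]
    with s h1 h2 h3
  refine MemW0.of_tendsto hm h3.fst h3.snd (fun n => h2 (ns n)) ?_ ?_ <;>
  refine tendsto_of_tendsto_of_tendsto_of_le_of_le tendsto_const_nhds h1
      (fun _ => zero_le) fun n => eLpNorm_mono fun x => ?_
  · exact norm_fst_le (W (ns n) (s, x) - V (s, x))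
  · exact norm_snd_le (W (ns n) (s, x) - V (s, x))

/-- All translates lie in the closed convex set `timeW0`, hence so does their average. Treating the
function and its gradient as one pair averages both at once. -/
lemma memW0_steklov [IsFiniteMeasure (volume.restrict Ω)] (hm : 1 ≤ m) {f : ℝ × Space N → ℝ × Space N} (hmf : StronglyMeasurable f)
    (hf : MemLp f (ENNReal.ofReal m) ((volume : Measure ℝ).prod (volume.restrict Ω)))
    (hf1 : Integrable f ((volume : Measure ℝ).prod (volume.restrict Ω)))
    (hW : ∀ᵐ s : ℝ, MemW0 Ω m (fun x => (f (s, x)).1) (fun x => (f (s, x)).2)) {h : ℝ}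
    (hh : 0 < h) :
    ∀ᵐ s : ℝ, MemW0 Ω m (fun x => (steklov f h (s, x)).1) (fun x => (steklov f h (s, x)).2) := by
  have : Fact (1 ≤ ENNReal.ofReal m) := ⟨by simpa using ENNReal.ofReal_le_ofReal hm⟩
  have hmem : ∀ r, shiftLp hf r ∈ timeW0 Ω m := by
    intro r
    have h1 := (measurePreserving_add_right volume r).quasiMeasurePreserving.ae hW
    simp only [timeW0, mem_ofPred_eq]
    filter_upwards [h1, Measure.ae_ae_of_ae_prod (coeFn_shiftLp hf r)] with s h2 h3
    refine h2.congr ?_ ?_ <;>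
    · filter_upwards [h3] with x hx
      rw [hx]
  have := Convex.set_average_mem (μ := (volume : Measure ℝ)) (t := Ioc 0 h)
      (convex_timeW0 hm) (isClosed_timeW0 hm) (by simpa using hh)
      (by simp) (f := shiftLp hf) (ae_of_all _ hmem)
      (continuous_shiftLp ENNReal.ofReal_ne_top hf).integrableOn_Ioc
  simp only [timeW0, mem_ofPred_eq] at this
  filter_upwards [this, Measure.ae_ae_of_ae_prod
    (coeFn_average_shiftLp ENNReal.ofReal_ne_top hmf hf hf1 (h := h))] with s h2 h3
  refine h2.congr ?_ ?_ <;>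
  · filter_upwards [h3] with x hx
    rw [hx]

end SteklovMemW0

/-! ### Duality pairings and summation by parts in time. -/

section Auxiliary

lemma memLp_prodMk {α E F : Type*} [MeasurableSpace α] [NormedAddCommGroup E]
    [NormedAddCommGroup F] {μ : Measure α} {p : ℝ≥0∞} {f : α → E} {g : α → F}
    (hf : MemLp f p μ) (hg : MemLp g p μ) : MemLp (fun x => (f x, g x)) p μ := by
  refine (hf.norm.add hg.norm).mono' (hf.1.prodMk hg.1) (ae_of_all _ fun x => ?_)
  rw [Prod.norm_def]
  exact max_le_add_of_nonneg (norm_nonneg _) (norm_nonneg _)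

lemma integrable_inner_of_memLp {α E : Type*} [MeasurableSpace α] [NormedAddCommGroup E]
    [InnerProductSpace ℝ E] {μ : Measure α} {p q : ℝ≥0∞} [q.HolderConjugate p]
    {a G : α → E} (ha : MemLp a q μ) (hG : MemLp G p μ) :
    Integrable (fun z => inner ℝ (a z) (G z)) μ := by
  refine memLp_one_iff_integrable.1 ⟨ha.1.inner hG.1, ?_⟩
  refine (eLpNorm_le_eLpNorm_mul_eLpNorm_of_nnnorm (p := q) (q := p) ha.1 hG.1
    (fun x y => inner ℝ x y) 1 (ae_of_all _ fun z => ?_)).trans_lt ?_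
  · simpa using nnnorm_inner_le_nnnorm (𝕜 := ℝ) (a z) (G z)
  · exact ENNReal.mul_lt_top (ENNReal.mul_lt_top ENNReal.coe_lt_top ha.2) hG.2

lemma tendsto_integral_inner {α E ι : Type*} [MeasurableSpace α] [NormedAddCommGroup E]
    [InnerProductSpace ℝ E] {μ : Measure α} {p q : ℝ≥0∞} [q.HolderConjugate p]
    {l : Filter ι} {a G : α → E} {Gi : ι → α → E} (ha : MemLp a q μ) (hG : MemLp G p μ)
    (hGi : ∀ᶠ i in l, MemLp (Gi i) p μ)
    (h : Tendsto (fun i => eLpNorm (fun z => Gi i z - G z) p μ) l (𝓝 0)) :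
    Tendsto (fun i => ∫ z, inner ℝ (a z) (Gi i z) ∂μ) l (𝓝 (∫ z, inner ℝ (a z) (G z) ∂μ)) := by
  refine tendsto_integral_of_L1' _ (ha.1.inner hG.1)
    (hGi.mono fun i hi => integrable_inner_of_memLp ha hi) ?_
  have h1 := ENNReal.Tendsto.const_mul (a := eLpNorm a q μ) h (Or.inr ha.2.ne)
  rw [mul_zero] at h1
  refine tendsto_of_tendsto_of_tendsto_of_le_of_le' tendsto_const_nhds h1
    (Eventually.of_forall fun _ => zero_le) (hGi.mono fun i hi => ?_)
  have h2 := eLpNorm_le_eLpNorm_mul_eLpNorm_of_nnnorm (p := q) (q := p) (r := 1) ha.1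
    (hi.1.sub hG.1) (fun x y => inner ℝ x y) 1 (ae_of_all _ fun z => by
      simpa using nnnorm_inner_le_nnnorm (𝕜 := ℝ) (a z) ((Gi i - G) z))
  rw [ENNReal.coe_one, one_mul] at h2
  refine le_trans (le_of_eq ?_) h2
  congr 1
  ext z
  simp [inner_sub_right]

/-- The forward average has the difference quotient as its derivative and vanishes at M because g
does beyond M. This makes the Steklov average an admissible test function in W^{1,1} with zero end
value. -/
lemma average_add_eq_neg_integral {g : ℝ → ℝ} {M h : ℝ}
    (hg : ∀ a b, IntervalIntegrable g volume a b) (hM : ∀ t, M ≤ t → g t = 0) (hh : 0 < h) (t : ℝ) :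
    ⨍ r in Ioc 0 h, g (t + r) = -∫ τ in t..M, h⁻¹ * (g (τ + h) - g τ) := by
  rw [setAverage_eq, ← intervalIntegral.integral_of_le hh.le]
  have h1 : ∫ r in (0 : ℝ)..h, g (t + r) = ∫ r in t..(t + h), g r := by
    rw [intervalIntegral.integral_comp_add_left]; simp
  have h2 : ∫ τ in t..M, g (τ + h) = ∫ τ in (t + h)..(M + h), g τ :=
    intervalIntegral.integral_comp_add_right _ _
  have h3 : ∫ τ in M..(M + h), g τ = 0 := by
    rw [← intervalIntegral.integral_zero (a := M) (b := M + h)]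
    refine intervalIntegral.integral_congr fun τ hτ => ?_
    rw [uIcc_of_le (by linarith)] at hτ
    exact hM τ hτ.1
  have h4 : IntervalIntegrable (fun τ => g (τ + h)) volume t M := by
    have := (hg (t + h) (M + h)).comp_add_right h
    simpa using this
  rw [intervalIntegral.integral_const_mul, intervalIntegral.integral_sub h4 (hg _ _), h1, h2]
  have h5 := intervalIntegral.integral_add_adjacent_intervals (hg t (t + h)) (hg (t + h) (M + h))
  have h6 := intervalIntegral.integral_add_adjacent_intervals (hg t M) (hg M (M + h))
  simp only [smul_eq_mul, Measure.real, Real.volume_Ioc, sub_zero, ENNReal.toReal_ofReal hh.le]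
  rw [h3] at h6
  rw [← mul_neg]
  congr 1
  linarith

lemma integral_timeShift {N : ℕ} {μ : Measure (Space N)} [IsFiniteMeasure μ]
    {E : Type*} [NormedAddCommGroup E] [NormedSpace ℝ E]
    {f : ℝ × Space N → E} (hm : StronglyMeasurable f) (r : ℝ) :
    ∫ z, f (z.1 + r, z.2) ∂((volume : Measure ℝ).prod μ) =
      ∫ z, f z ∂((volume : Measure ℝ).prod μ) := by
  have hmp := measurePreserving_timeShift μ r
  have h1 := integral_map (μ := (volume : Measure ℝ).prod μ) hmp.measurable.aemeasurable
    (f := f) hm.aestronglyMeasurable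
  rw [hmp.map_eq] at h1
  exact h1.symm

/-- Summation by parts for time differences. -/
lemma integral_mul_timeDiff {N : ℕ} {μ : Measure (Space N)} [IsFiniteMeasure μ]
    {b g : ℝ × Space N → ℝ} (hb : Measurable b) (hg : Measurable g)
    (hgi : Integrable g ((volume : Measure ℝ).prod μ)) {C : ℝ} (hC : ∀ z, |b z| ≤ C) (h : ℝ) :
    Integrable (fun z => b z * (g (z.1 + h, z.2) - g z)) ((volume : Measure ℝ).prod μ) ∧
    Integrable (fun z => (b (z.1 - h, z.2) - b z) * g z) ((volume : Measure ℝ).prod μ) ∧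
    ∫ z, b z * (g (z.1 + h, z.2) - g z) ∂((volume : Measure ℝ).prod μ) =
      ∫ z, (b (z.1 - h, z.2) - b z) * g z ∂((volume : Measure ℝ).prod μ) := by
  have hgs : Integrable (fun z : ℝ × Space N => g (z.1 + h, z.2)) ((volume : Measure ℝ).prod μ) :=
    (measurePreserving_timeShift μ h).integrable_comp_of_integrable hgi
  have hbs : Measurable fun z : ℝ × Space N => b (z.1 - h, z.2) := hb.comp (by fun_prop)
  have i1 : Integrable (fun z => b z * g (z.1 + h, z.2)) ((volume : Measure ℝ).prod μ) :=
    hgs.bdd_mul hb.aestronglyMeasurable (ae_of_all _ hC)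
  have i2 : Integrable (fun z => b z * g z) ((volume : Measure ℝ).prod μ) :=
    hgi.bdd_mul hb.aestronglyMeasurable (ae_of_all _ hC)
  have i3 : Integrable (fun z => b (z.1 - h, z.2) * g z) ((volume : Measure ℝ).prod μ) :=
    hgi.bdd_mul hbs.aestronglyMeasurable (ae_of_all _ fun z => hC _)
  refine ⟨(i1.sub i2).congr (ae_of_all _ fun z => ?_),
    (i3.sub i2).congr (ae_of_all _ fun z => ?_), ?_⟩
  · simp [mul_sub]
  · simp [sub_mul]
  · simp_rw [mul_sub, sub_mul]
    rw [integral_sub i1 i2, integral_sub i3 i2]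
    congr 1
    have := integral_timeShift (μ := μ)
      (f := fun z : ℝ × Space N => b (z.1 - h, z.2) * g z) (hbs.mul hg).stronglyMeasurable h
    simpa using this

end Auxiliary

/-! ### Solutions with good representatives. -/

section Regular

variable {N : ℕ} {Ω : Set (Space N)} {M m : ℝ} {α : ℝ → ℝ} {v₀ : Space N → ℝ}
  {v : ℝ → Space N → ℝ} {G : ℝ → Space N → Space N} {g : ℝ → Space N → ℝ}

/-- Bounded weak solutions of `∂_s α(v) - div(|∇v|^(m-2) ∇v) = g` with jointly measurable and
everywhere bounded representatives. -/
structure RegularSolution {N : ℕ} (Ω : Set (Space N)) (M m : ℝ) (α : ℝ → ℝ) (v₀ : Space N → ℝ)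
    (v : ℝ → Space N → ℝ) (G : ℝ → Space N → Space N) (g : ℝ → Space N → ℝ) : Prop where
  measurable_init : Measurable v₀
  bound_init : ∃ C, ∀ x, |v₀ x| ≤ C
  measurable : Measurable fun z : ℝ × Space N => v z.1 z.2
  bound : ∃ C, ∀ t x, |v t x| ≤ C
  measurable_grad : Measurable fun z : ℝ × Space N => G z.1 z.2
  memLp_grad : MemLp (fun z : ℝ × Space N => G z.1 z.2) (ENNReal.ofReal m) (cylinder Ω M)
  memW0 : ∀ᵐ s ∂(volume.restrict (Ioo 0 M)), MemW0 Ω m (v s) (G s)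
  measurable_source : Measurable fun z : ℝ × Space N => g z.1 z.2
  bound_source : ∃ C, ∀ t x, |g t x| ≤ C
  weak : ∀ (w wt : ℝ → Space N → ℝ) (G' : ℝ → Space N → Space N),
    MemLmW0 Ω M m w G' → MemLinfty Ω M w → MemW11End Ω M w wt →
    -(∫ z, (α (v z.1 z.2) - α (v₀ z.2)) * wt z.1 z.2 ∂(cylinder Ω M)) +
      ∫ z, ‖G z.1 z.2‖ ^ (m - 2) * inner ℝ (G z.1 z.2) (G' z.1 z.2) ∂(cylinder Ω M) =
      ∫ z, g z.1 z.2 * w z.1 z.2 ∂(cylinder Ω M)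

lemma cylinder_eq_restrict (Ω : Set (Space N)) (M : ℝ) : cylinder Ω M =
    ((volume : Measure ℝ).prod (volume.restrict Ω)).restrict (Ioo 0 M ×ˢ univ) := by
  rw [← Measure.prod_restrict, Measure.restrict_univ]; rfl

instance [IsFiniteMeasure (volume.restrict Ω)] : IsFiniteMeasure (cylinder Ω M) := by
  unfold cylinder; infer_instance

lemma holderConjugate_ofReal (hm : 2 ≤ m) :
    (ENNReal.ofReal (m / (m - 1))).HolderConjugate (ENNReal.ofReal m) :=
  (Real.HolderConjugate.conjExponent (by linarith : 1 < m)).symm.ennrealOfReal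

/-- The flux has norm |a|^(m-1), and (m - 1) m' = m. -/
lemma memLp_rpow_smul {α E : Type*} [MeasurableSpace α] [NormedAddCommGroup E] [NormedSpace ℝ E]
    {μ : Measure α} (hm : 2 ≤ m) {a : α → E} (ha : MemLp a (ENNReal.ofReal m) μ) :
    MemLp (fun z => ‖a z‖ ^ (m - 2) • a z) (ENNReal.ofReal (m / (m - 1))) μ := by
  have h1 := ha.norm_rpow_div (ENNReal.ofReal (m - 1))
  rw [← ENNReal.ofReal_div_of_pos (by linarith), ENNReal.toReal_ofReal (by linarith)] at h1
  refine h1.mono ((ha.1.norm.aemeasurable.pow_const _).aestronglyMeasurable.smul ha.1)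
    (ae_of_all _ fun z => ?_)
  rw [norm_smul, Real.norm_of_nonneg (by positivity), Real.norm_of_nonneg (by positivity)]
  rcases eq_or_ne (‖a z‖) 0 with h0 | h0
  · simp [h0, Real.zero_rpow (by linarith : m - 1 ≠ 0)]
  · rw [← Real.rpow_add_one h0]
    exact le_of_eq (by ring_nf)

end Regular

/-! ### The Steklov-averaged weak formulation and its time term. -/

section Kato

variable {N : ℕ} {Ω : Set (Space N)} {M m : ℝ} {α : ℝ → ℝ} {v₀ : Space N → ℝ}
  {v : ℝ → Space N → ℝ} {G : ℝ → Space N → Space N} {g : ℝ → Space N → ℝ}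
  {k : Space N → ℝ} {Gk : Space N → Space N} {ζ ζ' : ℝ → ℝ} {ε : ℝ}

/-- The pair of `ζ H(v - k)` and its gradient, extended by zero in time, where `H = regSign ε`. -/
noncomputable def signTest (M : ℝ) (v : ℝ → Space N → ℝ) (G : ℝ → Space N → Space N)
    (k : Space N → ℝ) (Gk : Space N → Space N) (ζ : ℝ → ℝ) (ε : ℝ) :
    ℝ × Space N → ℝ × Space N :=
  (Ioo 0 M ×ˢ univ).indicator fun z => (ζ z.1 * regSign ε (v z.1 z.2 - k z.2),
    (ζ z.1 * regSignDeriv ε (v z.1 z.2 - k z.2)) • (G z.1 z.2 - Gk z.2))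

lemma measurableSet_timeStrip : MeasurableSet (Ioo 0 M ×ˢ (univ : Set (Space N))) :=
  measurableSet_Ioo.prod MeasurableSet.univ

lemma exists_bound_on_Icc (hζ : Continuous ζ) (a b : ℝ) :
    ∃ C, 0 ≤ C ∧ ∀ t ∈ Icc a b, |ζ t| ≤ C := by
  obtain ⟨C, hC⟩ := isCompact_Icc.exists_bound_of_continuousOn (s := Icc a b) hζ.continuousOn
  exact ⟨max C 0, le_max_right _ _, fun t ht => (hC t ht).trans (le_max_left _ _)⟩

lemma measurable_signTest (hv : Measurable fun z : ℝ × Space N => v z.1 z.2)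
    (hG : Measurable fun z : ℝ × Space N => G z.1 z.2) (hk : Measurable k) (hGk : Measurable Gk)
    (hζ : Continuous ζ) (hε : 0 < ε) : Measurable (signTest M v G k Gk ζ ε) := by
  have h1 := (continuous_regSign hε).measurable
  have h2 := (continuous_regSignDeriv hε).measurable
  have h3 := hζ.measurable
  refine Measurable.indicator ?_ measurableSet_timeStrip
  fun_prop

lemma memLp_signTest [IsFiniteMeasure (volume.restrict Ω)]
    (hsol : RegularSolution Ω M m α v₀ v G g) (hk : Measurable k) (hGk : Measurable Gk)
    (hkW : MemW0 Ω m k Gk) (hζ : Continuous ζ) (hε : 0 < ε) :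
    MemLp (signTest M v G k Gk ζ ε) (ENNReal.ofReal m)
      ((volume : Measure ℝ).prod (volume.restrict Ω)) := by
  have h1 := (continuous_regSign hε).measurable
  have h2 := (continuous_regSignDeriv hε).measurable
  have h3 := hζ.measurable
  have h4 := hsol.measurable
  have h5 := hsol.measurable_grad
  obtain ⟨C, hC0, hC⟩ := exists_bound_on_Icc hζ 0 M
  unfold signTest
  rw [memLp_indicator_iff_restrict measurableSet_timeStrip, ← cylinder_eq_restrict]
  have hin : ∀ᵐ z ∂(cylinder Ω M), z ∈ Ioo 0 M ×ˢ (univ : Set (Space N)) := by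
    rw [cylinder_eq_restrict]
    exact ae_restrict_mem measurableSet_timeStrip
  refine memLp_prodMk ?_ ?_
  · refine MemLp.of_bound (Measurable.aestronglyMeasurable (by fun_prop)) C ?_
    filter_upwards [hin] with z hz
    rw [norm_mul, ← mul_one C]
    exact mul_le_mul (hC _ (Ioo_subset_Icc_self hz.1)) (abs_regSign_le hε _) (norm_nonneg _) hC0
  · have hd : MemLp (fun z : ℝ × Space N => G z.1 z.2 - Gk z.2) (ENNReal.ofReal m) (cylinder Ω M) :=
      hsol.memLp_grad.sub (hkW.2.1.comp_snd _)
    refine hd.of_le_mul (c := C * (1 / ε)) (Measurable.aestronglyMeasurable (by fun_prop)) ?_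
    filter_upwards [hin] with z hz
    rw [norm_smul, norm_mul]
    gcongr
    · exact hC _ (Ioo_subset_Icc_self hz.1)
    · rw [Real.norm_of_nonneg (regSignDeriv_nonneg _)]
      exact regSignDeriv_le hε _

lemma memW0_signTest (hm : 1 ≤ m) (hW : ∀ᵐ s ∂(volume.restrict (Ioo 0 M)), MemW0 Ω m (v s) (G s))
    (hkW : MemW0 Ω m k Gk) (hε : 0 < ε) :
    ∀ᵐ s : ℝ, MemW0 Ω m (fun x => (signTest M v G k Gk ζ ε (s, x)).1)
      (fun x => (signTest M v G k Gk ζ ε (s, x)).2) := by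
  rw [ae_restrict_iff' measurableSet_Ioo] at hW
  filter_upwards [hW] with s hs
  by_cases hsM : s ∈ Ioo 0 M
  · have h1 := ((hs hsM).regSign_sub hm hkW hε).const_mul hm (ζ s)
    simpa [signTest, hsM, mul_smul] using h1
  · simpa [signTest, hsM] using MemW0.zero

lemma integrable_signTest [IsFiniteMeasure (volume.restrict Ω)] (hm : 1 ≤ m)
    (hF : MemLp (signTest M v G k Gk ζ ε) (ENNReal.ofReal m)
      ((volume : Measure ℝ).prod (volume.restrict Ω))) :
    Integrable (signTest M v G k Gk ζ ε) ((volume : Measure ℝ).prod (volume.restrict Ω)) := by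
  have h1 : 1 ≤ ENNReal.ofReal m := by simpa using ENNReal.ofReal_le_ofReal hm
  unfold signTest at hF ⊢
  rw [memLp_indicator_iff_restrict measurableSet_timeStrip, ← cylinder_eq_restrict] at hF
  rw [integrable_indicator_iff measurableSet_timeStrip, IntegrableOn, ← cylinder_eq_restrict]
  exact hF.integrable h1

lemma abs_signTest_fst_le (hε : 0 < ε) {C : ℝ} (hC0 : 0 ≤ C) (hC : ∀ t ∈ Icc 0 M, |ζ t| ≤ C)
    (z : ℝ × Space N) : |(signTest M v G k Gk ζ ε z).1| ≤ C := by
  unfold signTest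
  by_cases hz : z ∈ Ioo 0 M ×ˢ (univ : Set (Space N))
  · rw [indicator_of_mem hz, abs_mul, ← mul_one C]
    exact mul_le_mul (hC _ (Ioo_subset_Icc_self hz.1)) (abs_regSign_le hε _) (abs_nonneg _) hC0
  · rw [indicator_of_notMem hz]
    simpa using hC0

/-- The weak formulation tested with the Steklov average of `ζ H(v - k)`. -/
lemma weak_steklov [IsFiniteMeasure (volume.restrict Ω)] (hm : 2 ≤ m)
    (hsol : RegularSolution Ω M m α v₀ v G g) (hk : Measurable k) (hGk : Measurable Gk)
    (hkW : MemW0 Ω m k Gk) (hζ : Continuous ζ) (hε : 0 < ε) {h : ℝ} (hh : 0 < h) :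
    -(∫ z, (α (v z.1 z.2) - α (v₀ z.2)) *
        (h⁻¹ * ((signTest M v G k Gk ζ ε (z.1 + h, z.2)).1 - (signTest M v G k Gk ζ ε z).1))
          ∂(cylinder Ω M)) +
      ∫ z, ‖G z.1 z.2‖ ^ (m - 2) *
        inner ℝ (G z.1 z.2) (steklov (signTest M v G k Gk ζ ε) h z).2 ∂(cylinder Ω M) =
      ∫ z, g z.1 z.2 * (steklov (signTest M v G k Gk ζ ε) h z).1 ∂(cylinder Ω M) := by
  have hm1 : 1 ≤ m := by linarith
  have h1 : 1 ≤ ENNReal.ofReal m := by simpa using ENNReal.ofReal_le_ofReal hm1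
  obtain ⟨C, hC0, hC⟩ := exists_bound_on_Icc hζ 0 M
  have hbd := abs_signTest_fst_le (N := N) (v := v) (G := G) (k := k) (Gk := Gk) hε hC0 hC
  have hFm := measurable_signTest (M := M) hsol.measurable hsol.measurable_grad hk hGk hζ hε
  have hF := memLp_signTest hsol hk hGk hkW hζ hε
  have hFi := integrable_signTest hm1 hF
  have hzero : ∀ z : ℝ × Space N, M ≤ z.1 → (signTest M v G k Gk ζ ε z).1 = 0 := by
    intro z hz
    unfold signTest
    rw [indicator_of_notMem (fun h => by linarith [h.1.2])]
    rfl
  set F := signTest M v G k Gk ζ ε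
  have hS := memLp_steklov h1 ENNReal.ofReal_ne_top hFm.stronglyMeasurable hF hFi h
  have hSr : MemLp (steklov F h) (ENNReal.ofReal m) (cylinder Ω M) := by
    rw [cylinder_eq_restrict]; exact hS.restrict _
  have hfst : ∀ᵐ z ∂(cylinder Ω M), (steklov F h z).1 = ⨍ r in Ioc 0 h, (F (z.1 + r, z.2)).1 := by
    rw [cylinder_eq_restrict]
    filter_upwards [ae_restrict_of_ae
      (integrable_timeShift_prod hFm.stronglyMeasurable hFi h).prod_left_ae] with z hz
    unfold steklov
    rw [setAverage_eq, setAverage_eq, Prod.smul_fst, fst_integral hz]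
  refine hsol.weak (fun t x => (steklov F h (t, x)).1)
    (fun t x => h⁻¹ * ((F (t + h, x)).1 - (F (t, x)).1)) (fun t x => (steklov F h (t, x)).2)
    ⟨hSr.fst, hSr.snd, ae_restrict_of_ae
      (memW0_steklov hm1 hFm.stronglyMeasurable hF hFi (memW0_signTest hm1 hsol.memW0 hkW hε) hh)⟩
    ?_ ⟨?_, ?_⟩
  · refine MemLp.of_bound hSr.fst.1 C ?_
    filter_upwards [hfst] with z hz
    change ‖(steklov F h z).1‖ ≤ C
    rw [hz, setAverage_eq, norm_smul]
    have h2 := norm_setIntegral_le_of_norm_le_const (μ := volume) (s := Ioc 0 h)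
      (f := fun r => (F (z.1 + r, z.2)).1) (by simp) fun r _ => hbd (z.1 + r, z.2)
    simp only [Measure.real, Real.volume_Ioc, sub_zero, ENNReal.toReal_ofReal hh.le] at h2 ⊢
    rw [Real.norm_of_nonneg (by positivity)]
    calc _ ≤ h⁻¹ * (C * h) := by gcongr
      _ = C := by field_simp
  · refine MemLp.of_bound (Measurable.aestronglyMeasurable (by fun_prop)) (h⁻¹ * (C + C))
      (ae_of_all _ fun z => ?_)
    rw [norm_mul, Real.norm_of_nonneg (by positivity)]
    gcongr
    exact (norm_sub_le _ _).trans (add_le_add (hbd _) (hbd _))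
  · filter_upwards [hfst] with z hz
    rw [show steklov F h (z.1, z.2) = steklov F h z from rfl, hz]
    refine average_add_eq_neg_integral (g := fun t => (F (t, z.2)).1) (fun a b => ?_)
      (fun t ht => hzero _ ht) hh z.1
    rw [intervalIntegrable_iff]
    exact Measure.integrableOn_of_bounded (M := C) (by simp)
      (Measurable.aestronglyMeasurable (by fun_prop)) (ae_of_all _ fun t => hbd _)

/-- The discrete chain rule inequality. -/
lemma integral_timeDiff_le [IsFiniteMeasure (volume.restrict Ω)] {L : ℝ≥0}
    (hL : LipschitzWith L α) (hα : Monotone α)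
    (hv : Measurable fun z : ℝ × Space N => v z.1 z.2) (hvb : ∃ C, ∀ t x, |v t x| ≤ C)
    (hv₀ : Measurable v₀) (hv₀b : ∃ C, ∀ x, |v₀ x| ≤ C)
    (hG : Measurable fun z : ℝ × Space N => G z.1 z.2)
    (hk : Measurable k) (hkb : ∃ C, ∀ x, |k x| ≤ C) (hGk : Measurable Gk)
    (hF : Integrable (signTest M v G k Gk ζ ε) ((volume : Measure ℝ).prod (volume.restrict Ω)))
    (hζ : Continuous ζ) (hζ0 : ∀ t, 0 ≤ ζ t) (hζM : ∀ t, M ≤ t → ζ t = 0)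
    (hε : 0 < ε) {h : ℝ} (hh : 0 < h) :
    ∫ z, (α (v z.1 z.2) - α (v₀ z.2)) *
        (h⁻¹ * ((signTest M v G k Gk ζ ε (z.1 + h, z.2)).1 - (signTest M v G k Gk ζ ε z).1))
          ∂(cylinder Ω M) ≤
      ∫ z, (entropy α ε (v z.1 z.2) (k z.2) - entropy α ε (v₀ z.2) (k z.2)) *
        (h⁻¹ * (ζ (z.1 + h) - ζ z.1)) ∂(cylinder Ω M) := by
  obtain ⟨Cv, hCv⟩ := hvb
  obtain ⟨C₀, hC₀⟩ := hv₀b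
  obtain ⟨Ck, hCk⟩ := hkb
  obtain ⟨Cζ, hCζ0, hCζ⟩ := exists_bound_on_Icc hζ 0 M
  set ν := (volume : Measure ℝ).prod (volume.restrict Ω)
  set S : Set (ℝ × Space N) := Ioo 0 M ×ˢ univ with hS_def
  have hS : MeasurableSet S := measurableSet_timeStrip
  have hαm := hL.continuous.measurable
  have hem := (continuous_entropy hε hL.continuous).measurable
  set F := signTest M v G k Gk ζ ε with hF_def
  have hFm : Measurable F := measurable_signTest hv hG hk hGk hζ hε
  -- Extending by zero amounts to setting v = v₀ before time 0. In this way the initial datum enters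
  -- through the first time step of length h.
  let b : ℝ × Space N → ℝ := S.indicator fun z => α (v z.1 z.2) - α (v₀ z.2)
  let P : ℝ × Space N → ℝ := S.indicator fun z =>
    entropy α ε (v z.1 z.2) (k z.2) - entropy α ε (v₀ z.2) (k z.2)
  let Z : ℝ × Space N → ℝ := S.indicator fun z => ζ z.1
  have hbm : Measurable b := Measurable.indicator (by fun_prop) hS
  have hPm : Measurable P := by
    refine Measurable.indicator (Measurable.sub ?_ ?_) hS
    · exact hem.comp (hv.prodMk (hk.comp measurable_snd))
    · exact hem.comp ((hv₀.comp measurable_snd).prodMk (hk.comp measurable_snd))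
  have hZm : Measurable Z := Measurable.indicator (by fun_prop) hS
  have hLip : ∀ a b, |α a - α b| ≤ L * |a - b| := fun a b => by
    simpa [Real.dist_eq] using hL.dist_le_mul a b
  have hbb : ∀ z, |b z| ≤ L * (Cv + C₀) := by
    intro z
    have h0 : 0 ≤ (L : ℝ) * (Cv + C₀) := by
      have h1 := (abs_nonneg _).trans (hCv z.1 z.2)
      have h2 := (abs_nonneg _).trans (hC₀ z.2)
      positivity
    by_cases hz : z ∈ S
    · simp only [b, indicator_of_mem hz]
      refine (hLip _ _).trans ?_
      gcongr
      exact (abs_sub _ _).trans (add_le_add (hCv _ _) (hC₀ _))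
    · simpa only [b, indicator_of_notMem hz, abs_zero] using h0
  have hent : ∀ r C x, |r| ≤ C → |entropy α ε r (k x)| ≤ L * (C + Ck) + 2 * L * ε :=
    fun r C x hr => abs_entropy_le hε hL hα hr (hCk x)
  have hPb : ∀ z, |P z| ≤ (L * (Cv + Ck) + 2 * L * ε) + (L * (C₀ + Ck) + 2 * L * ε) := by
    intro z
    by_cases hz : z ∈ S
    · simp only [P, indicator_of_mem hz]
      exact (abs_sub _ _).trans (add_le_add (hent _ _ _ (hCv _ _)) (hent _ _ _ (hC₀ _)))
    · simp only [P, indicator_of_notMem hz, abs_zero]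
      exact add_nonneg ((abs_nonneg _).trans (hent _ _ z.2 (hCv z.1 z.2)))
        ((abs_nonneg _).trans (hent _ _ z.2 (hC₀ z.2)))
  have hZi : Integrable Z ν := by
    rw [integrable_indicator_iff hS, IntegrableOn, ← cylinder_eq_restrict]
    refine Integrable.of_bound (Measurable.aestronglyMeasurable (by fun_prop)) Cζ ?_
    rw [cylinder_eq_restrict]
    filter_upwards [ae_restrict_mem hS] with z hz
    exact hCζ _ (Ioo_subset_Icc_self hz.1)
  have hF1 : Integrable (fun z => (F z).1) ν := hF.fst
  obtain ⟨-, ib, eb⟩ := integral_mul_timeDiff (μ := volume.restrict Ω) hbm hFm.fst hF1 hbb h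
  obtain ⟨-, iP, eP⟩ := integral_mul_timeDiff (μ := volume.restrict Ω) hPm hZm hZi hPb h
  -- Once the time difference has been moved onto b and P, the claim is pointwise: it is
  -- `entropy_sub_le` times ζ ≥ 0, comparing v(t) with v(t - h), or with v₀ when t ≤ h.
  have key : ∫ z, b z * ((F (z.1 + h, z.2)).1 - (F z).1) ∂ν ≤
      ∫ z, P z * (Z (z.1 + h, z.2) - Z z) ∂ν := by
    rw [eb, eP]
    refine integral_mono ib iP fun z => ?_
    by_cases hz : z ∈ S
    · have hFz : (F z).1 = ζ z.1 * regSign ε (v z.1 z.2 - k z.2) := by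
        simp only [hF_def, signTest]
        rw [indicator_of_mem hz]
      have hmono : ∀ y, entropy α ε (v z.1 z.2) (k z.2) - entropy α ε y (k z.2) ≤
          (α (v z.1 z.2) - α y) * regSign ε (v z.1 z.2 - k z.2) :=
        fun y => entropy_sub_le hε hL.continuous hα _ _ _
      simp only [hFz, b, P, Z, indicator_of_mem hz]
      by_cases hz' : (z.1 - h, z.2) ∈ S
      · simp only [indicator_of_mem hz']
        have := mul_le_mul_of_nonneg_left (hmono (v (z.1 - h) z.2)) (hζ0 z.1)
        linarith
      · simp only [indicator_of_notMem hz']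
        have := mul_le_mul_of_nonneg_left (hmono (v₀ z.2)) (hζ0 z.1)
        linarith
    · have hFz : F z = 0 := by
        simp only [hF_def, signTest]
        rw [indicator_of_notMem hz]
      simp [hFz, Z, indicator_of_notMem hz]
  have e1 : ∫ z, (α (v z.1 z.2) - α (v₀ z.2)) *
        (h⁻¹ * ((F (z.1 + h, z.2)).1 - (F z).1)) ∂(cylinder Ω M) =
      h⁻¹ * ∫ z, b z * ((F (z.1 + h, z.2)).1 - (F z).1) ∂ν := by
    rw [cylinder_eq_restrict, ← integral_indicator hS, ← integral_const_mul]
    refine integral_congr_ae (ae_of_all _ fun z => ?_)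
    by_cases hz : z ∈ S
    · simp only [b, indicator_of_mem hz]; ring
    · simp only [b, indicator_of_notMem hz]; ring
  have e2 : ∫ z, (entropy α ε (v z.1 z.2) (k z.2) - entropy α ε (v₀ z.2) (k z.2)) *
        (h⁻¹ * (ζ (z.1 + h) - ζ z.1)) ∂(cylinder Ω M) =
      h⁻¹ * ∫ z, P z * (Z (z.1 + h, z.2) - Z z) ∂ν := by
    rw [cylinder_eq_restrict, ← integral_indicator hS, ← integral_const_mul]
    refine integral_congr_ae (ae_of_all _ fun z => ?_)
    by_cases hz : z ∈ S
    · beta_reduce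
      have hZ : Z (z.1 + h, z.2) = ζ (z.1 + h) := by
        by_cases hz' : (z.1 + h, z.2) ∈ S
        · simp only [Z, indicator_of_mem hz']
        · simp only [Z, indicator_of_notMem hz']
          refine (hζM _ ?_).symm
          by_contra hlt
          exact hz' ⟨⟨by linarith [hz.1.1], not_le.1 hlt⟩, trivial⟩
      rw [hZ]
      simp only [P, Z, indicator_of_mem hz]; ring
    · simp only [P, indicator_of_notMem hz]; ring
  rw [e1, e2]
  exact mul_le_mul_of_nonneg_left key (by positivity)

lemma tendsto_integral_mul_timeDiff [IsFiniteMeasure (volume.restrict Ω)]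
    {P : ℝ × Space N → ℝ} (hP : Measurable P) {C : ℝ} (hC : ∀ z, |P z| ≤ C)
    (hζ : ∀ t, HasDerivAt ζ (ζ' t) t) (hζ' : Continuous ζ') :
    Tendsto (fun h => ∫ z, P z * (h⁻¹ * (ζ (z.1 + h) - ζ z.1)) ∂(cylinder Ω M)) (𝓝[>] 0)
      (𝓝 (∫ z, P z * ζ' z.1 ∂(cylinder Ω M))) := by
  -- The interval reaches M + 1 because t + h with t < M and h < 1 must stay inside it for the mean
  -- value bound.
  obtain ⟨D, hD0, hD⟩ := exists_bound_on_Icc hζ' 0 (M + 1)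
  have hζc : Continuous ζ := continuous_iff_continuousAt.2 fun t => (hζ t).continuousAt
  have hζm := hζc.measurable
  refine tendsto_integral_filter_of_dominated_convergence (fun _ => C * D) ?_ ?_
    (integrable_const _) ?_
  · exact Eventually.of_forall fun h => Measurable.aestronglyMeasurable (by fun_prop)
  · have hlt : ∀ᶠ h : ℝ in 𝓝[>] 0, h ∈ Ioo (0 : ℝ) 1 := Ioo_mem_nhdsGT one_pos
    filter_upwards [hlt] with h hh
    rw [cylinder_eq_restrict]
    filter_upwards [ae_restrict_mem measurableSet_timeStrip] with z hz
    have h1 := Convex.norm_image_sub_le_of_norm_hasDerivWithin_le (s := Icc 0 (M + 1)) (f := ζ)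
      (f' := ζ') (x := z.1) (y := z.1 + h) (fun x _ => (hζ x).hasDerivWithinAt) hD (convex_Icc _ _)
      ⟨hz.1.1.le, by linarith [hz.1.2]⟩ ⟨by linarith [hz.1.1, hh.1], by linarith [hz.1.2, hh.2]⟩
    rw [add_sub_cancel_left, Real.norm_of_nonneg hh.1.le] at h1
    rw [norm_mul, norm_mul, Real.norm_of_nonneg (inv_nonneg.2 hh.1.le)]
    have h2 : h⁻¹ * ‖ζ (z.1 + h) - ζ z.1‖ ≤ D := by
      rw [inv_mul_le_iff₀ hh.1]; linarith
    exact mul_le_mul (hC z) h2 (by have := hh.1; positivity) ((abs_nonneg _).trans (hC z))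
  · refine ae_of_all _ fun z => Tendsto.const_mul _ ?_
    have := (hζ z.1).tendsto_slope_zero_right
    simpa using this

end Kato

/-! ### The entropy inequality against a time-independent k. -/

section KatoInequality

variable {N : ℕ} {Ω : Set (Space N)} {M m : ℝ} {α : ℝ → ℝ} {v₀ : Space N → ℝ}
  {v : ℝ → Space N → ℝ} {G : ℝ → Space N → Space N} {g : ℝ → Space N → ℝ}
  {k : Space N → ℝ} {Gk : Space N → Space N} {ζ ζ' : ℝ → ℝ} {ε : ℝ}

/-- The integrand of the entropy inequality. -/
noncomputable def katoIntegrand (m : ℝ) (α : ℝ → ℝ) (ε : ℝ) (r₀ r : ℝ) {N : ℕ} (G : Space N) (g k : ℝ)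
    (Gk : Space N) (ζ ζ' : ℝ) : ℝ :=
  -((entropy α ε r k - entropy α ε r₀ k) * ζ') +
    ζ * regSignDeriv ε (r - k) * (‖G‖ ^ (m - 2) * inner ℝ G (G - Gk)) -
    g * (ζ * regSign ε (r - k))

/-- The one-sided entropy inequality for a bounded weak solution and a fixed `k ∈ W_0^{1,m}`. -/
theorem RegularSolution.kato [IsFiniteMeasure (volume.restrict Ω)] (hm : 2 ≤ m) {L : ℝ≥0}
    (hL : LipschitzWith L α) (hα : Monotone α) (hsol : RegularSolution Ω M m α v₀ v G g)
    (hk : Measurable k) (hkb : ∃ C, ∀ x, |k x| ≤ C) (hGk : Measurable Gk) (hkW : MemW0 Ω m k Gk)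
    (hζ : ∀ t, HasDerivAt ζ (ζ' t) t) (hζ' : Continuous ζ') (hζ0 : ∀ t, 0 ≤ ζ t)
    (hζM : ∀ t, M ≤ t → ζ t = 0) (hε : 0 < ε) :
    Integrable (fun z : ℝ × Space N => katoIntegrand m α ε (v₀ z.2) (v z.1 z.2) (G z.1 z.2)
      (g z.1 z.2) (k z.2) (Gk z.2) (ζ z.1) (ζ' z.1)) (cylinder Ω M) ∧
    ∫ z, katoIntegrand m α ε (v₀ z.2) (v z.1 z.2) (G z.1 z.2) (g z.1 z.2) (k z.2) (Gk z.2) (ζ z.1)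
      (ζ' z.1) ∂(cylinder Ω M) ≤ 0 := by
  have hm1 : 1 ≤ m := by linarith
  have h1 : 1 ≤ ENNReal.ofReal m := by simpa using ENNReal.ofReal_le_ofReal hm1
  have hc := holderConjugate_ofReal hm
  have hζc : Continuous ζ := continuous_iff_continuousAt.2 fun t => (hζ t).continuousAt
  have hFm := measurable_signTest (M := M) hsol.measurable hsol.measurable_grad hk hGk hζc hε
  have hF := memLp_signTest hsol hk hGk hkW hζc hε
  have hFi := integrable_signTest hm1 hF
  have hFeq : ∀ᵐ z ∂(cylinder Ω M), signTest M v G k Gk ζ ε z =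
      (ζ z.1 * regSign ε (v z.1 z.2 - k z.2),
        (ζ z.1 * regSignDeriv ε (v z.1 z.2 - k z.2)) • (G z.1 z.2 - Gk z.2)) := by
    rw [cylinder_eq_restrict]
    filter_upwards [ae_restrict_mem measurableSet_timeStrip] with z hz
    rw [signTest, indicator_of_mem hz]
  have hem := (continuous_entropy hε hL.continuous).measurable
  obtain ⟨Cv, hCv⟩ := hsol.bound
  obtain ⟨C₀, hC₀⟩ := hsol.bound_init
  obtain ⟨Cg, hCg⟩ := hsol.bound_source
  obtain ⟨Ck, hCk⟩ := id hkb
  set F := signTest M v G k Gk ζ ε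
  have hS : ∀ h, MemLp (steklov F h) (ENNReal.ofReal m) (cylinder Ω M) := fun h => by
    rw [cylinder_eq_restrict]
    exact (memLp_steklov h1 ENNReal.ofReal_ne_top hFm.stronglyMeasurable hF hFi h).restrict _
  have hFc : MemLp F (ENNReal.ofReal m) (cylinder Ω M) := by
    rw [cylinder_eq_restrict]; exact hF.restrict _
  have hlim : Tendsto (fun h => eLpNorm (fun z => steklov F h z - F z) (ENNReal.ofReal m)
      (cylinder Ω M)) (𝓝[>] 0) (𝓝 0) := by
    refine tendsto_of_tendsto_of_tendsto_of_le_of_le tendsto_const_nhds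
      (tendsto_eLpNorm_steklov_sub h1 ENNReal.ofReal_ne_top hFm.stronglyMeasurable hF hFi)
      (fun _ => zero_le) fun h => ?_
    rw [cylinder_eq_restrict]
    exact eLpNorm_mono_measure _ Measure.restrict_le_self
  have hlim1 : Tendsto (fun h => eLpNorm (fun z => (steklov F h z).1 - (F z).1) (ENNReal.ofReal m)
      (cylinder Ω M)) (𝓝[>] 0) (𝓝 0) :=
    tendsto_of_tendsto_of_tendsto_of_le_of_le tendsto_const_nhds hlim (fun _ => zero_le)
      fun h => eLpNorm_mono fun z => norm_fst_le (steklov F h z - F z)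
  have hlim2 : Tendsto (fun h => eLpNorm (fun z => (steklov F h z).2 - (F z).2) (ENNReal.ofReal m)
      (cylinder Ω M)) (𝓝[>] 0) (𝓝 0) :=
    tendsto_of_tendsto_of_tendsto_of_le_of_le tendsto_const_nhds hlim (fun _ => zero_le)
      fun h => eLpNorm_mono fun z => norm_snd_le (steklov F h z - F z)
  have ha := memLp_rpow_smul hm hsol.memLp_grad
  have hg : MemLp (fun z : ℝ × Space N => g z.1 z.2) (ENNReal.ofReal (m / (m - 1)))
      (cylinder Ω M) :=
    MemLp.of_bound hsol.measurable_source.aestronglyMeasurable Cg (ae_of_all _ fun z => hCg _ _)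
  have T2 := tendsto_integral_inner ha hFc.snd (Eventually.of_forall fun h => (hS h).snd) hlim2
  have T3 := tendsto_integral_inner hg hFc.fst (Eventually.of_forall fun h => (hS h).fst) hlim1
  have hPm : Measurable fun z : ℝ × Space N =>
      entropy α ε (v z.1 z.2) (k z.2) - entropy α ε (v₀ z.2) (k z.2) :=
    (hem.comp (hsol.measurable.prodMk (hk.comp measurable_snd))).sub
      (hem.comp ((hsol.measurable_init.comp measurable_snd).prodMk (hk.comp measurable_snd)))
  have hPb : ∀ z : ℝ × Space N, |entropy α ε (v z.1 z.2) (k z.2) - entropy α ε (v₀ z.2) (k z.2)| ≤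
      (L * (Cv + Ck) + 2 * L * ε) + (L * (C₀ + Ck) + 2 * L * ε) := fun z =>
    (abs_sub _ _).trans (add_le_add (abs_entropy_le hε hL hα (hCv _ _) (hCk _))
      (abs_entropy_le hε hL hα (hC₀ _) (hCk _)))
  have T1 := tendsto_integral_mul_timeDiff (Ω := Ω) (M := M) hPm hPb hζ hζ'
  -- For each h > 0 the averaged equation holds exactly, and replacing its time term by the entropy
  -- term only decreases the left side. Now only ζ carries a difference quotient, so h can tend to
  -- 0.
  have hle := le_of_tendsto (b := 0) ((T1.neg.add T2).sub T3) (by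
    filter_upwards [self_mem_nhdsWithin] with h hh
    have hw := weak_steklov hm hsol hk hGk hkW hζc hε (h := h) hh
    have hd := integral_timeDiff_le hL hα hsol.measurable hsol.bound hsol.measurable_init
      hsol.bound_init hsol.measurable_grad hk hkb hGk hFi hζc hζ0 hζM hε (h := h) hh
    simp only [real_inner_smul_left] at *
    simp only [RCLike.inner_apply, conj_trivial, mul_comm (_ : ℝ) (g _ _)]
    linarith)
  have hζb : Integrable (fun z : ℝ × Space N =>
      (entropy α ε (v z.1 z.2) (k z.2) - entropy α ε (v₀ z.2) (k z.2)) * ζ' z.1)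
      (cylinder Ω M) := by
    obtain ⟨D, hD0, hD⟩ := exists_bound_on_Icc hζ' 0 M
    refine Integrable.of_bound (hPm.mul (hζ'.measurable.comp measurable_fst)).aestronglyMeasurable
      (((L * (Cv + Ck) + 2 * L * ε) + (L * (C₀ + Ck) + 2 * L * ε)) * D) ?_
    rw [cylinder_eq_restrict]
    filter_upwards [ae_restrict_mem measurableSet_timeStrip] with z hz
    rw [norm_mul]
    exact mul_le_mul (hPb z) (hD _ (Ioo_subset_Icc_self hz.1)) (norm_nonneg _)
      ((abs_nonneg _).trans (hPb z))
  have hint2 := integrable_inner_of_memLp ha hFc.snd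
  have hint3 := integrable_inner_of_memLp hg hFc.fst
  have hneg : Integrable (fun z : ℝ × Space N =>
      -((entropy α ε (v z.1 z.2) (k z.2) - entropy α ε (v₀ z.2) (k z.2)) * ζ' z.1))
      (cylinder Ω M) := hζb.neg
  have hsum : Integrable (fun z : ℝ × Space N =>
      -((entropy α ε (v z.1 z.2) (k z.2) - entropy α ε (v₀ z.2) (k z.2)) * ζ' z.1) +
      inner ℝ (‖G z.1 z.2‖ ^ (m - 2) • G z.1 z.2) (F z).2) (cylinder Ω M) := hneg.add hint2
  rw [← integral_neg, ← integral_add hneg hint2, ← integral_sub hsum hint3] at hle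
  have heq : ∀ᵐ z ∂(cylinder Ω M),
      -((entropy α ε (v z.1 z.2) (k z.2) - entropy α ε (v₀ z.2) (k z.2)) * ζ' z.1) +
        inner ℝ (‖G z.1 z.2‖ ^ (m - 2) • G z.1 z.2) (F z).2 - inner ℝ (g z.1 z.2) (F z).1 =
      katoIntegrand m α ε (v₀ z.2) (v z.1 z.2) (G z.1 z.2) (g z.1 z.2) (k z.2) (Gk z.2) (ζ z.1)
        (ζ' z.1) := by
    filter_upwards [hFeq] with z hz
    simp only [katoIntegrand, hz, real_inner_smul_left, real_inner_smul_right, RCLike.inner_apply,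
      conj_trivial]
    ring
  exact ⟨(hsum.sub hint3).congr heq, (integral_congr_ae heq).symm.le.trans hle⟩

end KatoInequality

/-! ### Doubling of the time variable. -/

section Doubling

variable {N : ℕ} {Ω : Set (Space N)} {M m : ℝ} {α : ℝ → ℝ} {v₀ u₀ : Space N → ℝ}
  {v u : ℝ → Space N → ℝ} {Gv Gu : ℝ → Space N → Space N} {gv gu : ℝ → Space N → ℝ}
  {ζ ζ₁ ζ₂ : ℝ → ℝ → ℝ} {ε : ℝ}

/-- Lebesgue measure on `(0, M) × (0, M) × Ω`. -/
noncomputable def doubleCylinder (Ω : Set (Space N)) (M : ℝ) : Measure (ℝ × (ℝ × Space N)) :=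
  (volume.restrict (Ioo 0 M)).prod (cylinder Ω M)

instance [IsFiniteMeasure (volume.restrict Ω)] : IsFiniteMeasure (doubleCylinder Ω M) := by
  unfold doubleCylinder; infer_instance

/-- Exchange of the two time variables. -/
def swapTimes (N : ℕ) : ℝ × (ℝ × Space N) ≃ᵐ ℝ × (ℝ × Space N) :=
  (MeasurableEquiv.prodAssoc.symm.trans
    (MeasurableEquiv.prodComm.prodCongr (MeasurableEquiv.refl _))).trans MeasurableEquiv.prodAssoc

lemma measurePreserving_swapTimes [IsFiniteMeasure (volume.restrict Ω)] :
    MeasurePreserving (swapTimes N) (doubleCylinder Ω M) (doubleCylinder Ω M) := by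
  have h1 := measurePreserving_prodAssoc (volume.restrict (Ioo 0 M)) (volume.restrict (Ioo 0 M))
    (volume.restrict Ω)
  have h2 : MeasurePreserving (Prod.swap : ℝ × ℝ → ℝ × ℝ)
      ((volume.restrict (Ioo 0 M)).prod (volume.restrict (Ioo 0 M)))
      ((volume.restrict (Ioo 0 M)).prod (volume.restrict (Ioo 0 M))) := Measure.measurePreserving_swap
  exact (h1.comp (h2.prod (MeasurePreserving.id (volume.restrict Ω)))).comp h1.symm

lemma ae_doubleCylinder_mem [IsFiniteMeasure (volume.restrict Ω)] :
    ∀ᵐ q ∂(doubleCylinder Ω M), q.1 ∈ Ioo 0 M ∧ q.2.1 ∈ Ioo 0 M := by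
  have h1 : ∀ᵐ q ∂(doubleCylinder Ω M), q.1 ∈ Ioo 0 M :=
    Measure.quasiMeasurePreserving_fst.ae (ae_restrict_mem measurableSet_Ioo)
  have h2 := measurePreserving_swapTimes.quasiMeasurePreserving.ae h1
  filter_upwards [h1, h2] with q h3 h4
  exact ⟨h3, h4⟩

lemma exists_bound_on_square (hζ : Continuous (Function.uncurry ζ)) (M : ℝ) :
    ∃ C, 0 ≤ C ∧ ∀ s ∈ Ioo 0 M, ∀ t ∈ Ioo 0 M, |ζ s t| ≤ C := by
  obtain ⟨C, hC⟩ := (isCompact_Icc.prod isCompact_Icc).exists_bound_of_continuousOn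
    (s := Icc 0 M ×ˢ Icc 0 M) hζ.continuousOn
  exact ⟨max C 0, le_max_right _ _, fun s hs t ht =>
    (hC (s, t) ⟨Ioo_subset_Icc_self hs, Ioo_subset_Icc_self ht⟩).trans (le_max_left _ _)⟩

lemma integrable_norm_rpow_double [IsFiniteMeasure (volume.restrict Ω)] (hm : 2 ≤ m)
    {G : ℝ → Space N → Space N}
    (hG : MemLp (fun z : ℝ × Space N => G z.1 z.2) (ENNReal.ofReal m) (cylinder Ω M)) :
    Integrable (fun q : ℝ × (ℝ × Space N) => ‖G q.2.1 q.2.2‖ ^ m) (doubleCylinder Ω M) ∧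
    Integrable (fun q : ℝ × (ℝ × Space N) => ‖G q.1 q.2.2‖ ^ m) (doubleCylinder Ω M) := by
  have h1 := hG.integrable_norm_rpow (ofReal_ne_zero_of_one_le (by linarith)) ENNReal.ofReal_ne_top
  rw [ENNReal.toReal_ofReal (by linarith)] at h1
  have h2 : Integrable (fun q : ℝ × (ℝ × Space N) => ‖G q.2.1 q.2.2‖ ^ m) (doubleCylinder Ω M) :=
    h1.comp_snd _
  exact ⟨h2, measurePreserving_swapTimes.integrable_comp_of_integrable h2⟩

/-- A crude form of Young's inequality: both norms are replaced by the larger one. -/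
lemma abs_rpow_mul_inner_le {E : Type*} [NormedAddCommGroup E] [InnerProductSpace ℝ E]
    (hm : 2 ≤ m) (a b : E) :
    |‖a‖ ^ (m - 2) * inner ℝ a b| ≤ ‖a‖ ^ m + ‖b‖ ^ m := by
  rw [abs_mul, abs_of_nonneg (by positivity)]
  have h1 : ∀ c : ℝ, 0 ≤ c → c ^ (m - 2) * (c * c) = c ^ m := by
    intro c hc
    rcases hc.eq_or_lt with rfl | hc
    · simp [Real.zero_rpow (by linarith : m ≠ 0)]
    · rw [← sq, ← Real.rpow_natCast, ← Real.rpow_add hc]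
      congr 1; norm_num
  calc ‖a‖ ^ (m - 2) * |inner ℝ a b| ≤ ‖a‖ ^ (m - 2) * (‖a‖ * ‖b‖) := by
        gcongr; exact abs_real_inner_le_norm a b
    _ ≤ ‖a‖ ^ m + ‖b‖ ^ m := by
        have hm2 : 0 ≤ m - 2 := by linarith
        rcases le_total ‖a‖ ‖b‖ with h | h
        · calc _ ≤ ‖b‖ ^ (m - 2) * (‖b‖ * ‖b‖) := by gcongr
            _ = ‖b‖ ^ m := h1 _ (norm_nonneg _)
            _ ≤ _ := le_add_of_nonneg_left (by positivity)
        · calc _ ≤ ‖a‖ ^ (m - 2) * (‖a‖ * ‖a‖) := by gcongr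
            _ = ‖a‖ ^ m := h1 _ (norm_nonneg _)
            _ ≤ _ := le_add_of_nonneg_right (by positivity)

lemma abs_rpow_mul_inner_sub_le {E : Type*} [NormedAddCommGroup E] [InnerProductSpace ℝ E]
    (hm : 2 ≤ m) (a b : E) :
    |‖a‖ ^ (m - 2) * inner ℝ a (a - b)| ≤ 3 * (‖a‖ ^ m + ‖b‖ ^ m) := by
  rw [inner_sub_right, mul_sub]
  have h1 := abs_rpow_mul_inner_le hm a a
  have h2 := abs_rpow_mul_inner_le hm a b
  have h3 : 0 ≤ ‖b‖ ^ m := by positivity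
  have h4 := abs_sub (‖a‖ ^ (m - 2) * inner ℝ a a) (‖a‖ ^ (m - 2) * inner ℝ a b)
  linarith

/-- The entropy inequality with `k = u(τ)`, integrated over `τ`. -/
lemma integral_double_kato_nonpos [IsFiniteMeasure (volume.restrict Ω)] (hm : 2 ≤ m) {L : ℝ≥0}
    (hL : LipschitzWith L α) (hα : Monotone α) (hv : RegularSolution Ω M m α v₀ v Gv gv)
    (hu : RegularSolution Ω M m α u₀ u Gu gu)
    (hζ : ∀ t τ, HasDerivAt (fun t => ζ t τ) (ζ₁ t τ) t)
    (hζc : Continuous (Function.uncurry ζ)) (hζ₁c : Continuous (Function.uncurry ζ₁))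
    (hζ0 : ∀ t τ, 0 ≤ ζ t τ) (hζM : ∀ t τ, M ≤ t → ζ t τ = 0) (hε : 0 < ε) :
    Integrable (fun q : ℝ × (ℝ × Space N) => katoIntegrand m α ε (v₀ q.2.2) (v q.2.1 q.2.2)
      (Gv q.2.1 q.2.2) (gv q.2.1 q.2.2) (u q.1 q.2.2) (Gu q.1 q.2.2) (ζ q.2.1 q.1) (ζ₁ q.2.1 q.1))
      (doubleCylinder Ω M) ∧
    ∫ q, katoIntegrand m α ε (v₀ q.2.2) (v q.2.1 q.2.2)
      (Gv q.2.1 q.2.2) (gv q.2.1 q.2.2) (u q.1 q.2.2) (Gu q.1 q.2.2) (ζ q.2.1 q.1) (ζ₁ q.2.1 q.1)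
      ∂(doubleCylinder Ω M) ≤ 0 := by
  -- A point of the doubled domain is q = (τ, (t, x)): `q.1` is the time of u, `q.2.1` the time of
  -- v, and the space variable is shared.
  have hem := (continuous_entropy hε hL.continuous).measurable
  have hH := (continuous_regSign hε).measurable
  have hH' := (continuous_regSignDeriv hε).measurable
  have mv : Measurable fun q : ℝ × (ℝ × Space N) => v q.2.1 q.2.2 := hv.measurable.comp measurable_snd
  have mG : Measurable fun q : ℝ × (ℝ × Space N) => Gv q.2.1 q.2.2 :=
    hv.measurable_grad.comp measurable_snd
  have mg : Measurable fun q : ℝ × (ℝ × Space N) => gv q.2.1 q.2.2 :=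
    hv.measurable_source.comp measurable_snd
  have m0 : Measurable fun q : ℝ × (ℝ × Space N) => v₀ q.2.2 :=
    hv.measurable_init.comp (by fun_prop)
  have mu : Measurable fun q : ℝ × (ℝ × Space N) => u q.1 q.2.2 :=
    hu.measurable.comp (by fun_prop : Measurable fun q : ℝ × (ℝ × Space N) => (q.1, q.2.2))
  have mGu : Measurable fun q : ℝ × (ℝ × Space N) => Gu q.1 q.2.2 :=
    hu.measurable_grad.comp (by fun_prop : Measurable fun q : ℝ × (ℝ × Space N) => (q.1, q.2.2))
  have mζ : Measurable fun q : ℝ × (ℝ × Space N) => ζ q.2.1 q.1 :=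
    hζc.measurable.comp (by fun_prop : Measurable fun q : ℝ × (ℝ × Space N) => (q.2.1, q.1))
  have mζ₁ : Measurable fun q : ℝ × (ℝ × Space N) => ζ₁ q.2.1 q.1 :=
    hζ₁c.measurable.comp (by fun_prop : Measurable fun q : ℝ × (ℝ × Space N) => (q.2.1, q.1))
  have me1 : Measurable fun q : ℝ × (ℝ × Space N) => entropy α ε (v q.2.1 q.2.2) (u q.1 q.2.2) :=
    hem.comp (mv.prodMk mu)
  have me2 : Measurable fun q : ℝ × (ℝ × Space N) => entropy α ε (v₀ q.2.2) (u q.1 q.2.2) :=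
    hem.comp (m0.prodMk mu)
  obtain ⟨Cv, hCv⟩ := hv.bound
  obtain ⟨C₀, hC₀⟩ := hv.bound_init
  obtain ⟨Cg, hCg⟩ := hv.bound_source
  obtain ⟨Cu, hCu⟩ := hu.bound
  obtain ⟨D, hD0, hD⟩ := exists_bound_on_square hζc M
  obtain ⟨D₁, hD₁0, hD₁⟩ := exists_bound_on_square hζ₁c M
  have hint : Integrable (fun q : ℝ × (ℝ × Space N) => katoIntegrand m α ε (v₀ q.2.2)
      (v q.2.1 q.2.2) (Gv q.2.1 q.2.2) (gv q.2.1 q.2.2) (u q.1 q.2.2) (Gu q.1 q.2.2)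
      (ζ q.2.1 q.1) (ζ₁ q.2.1 q.1)) (doubleCylinder Ω M) := by
    unfold katoIntegrand
    refine Integrable.sub (Integrable.add (Integrable.neg ?_) ?_) ?_
    · refine Integrable.of_bound (Measurable.aestronglyMeasurable ((me1.sub me2).mul mζ₁))
        (((L * (Cv + Cu) + 2 * L * ε) + (L * (C₀ + Cu) + 2 * L * ε)) * D₁) ?_
      filter_upwards [ae_doubleCylinder_mem] with q hq
      rw [norm_mul]
      have h1 : ‖entropy α ε (v q.2.1 q.2.2) (u q.1 q.2.2) - entropy α ε (v₀ q.2.2) (u q.1 q.2.2)‖ ≤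
          (L * (Cv + Cu) + 2 * L * ε) + (L * (C₀ + Cu) + 2 * L * ε) :=
        (norm_sub_le _ _).trans (add_le_add (abs_entropy_le hε hL hα (hCv _ _) (hCu _ _))
          (abs_entropy_le hε hL hα (hC₀ _) (hCu _ _)))
      exact mul_le_mul h1 (hD₁ _ hq.2 _ hq.1) (norm_nonneg _) ((norm_nonneg _).trans h1)
    · have hi := (((integrable_norm_rpow_double hm hv.memLp_grad).1.add
        (integrable_norm_rpow_double hm hu.memLp_grad).2).const_mul 3).const_mul (D * (1 / ε))
      refine hi.mono' (Measurable.aestronglyMeasurable ?_) ?_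
      · refine (mζ.mul (hH'.comp (mv.sub mu))).mul ?_
        exact (mG.norm.pow_const _).mul (mG.inner (mG.sub mGu))
      · filter_upwards [ae_doubleCylinder_mem] with q hq
        rw [norm_mul, norm_mul]
        refine mul_le_mul (mul_le_mul (hD _ hq.2 _ hq.1) ?_ (norm_nonneg _) hD0) ?_
          (norm_nonneg _) (by positivity)
        · rw [Real.norm_of_nonneg (regSignDeriv_nonneg _)]
          exact regSignDeriv_le hε _
        · exact abs_rpow_mul_inner_sub_le hm _ _
    · refine Integrable.of_bound (Measurable.aestronglyMeasurable
        (mg.mul (mζ.mul (hH.comp (mv.sub mu))))) (Cg * (D * 1)) ?_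
      filter_upwards [ae_doubleCylinder_mem] with q hq
      rw [norm_mul, norm_mul]
      refine mul_le_mul (hCg _ _) (mul_le_mul (hD _ hq.2 _ hq.1) (abs_regSign_le hε _)
        (norm_nonneg _) hD0) (by positivity) ((abs_nonneg _).trans (hCg 0 0))
  refine ⟨hint, ?_⟩
  rw [doubleCylinder, integral_prod _ hint]
  refine integral_nonpos_of_ae ?_
  -- For almost every τ the slice u(τ) belongs to W_0^{1,m}(Ω), hence is an admissible k.
  filter_upwards [hu.memW0] with τ hτ
  have hpair : Measurable fun x : Space N => (τ, x) := by fun_prop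
  exact (hv.kato hm hL hα (hu.measurable.comp hpair) ⟨Cu, hCu τ⟩ (hu.measurable_grad.comp hpair) hτ
    (fun t => hζ t τ) (hζ₁c.comp (by fun_prop : Continuous fun t : ℝ => (t, τ))) (fun t => hζ0 t τ)
    (fun t ht => hζM t τ ht) hε).2

/-- The elliptic terms have a sign, the entropies are close to `|α(r) - α(k)|`. -/
lemma le_katoIntegrand_add (hm : 2 ≤ m) {L : ℝ≥0} (hL : LipschitzWith L α) (hα : Monotone α)
    (hε : 0 < ε) (r₀ r k₀ k : ℝ) (A B : Space N) (a b : ℝ) {z : ℝ} (hz : 0 ≤ z) (z₁ z₂ : ℝ) :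
    -((|α r - α k| - |α r₀ - α k|) * z₁) - (|α r - α k| - |α r - α k₀|) * z₂ - |a - b| * z -
      4 * L * ε * (|z₁| + |z₂|) ≤
    katoIntegrand m α ε r₀ r A a k B z z₁ + katoIntegrand m α ε k₀ k B b r A z z₂ := by
  have e1 := abs_entropy_sub_le hε hL hα r k
  have e2 := abs_entropy_sub_le hε hL hα r₀ k
  have e3 := abs_entropy_sub_le hε hL hα k r
  have e4 := abs_entropy_sub_le hε hL hα k₀ r
  rw [abs_sub_comm (α k) (α r)] at e3
  rw [abs_sub_comm (α k₀) (α r)] at e4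
  have hmono := inner_rpow_smul_sub_nonneg (by linarith : 0 ≤ m - 2) A B
  have hneg : regSignDeriv ε (k - r) = regSignDeriv ε (r - k) := by
    rw [← regSignDeriv_neg, neg_sub]
  have hneg' : regSign ε (k - r) = -regSign ε (r - k) := by rw [← regSign_neg, neg_sub]
  have hinner : inner ℝ B (B - A) = -inner ℝ B (A - B) := by rw [← inner_neg_right, neg_sub]
  -- Each difference of two entropies carries two errors of size 2Lε, hence the constant 4Lε.
  have key1 : ∀ p q p' q' w : ℝ, |p - p'| ≤ 2 * L * ε → |q - q'| ≤ 2 * L * ε →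
      (p - q) * w ≤ (p' - q') * w + 4 * L * ε * |w| := by
    intro p q p' q' w hp hq
    have h1 : |(p - q) - (p' - q')| ≤ 4 * L * ε := by
      rw [abs_le] at hp hq ⊢
      constructor <;> linarith [hp.1, hp.2, hq.1, hq.2]
    have h2 : ((p - q) - (p' - q')) * w ≤ 4 * L * ε * |w| := by
      refine (le_abs_self _).trans ?_
      rw [abs_mul]
      gcongr
    linarith
  have k1 := key1 _ _ _ _ z₁ e1 e2
  have k2 := key1 _ _ _ _ z₂ e3 e4
  -- H is odd, so the two source terms merge into one with the factor a - b.
  have k3 : (a - b) * (z * regSign ε (r - k)) ≤ |a - b| * z := by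
    refine (le_abs_self _).trans ?_
    rw [abs_mul, abs_mul, abs_of_nonneg hz]
    have := abs_regSign_le hε (r - k)
    gcongr
    nlinarith
  -- H' is even, so both elliptic terms carry the same weight and their sum is the monotonicity
  -- expression. Its sign compensates for the size 1/ε of H'.
  have k4 := mul_nonneg (mul_nonneg hz (regSignDeriv_nonneg (ε := ε) (r - k))) hmono
  unfold katoIntegrand
  rw [hneg, hneg', hinner]
  nlinarith

/-- The entropy inequality with doubled time variable. -/
lemma integral_double_nonpos [IsFiniteMeasure (volume.restrict Ω)] (hm : 2 ≤ m) {L : ℝ≥0}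
    (hL : LipschitzWith L α) (hα : Monotone α) (hv : RegularSolution Ω M m α v₀ v Gv gv)
    (hu : RegularSolution Ω M m α u₀ u Gu gu)
    (hζ₁ : ∀ t τ, HasDerivAt (fun t => ζ t τ) (ζ₁ t τ) t)
    (hζ₂ : ∀ t τ, HasDerivAt (fun τ => ζ t τ) (ζ₂ t τ) τ)
    (hζc : Continuous (Function.uncurry ζ)) (hζ₁c : Continuous (Function.uncurry ζ₁))
    (hζ₂c : Continuous (Function.uncurry ζ₂)) (hζ0 : ∀ t τ, 0 ≤ ζ t τ)
    (hζM : ∀ t τ, M ≤ t → ζ t τ = 0) (hζM' : ∀ t τ, M ≤ τ → ζ t τ = 0) :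
    ∫ q : ℝ × (ℝ × Space N),
      (-((|α (v q.2.1 q.2.2) - α (u q.1 q.2.2)| - |α (v₀ q.2.2) - α (u q.1 q.2.2)|) * ζ₁ q.2.1 q.1) -
        (|α (v q.2.1 q.2.2) - α (u q.1 q.2.2)| - |α (v q.2.1 q.2.2) - α (u₀ q.2.2)|) * ζ₂ q.2.1 q.1 -
        |gv q.2.1 q.2.2 - gu q.1 q.2.2| * ζ q.2.1 q.1) ∂(doubleCylinder Ω M) ≤ 0 := by
  have hαm := hL.continuous.measurable
  have hLip : ∀ a b, |α a - α b| ≤ L * |a - b| := fun a b => by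
    simpa [Real.dist_eq] using hL.dist_le_mul a b
  have mv : Measurable fun q : ℝ × (ℝ × Space N) => v q.2.1 q.2.2 := hv.measurable.comp measurable_snd
  have mg : Measurable fun q : ℝ × (ℝ × Space N) => gv q.2.1 q.2.2 :=
    hv.measurable_source.comp measurable_snd
  have m0 : Measurable fun q : ℝ × (ℝ × Space N) => v₀ q.2.2 :=
    hv.measurable_init.comp (by fun_prop)
  have mu0 : Measurable fun q : ℝ × (ℝ × Space N) => u₀ q.2.2 :=
    hu.measurable_init.comp (by fun_prop)
  have mu : Measurable fun q : ℝ × (ℝ × Space N) => u q.1 q.2.2 :=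
    hu.measurable.comp (by fun_prop : Measurable fun q : ℝ × (ℝ × Space N) => (q.1, q.2.2))
  have mgu : Measurable fun q : ℝ × (ℝ × Space N) => gu q.1 q.2.2 :=
    hu.measurable_source.comp (by fun_prop : Measurable fun q : ℝ × (ℝ × Space N) => (q.1, q.2.2))
  have hsw : Measurable fun q : ℝ × (ℝ × Space N) => (q.2.1, q.1) := by fun_prop
  have mζ : Measurable fun q : ℝ × (ℝ × Space N) => ζ q.2.1 q.1 := hζc.measurable.comp hsw
  have mζ₁ : Measurable fun q : ℝ × (ℝ × Space N) => ζ₁ q.2.1 q.1 := hζ₁c.measurable.comp hsw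
  have mζ₂ : Measurable fun q : ℝ × (ℝ × Space N) => ζ₂ q.2.1 q.1 := hζ₂c.measurable.comp hsw
  obtain ⟨Cv, hCv⟩ := hv.bound
  obtain ⟨C₀, hC₀⟩ := hv.bound_init
  obtain ⟨Cg, hCg⟩ := hv.bound_source
  obtain ⟨Cu, hCu⟩ := hu.bound
  obtain ⟨Cu₀, hCu₀⟩ := hu.bound_init
  obtain ⟨Cgu, hCgu⟩ := hu.bound_source
  obtain ⟨D, hD0, hD⟩ := exists_bound_on_square hζc M
  obtain ⟨D₁, hD₁0, hD₁⟩ := exists_bound_on_square hζ₁c M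
  obtain ⟨D₂, hD₂0, hD₂⟩ := exists_bound_on_square hζ₂c M
  have hα' : ∀ {a b A B : ℝ}, |a| ≤ A → |b| ≤ B → |α a - α b| ≤ L * (A + B) := by
    intro a b A B ha hb
    refine (hLip a b).trans ?_
    gcongr
    exact (abs_sub _ _).trans (add_le_add ha hb)
  have hE : Integrable (fun q : ℝ × (ℝ × Space N) =>
      4 * (L : ℝ) * (|ζ₁ q.2.1 q.1| + |ζ₂ q.2.1 q.1|)) (doubleCylinder Ω M) := by
    refine Integrable.const_mul (Integrable.add (Integrable.abs ?_) (Integrable.abs ?_)) _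
    · refine Integrable.of_bound mζ₁.aestronglyMeasurable D₁ ?_
      filter_upwards [ae_doubleCylinder_mem] with q hq using hD₁ _ hq.2 _ hq.1
    · refine Integrable.of_bound mζ₂.aestronglyMeasurable D₂ ?_
      filter_upwards [ae_doubleCylinder_mem] with q hq using hD₂ _ hq.2 _ hq.1
  have mE : Measurable fun q : ℝ × (ℝ × Space N) => |α (v q.2.1 q.2.2) - α (u q.1 q.2.2)| :=
    continuous_abs.measurable.comp ((hαm.comp mv).sub (hαm.comp mu))
  have mE₀ : Measurable fun q : ℝ × (ℝ × Space N) => |α (v₀ q.2.2) - α (u q.1 q.2.2)| :=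
    continuous_abs.measurable.comp ((hαm.comp m0).sub (hαm.comp mu))
  have mE₀' : Measurable fun q : ℝ × (ℝ × Space N) => |α (v q.2.1 q.2.2) - α (u₀ q.2.2)| :=
    continuous_abs.measurable.comp ((hαm.comp mv).sub (hαm.comp mu0))
  have mg' : Measurable fun q : ℝ × (ℝ × Space N) => |gv q.2.1 q.2.2 - gu q.1 q.2.2| :=
    continuous_abs.measurable.comp (mg.sub mgu)
  set I₀ : ℝ × (ℝ × Space N) → ℝ := fun q =>
    -((|α (v q.2.1 q.2.2) - α (u q.1 q.2.2)| - |α (v₀ q.2.2) - α (u q.1 q.2.2)|) * ζ₁ q.2.1 q.1) -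
      (|α (v q.2.1 q.2.2) - α (u q.1 q.2.2)| - |α (v q.2.1 q.2.2) - α (u₀ q.2.2)|) * ζ₂ q.2.1 q.1 -
      |gv q.2.1 q.2.2 - gu q.1 q.2.2| * ζ q.2.1 q.1
  have hI₀ : Integrable I₀ (doubleCylinder Ω M) := by
    refine Integrable.sub (Integrable.sub (Integrable.neg ?_) ?_) ?_
    · refine Integrable.of_bound (Measurable.aestronglyMeasurable (by fun_prop))
        ((L * (Cv + Cu) + L * (C₀ + Cu)) * D₁) ?_
      filter_upwards [ae_doubleCylinder_mem] with q hq
      rw [norm_mul]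
      have h1 : ‖|α (v q.2.1 q.2.2) - α (u q.1 q.2.2)| - |α (v₀ q.2.2) - α (u q.1 q.2.2)|‖ ≤
          L * (Cv + Cu) + L * (C₀ + Cu) := by
        refine (norm_sub_le _ _).trans ?_
        rw [norm_abs_eq_norm, norm_abs_eq_norm]
        exact add_le_add (hα' (hCv _ _) (hCu _ _)) (hα' (hC₀ _) (hCu _ _))
      exact mul_le_mul h1 (hD₁ _ hq.2 _ hq.1) (norm_nonneg _) ((norm_nonneg _).trans h1)
    · refine Integrable.of_bound (Measurable.aestronglyMeasurable (by fun_prop))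
        ((L * (Cv + Cu) + L * (Cv + Cu₀)) * D₂) ?_
      filter_upwards [ae_doubleCylinder_mem] with q hq
      rw [norm_mul]
      have h1 : ‖|α (v q.2.1 q.2.2) - α (u q.1 q.2.2)| - |α (v q.2.1 q.2.2) - α (u₀ q.2.2)|‖ ≤
          L * (Cv + Cu) + L * (Cv + Cu₀) := by
        refine (norm_sub_le _ _).trans ?_
        rw [norm_abs_eq_norm, norm_abs_eq_norm]
        exact add_le_add (hα' (hCv _ _) (hCu _ _)) (hα' (hCv _ _) (hCu₀ _))
      exact mul_le_mul h1 (hD₂ _ hq.2 _ hq.1) (norm_nonneg _) ((norm_nonneg _).trans h1)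
    · refine Integrable.of_bound (Measurable.aestronglyMeasurable (by fun_prop))
        ((Cg + Cgu) * D) ?_
      filter_upwards [ae_doubleCylinder_mem] with q hq
      rw [norm_mul, norm_abs_eq_norm]
      have h1 : ‖gv q.2.1 q.2.2 - gu q.1 q.2.2‖ ≤ Cg + Cgu :=
        (norm_sub_le _ _).trans (add_le_add (hCg _ _) (hCgu _ _))
      exact mul_le_mul h1 (hD _ hq.2 _ hq.1) (norm_nonneg _) ((norm_nonneg _).trans h1)
  -- The integrand `I₀` does not contain ε, so an upper bound of order ε suffices.
  have hε : ∀ ε : ℝ, 0 < ε → ∫ q, I₀ q ∂(doubleCylinder Ω M) ≤ ε * ∫ q : ℝ × (ℝ × Space N),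
      4 * (L : ℝ) * (|ζ₁ q.2.1 q.1| + |ζ₂ q.2.1 q.1|) ∂(doubleCylinder Ω M) := by
    intro ε hε
    obtain ⟨i1, n1⟩ := integral_double_kato_nonpos hm hL hα hv hu hζ₁ hζc hζ₁c hζ0 hζM hε
    -- The same inequality with v and u exchanged and ζ transposed; the two time variables are then
    -- swapped back so that both integrals use the same coordinates.
    obtain ⟨i2, n2⟩ := integral_double_kato_nonpos (ζ := fun t τ => ζ τ t)
      (ζ₁ := fun t τ => ζ₂ τ t) hm hL hα hu hv (fun t τ => hζ₂ τ t)
      (hζc.comp continuous_swap) (hζ₂c.comp continuous_swap) (fun t τ => hζ0 τ t)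
      (fun t τ h => hζM' τ t h) hε
    rw [← measurePreserving_swapTimes.integral_comp'] at n2
    have i2' := (measurePreserving_swapTimes (Ω := Ω) (M := M)).integrable_comp_of_integrable i2
    rw [← integral_const_mul, ← sub_nonpos, ← integral_sub hI₀ (hE.const_mul ε)]
    refine le_trans ?_ ((integral_add i1 i2').le.trans (add_nonpos n1 n2))
    refine integral_mono (hI₀.sub (hE.const_mul ε)) (i1.add i2') fun q => ?_
    have := le_katoIntegrand_add hm hL hα hε (v₀ q.2.2) (v q.2.1 q.2.2) (u₀ q.2.2) (u q.1 q.2.2)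
      (Gv q.2.1 q.2.2) (Gu q.1 q.2.2) (gv q.2.1 q.2.2) (gu q.1 q.2.2) (hζ0 q.2.1 q.1)
      (ζ₁ q.2.1 q.1) (ζ₂ q.2.1 q.1)
    refine le_trans (le_of_eq ?_) this
    simp only [I₀]
    ring
  have hlim : Tendsto (fun ε : ℝ => ε * ∫ q : ℝ × (ℝ × Space N),
      4 * (L : ℝ) * (|ζ₁ q.2.1 q.1| + |ζ₂ q.2.1 q.1|) ∂(doubleCylinder Ω M)) (𝓝[>] 0) (𝓝 0) := by
    have : Tendsto (fun ε : ℝ => ε) (𝓝[>] 0) (𝓝 0) := tendsto_nhdsWithin_of_tendsto_nhds tendsto_id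
    simpa using this.mul_const _
  refine ge_of_tendsto hlim ?_
  filter_upwards [self_mem_nhdsWithin] with ε h using hε ε h

end Doubling

/-! ### Density of test functions. -/

section Density

variable {N : ℕ} {Ω : Set (Space N)}

lemma IsTestFunction.memLp {φ : Space N → ℝ} (h : IsTestFunction Ω φ) (p : ℝ≥0∞) :
    MemLp φ p (volume.restrict Ω) :=
  h.1.continuous.memLp_of_hasCompactSupport h.2.1

/-- Test functions as a subspace of `L^2(Ω)`. -/
noncomputable def testSubmodule (Ω : Set (Space N)) : Submodule ℝ (Lp ℝ 2 (volume.restrict Ω)) where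
  carrier := {f | ∃ φ, IsTestFunction Ω φ ∧ f =ᵐ[volume.restrict Ω] φ}
  zero_mem' := ⟨_, IsTestFunction.zero, Lp.coeFn_zero _ _ _⟩
  add_mem' := by
    rintro a b ⟨φ, hφ, h1⟩ ⟨ψ, hψ, h2⟩
    refine ⟨_, hφ.lincomb hψ 1 1, ?_⟩
    filter_upwards [Lp.coeFn_add a b, h1, h2] with x h3 h4 h5
    rw [h3, Pi.add_apply, h4, h5, one_mul, one_mul]
  smul_mem' := by
    rintro c a ⟨φ, hφ, h1⟩
    refine ⟨_, hφ.lincomb hφ c 0, ?_⟩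
    filter_upwards [Lp.coeFn_smul c a, h1] with x h3 h4
    rw [h3, Pi.smul_apply, h4, smul_eq_mul, zero_mul, add_zero]

/-- In the Hilbert space L² density means a trivial orthogonal complement, and a function orthogonal
to all test functions vanishes almost everywhere by the fundamental lemma of the calculus of
variations. -/
lemma testSubmodule_topologicalClosure (hΩ : IsOpen Ω) [IsFiniteMeasure (volume.restrict Ω)] :
    (testSubmodule Ω).topologicalClosure = ⊤ := by
  rw [Submodule.topologicalClosure_eq_top_iff, Submodule.eq_bot_iff]
  intro f hf
  have h0 : ∀ᵐ x, x ∈ Ω → f x = 0 := by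
    refine hΩ.ae_eq_zero_of_integral_contDiff_smul_eq_zero ?_ fun φ h1 h2 h3 => ?_
    · have : IntegrableOn f Ω volume := (Lp.memLp f).integrable (by norm_num)
      exact this.locallyIntegrableOn
    · have hφ : IsTestFunction Ω φ := ⟨h1, h2, h3⟩
      have h4 := (Submodule.mem_orthogonal _ f).1 hf ((hφ.memLp 2).toLp φ)
        ⟨φ, hφ, MemLp.coeFn_toLp _⟩
      rw [L2.inner_def] at h4
      rw [← setIntegral_eq_integral_of_forall_compl_eq_zero (s := Ω), ← h4]
      · refine integral_congr_ae ?_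
        filter_upwards [(hφ.memLp 2).coeFn_toLp] with x hx
        simp [hx, mul_comm]
      · intro x hx
        rw [image_eq_zero_of_notMem_tsupport fun h => hx (h3 h), zero_smul]
  rw [Lp.eq_zero_iff_ae_eq_zero]
  exact (ae_restrict_iff' hΩ.measurableSet).2 h0

/-- Density of the test functions in `L^1(Ω)`. -/
lemma exists_testFunction_integral_sub_lt (hΩ : IsOpen Ω) [IsFiniteMeasure (volume.restrict Ω)]
    {w : Space N → ℝ} (hw : MemLp w 2 (volume.restrict Ω)) {η : ℝ} (hη : 0 < η) :
    ∃ φ, IsTestFunction Ω φ ∧ ∫ x in Ω, |w x - φ x| < η := by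
  have hmem : hw.toLp w ∈ (testSubmodule Ω).topologicalClosure := by
    rw [testSubmodule_topologicalClosure hΩ]; trivial
  set c : ℝ := ((volume.restrict Ω) univ ^ ((1 : ℝ) / (1 : ℝ≥0∞).toReal - 1 / (2 : ℝ≥0∞).toReal)).toReal
    with hc
  have hc0 : 0 ≤ c := ENNReal.toReal_nonneg
  -- Here c is Hölder's constant for passing from L² to L¹ on Ω; the summand 1 covers c = 0.
  obtain ⟨f, ⟨φ, hφ, hf⟩, hd⟩ := Metric.mem_closure_iff.1 hmem (η / (c + 1)) (by positivity)
  refine ⟨φ, hφ, ?_⟩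
  have hsub : MemLp (fun x => w x - φ x) 2 (volume.restrict Ω) := hw.sub (hφ.memLp 2)
  have h1 : ∫ x in Ω, |w x - φ x| = (eLpNorm (fun x => w x - φ x) 1 (volume.restrict Ω)).toReal := by
    rw [eLpNorm_one_eq_lintegral_enorm, ← integral_norm_eq_lintegral_enorm hsub.1]
    rfl
  have h2 := eLpNorm_le_eLpNorm_mul_rpow_measure_univ (p := 1) (q := 2) (by norm_num) hsub.1
  have h3 : eLpNorm (fun x => w x - φ x) 2 (volume.restrict Ω) =
      ENNReal.ofReal (dist (hw.toLp w) f) := by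
    rw [Lp.dist_def, ENNReal.ofReal_toReal]
    · refine eLpNorm_congr_ae ?_
      filter_upwards [hw.coeFn_toLp, hf] with x h4 h5
      simp [h4, h5]
    · exact ((Lp.memLp _).sub (Lp.memLp _)).2.ne
  have h4 : ((volume.restrict Ω) univ ^
      ((1 : ℝ) / (1 : ℝ≥0∞).toReal - 1 / (2 : ℝ≥0∞).toReal)) ≠ ∞ := by
    refine ENNReal.rpow_ne_top_of_nonneg (by norm_num) (measure_ne_top _ _)
  rw [h1]
  have h5 := ENNReal.toReal_mono (ENNReal.mul_ne_top hsub.2.ne h4) h2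
  rw [ENNReal.toReal_mul, h3, ENNReal.toReal_ofReal dist_nonneg, ← hc] at h5
  calc _ ≤ dist (hw.toLp w) f * c := h5
    _ ≤ η / (c + 1) * c := by gcongr
    _ < η := by
      rw [div_mul_eq_mul_div, div_lt_iff₀ (by positivity)]
      nlinarith

end Density

/-! ### One-sided mollifiers in time. -/

/-- A continuously differentiable probability density `ρ` on `(0, δ)` with derivative `ρ'`. -/
structure IsTimeMollifier (δ : ℝ) (ρ ρ' : ℝ → ℝ) : Prop where
  hasDerivAt : ∀ t, HasDerivAt ρ (ρ' t) t
  continuous_deriv : Continuous ρ'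
  nonneg : ∀ t, 0 ≤ ρ t
  eq_zero_of_nonpos : ∀ t, t ≤ 0 → ρ t = 0
  eq_zero_of_le : ∀ t, δ ≤ t → ρ t = 0
  integral_eq_one : ∫ t, ρ t = 1

lemma exists_isTimeMollifier {δ : ℝ} (hδ : 0 < δ) : ∃ ρ ρ', IsTimeMollifier δ ρ ρ' := by
  -- Centre δ/2 and outer radius δ/4 keep the support inside (0, δ).
  let b : ContDiffBump (δ / 2) := ⟨δ / 8, δ / 4, by positivity, by linarith⟩
  have hsm : ContDiff ℝ 1 (b.normed volume) := b.contDiff_normed (n := 1)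
  have hsupp : ∀ t, t ∉ Metric.ball (δ / 2) (δ / 4) → b.normed volume t = 0 := by
    intro t ht
    have : t ∉ Function.support (b.normed volume) := by rwa [b.support_normed_eq]
    simpa using this
  refine ⟨b.normed volume, deriv (b.normed volume),
    fun t => (hsm.differentiable (by norm_num) t).hasDerivAt, hsm.continuous_deriv (by norm_num),
    fun t => b.nonneg_normed t, fun t ht => hsupp t ?_, fun t ht => hsupp t ?_, b.integral_normed⟩
  · rw [Metric.mem_ball, Real.dist_eq, abs_lt]
    exact fun h => by linarith [h.1]
  · rw [Metric.mem_ball, Real.dist_eq, abs_lt]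
    exact fun h => by linarith [h.2]

namespace IsTimeMollifier

variable {δ M : ℝ} {ρ ρ' : ℝ → ℝ}

lemma continuous (h : IsTimeMollifier δ ρ ρ') : Continuous ρ :=
  continuous_iff_continuousAt.2 fun t => (h.hasDerivAt t).continuousAt

lemma integrable (h : IsTimeMollifier δ ρ ρ') : Integrable ρ :=
  Integrable.of_integral_ne_zero (by rw [h.integral_eq_one]; exact one_ne_zero)

lemma setIntegral_Ioo (h : IsTimeMollifier δ ρ ρ') (hM : δ ≤ M) : ∫ t in Ioo 0 M, ρ t = 1 := by
  rw [← h.integral_eq_one]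
  refine setIntegral_eq_integral_of_forall_compl_eq_zero fun t ht => ?_
  rw [mem_Ioo, not_and_or, not_lt, not_lt] at ht
  rcases ht with ht | ht
  · exact h.eq_zero_of_nonpos t ht
  · exact h.eq_zero_of_le t (hM.trans ht)

end IsTimeMollifier

/-! ### The initial datum is attained in L¹. -/

section InitialTrace

variable {N : ℕ} {Ω : Set (Space N)} {M m : ℝ} {α : ℝ → ℝ} {v₀ : Space N → ℝ}
  {v : ℝ → Space N → ℝ} {G : ℝ → Space N → Space N} {g : ℝ → Space N → ℝ}
  {k : Space N → ℝ} {Gk : Space N → Space N} {ε : ℝ}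

lemma integrable_cylinder_of_bound [IsFiniteMeasure (volume.restrict Ω)] {F : ℝ × Space N → ℝ}
    (hF : Measurable F) {C : ℝ} (hC : ∀ z : ℝ × Space N, z.1 ∈ Ioo 0 M → |F z| ≤ C) :
    Integrable F (cylinder Ω M) := by
  refine Integrable.of_bound hF.aestronglyMeasurable C ?_
  rw [cylinder_eq_restrict]
  filter_upwards [ae_restrict_mem measurableSet_timeStrip] with z hz using hC z hz.1

lemma integral_mollifier_mul [IsFiniteMeasure (volume.restrict Ω)] {δ : ℝ} {ρ ρ' : ℝ → ℝ}
    (hρ : IsTimeMollifier δ ρ ρ') (hδ : δ ≤ M) (h : Space N → ℝ) :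
    ∫ z, ρ z.1 * h z.2 ∂(cylinder Ω M) = ∫ x in Ω, h x := by
  rw [cylinder, integral_prod_mul, hρ.setIntegral_Ioo hδ, one_mul]

/-- The initial layer estimate: averages over `(0, δ)` of `|α(v(t)) - α(k)|`. -/
lemma integral_mollifier_sub_le [IsFiniteMeasure (volume.restrict Ω)] (hm : 2 ≤ m) {L : ℝ≥0}
    (hL : LipschitzWith L α) (hα : Monotone α) (hsol : RegularSolution Ω M m α v₀ v G g)
    (hk : Measurable k) (hkb : ∃ C, ∀ x, |k x| ≤ C) (hGk : Measurable Gk) (hkW : MemW0 Ω m k Gk)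
    (hε : 0 < ε) : ∃ W : ℝ × Space N → ℝ, Integrable W (cylinder Ω M) ∧ (∀ z, 0 ≤ W z) ∧
      ∀ δ ρ ρ', IsTimeMollifier δ ρ ρ' → δ ≤ M →
        ∫ z, ρ z.1 * |α (v z.1 z.2) - α (k z.2)| ∂(cylinder Ω M) ≤
          (∫ x in Ω, |α (v₀ x) - α (k x)|) + 4 * L * ε * (volume.restrict Ω).real univ +
          ∫ z, {z : ℝ × Space N | z.1 < δ}.indicator W z ∂(cylinder Ω M) := by
  obtain ⟨Cv, hCv⟩ := hsol.bound
  obtain ⟨C₀, hC₀⟩ := hsol.bound_init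
  obtain ⟨Cg, hCg⟩ := hsol.bound_source
  obtain ⟨Ck, hCk⟩ := id hkb
  have hCg0 : 0 ≤ Cg := (abs_nonneg _).trans (hCg 0 0)
  have hm0 := ofReal_ne_zero_of_one_le (by linarith : 1 ≤ m)
  have iG := hsol.memLp_grad.integrable_norm_rpow hm0 ENNReal.ofReal_ne_top
  have iGk := (hkW.2.1.integrable_norm_rpow hm0 ENNReal.ofReal_ne_top).comp_snd
    (volume.restrict (Ioo 0 M))
  rw [ENNReal.toReal_ofReal (by linarith)] at iG iGk
  -- This W dominates the terms multiplied by ζ: 1/ε bounds H', the factor 3(...) the elliptic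
  -- product, and Cg the source. It does not depend on the mollifier.
  have hW : Integrable (fun z : ℝ × Space N =>
      1 / ε * (3 * (‖G z.1 z.2‖ ^ m + ‖Gk z.2‖ ^ m)) + Cg) (cylinder Ω M) :=
    (((iG.add iGk).const_mul 3).const_mul _).add (integrable_const _)
  refine ⟨_, hW, fun z => by positivity, fun δ ρ ρ' hρ hδ => ?_⟩
  -- With ζ' = -ρ the time term of the entropy inequality is the ρ-average of the entropies. On (0,
  -- M), ζ lies between 0 and 1, and it vanishes from δ on, so all other terms live on the layer t <
  -- δ.
  set ζ : ℝ → ℝ := fun t => -∫ s in M..t, ρ s with hζ_def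
  have hζd : ∀ t, HasDerivAt ζ (-ρ t) t := fun t =>
    (hρ.continuous.integral_hasStrictDerivAt M t).hasDerivAt.neg
  have hζle : ∀ t, t ≤ M → ζ t = ∫ s in Ioc t M, ρ s := fun t ht => by
    rw [hζ_def]
    simp only
    rw [← intervalIntegral.integral_symm, intervalIntegral.integral_of_le ht]
  have hζδ : ∀ t, δ ≤ t → ζ t = 0 := fun t ht => by
    rw [hζ_def]
    simp only
    rw [neg_eq_zero, ← intervalIntegral.integral_zero (a := M) (b := t)]
    refine intervalIntegral.integral_congr fun s hs => ?_
    exact hρ.eq_zero_of_le s ((le_min hδ ht).trans hs.1)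
  have hζ0 : ∀ t, 0 ≤ ζ t := fun t => by
    rcases le_total t M with ht | ht
    · rw [hζle t ht]
      exact integral_nonneg fun s => hρ.nonneg s
    · exact (hζδ t (hδ.trans ht)).ge
  have hζ1 : ∀ t, t ≤ M → ζ t ≤ 1 := fun t ht => by
    rw [hζle t ht, ← hρ.integral_eq_one]
    exact setIntegral_le_integral hρ.integrable (ae_of_all _ hρ.nonneg)
  obtain ⟨iK, nK⟩ := hsol.kato hm hL hα hk hkb hGk hkW hζd hρ.continuous.neg hζ0
    (fun t ht => hζδ t (hδ.trans ht)) hε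
  have hαm := hL.continuous.measurable
  have hρm := hρ.continuous.measurable
  obtain ⟨Cρ, -, hCρ⟩ := exists_bound_on_Icc hρ.continuous 0 M
  have hLip : ∀ a b, |α a - α b| ≤ L * |a - b| := fun a b => by
    simpa [Real.dist_eq] using hL.dist_le_mul a b
  have hb : ∀ {a b A B : ℝ}, |a| ≤ A → |b| ≤ B → |α a - α b| ≤ L * (A + B) := by
    intro a b A B ha hb
    refine (hLip a b).trans ?_
    gcongr
    exact (abs_sub _ _).trans (add_le_add ha hb)
  have m1 : Measurable fun z : ℝ × Space N => ρ z.1 * |α (v z.1 z.2) - α (k z.2)| :=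
    (hρm.comp measurable_fst).mul (continuous_abs.measurable.comp
      ((hαm.comp hsol.measurable).sub (hαm.comp (hk.comp measurable_snd))))
  have m2 : Measurable fun z : ℝ × Space N => ρ z.1 * (|α (v₀ z.2) - α (k z.2)| + 4 * L * ε) :=
    (hρm.comp measurable_fst).mul ((continuous_abs.measurable.comp
      ((hαm.comp (hsol.measurable_init.comp measurable_snd)).sub
        (hαm.comp (hk.comp measurable_snd)))).add_const _)
  have i1 : Integrable (fun z : ℝ × Space N => ρ z.1 * |α (v z.1 z.2) - α (k z.2)|)
      (cylinder Ω M) := by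
    refine integrable_cylinder_of_bound m1 (C := Cρ * (L * (Cv + Ck))) fun z hz => ?_
    rw [abs_mul, abs_abs]
    exact mul_le_mul (hCρ _ (Ioo_subset_Icc_self hz)) (hb (hCv _ _) (hCk _)) (abs_nonneg _)
      ((abs_nonneg _).trans (hCρ _ (Ioo_subset_Icc_self hz)))
  have i2 : Integrable (fun z : ℝ × Space N => ρ z.1 * (|α (v₀ z.2) - α (k z.2)| + 4 * L * ε))
      (cylinder Ω M) := by
    refine integrable_cylinder_of_bound m2 (C := Cρ * (L * (C₀ + Ck) + 4 * L * ε)) fun z hz => ?_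
    rw [abs_mul, abs_of_nonneg (a := _ + _) (by positivity)]
    exact mul_le_mul (hCρ _ (Ioo_subset_Icc_self hz))
      (add_le_add (hb (hC₀ _) (hCk _)) le_rfl) (by positivity)
      ((abs_nonneg _).trans (hCρ _ (Ioo_subset_Icc_self hz)))
  have hδm : MeasurableSet {z : ℝ × Space N | z.1 < δ} :=
    measurableSet_lt measurable_fst measurable_const
  have i3 := hW.indicator hδm
  have hle : ∫ z, (ρ z.1 * |α (v z.1 z.2) - α (k z.2)| -
      ρ z.1 * (|α (v₀ z.2) - α (k z.2)| + 4 * L * ε) - {z : ℝ × Space N | z.1 < δ}.indicator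
        (fun z => 1 / ε * (3 * (‖G z.1 z.2‖ ^ m + ‖Gk z.2‖ ^ m)) + Cg) z) ∂(cylinder Ω M) ≤ 0 := by
    refine le_trans (integral_mono_ae ((i1.sub i2).sub i3) iK ?_) nK
    rw [cylinder_eq_restrict]
    filter_upwards [ae_restrict_mem measurableSet_timeStrip] with z hz
    have hK : ρ z.1 * |α (v z.1 z.2) - α (k z.2)| -
        ρ z.1 * (|α (v₀ z.2) - α (k z.2)| + 4 * L * ε) -
        ζ z.1 * (1 / ε * (3 * (‖G z.1 z.2‖ ^ m + ‖Gk z.2‖ ^ m)) + Cg) ≤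
        katoIntegrand m α ε (v₀ z.2) (v z.1 z.2) (G z.1 z.2) (g z.1 z.2) (k z.2) (Gk z.2) (ζ z.1)
          (-ρ z.1) := by
      have e1 := (abs_le.1 (abs_entropy_sub_le hε hL hα (v z.1 z.2) (k z.2))).1
      have e2 := (abs_le.1 (abs_entropy_sub_le hε hL hα (v₀ z.2) (k z.2))).2
      have e3 : ρ z.1 * (|α (v z.1 z.2) - α (k z.2)| - (|α (v₀ z.2) - α (k z.2)| + 4 * L * ε)) ≤
          ρ z.1 * (entropy α ε (v z.1 z.2) (k z.2) - entropy α ε (v₀ z.2) (k z.2)) :=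
        mul_le_mul_of_nonneg_left (by linarith) (hρ.nonneg _)
      have e4 : |regSignDeriv ε (v z.1 z.2 - k z.2) *
          (‖G z.1 z.2‖ ^ (m - 2) * inner ℝ (G z.1 z.2) (G z.1 z.2 - Gk z.2))| ≤
          1 / ε * (3 * (‖G z.1 z.2‖ ^ m + ‖Gk z.2‖ ^ m)) := by
        rw [abs_mul, abs_of_nonneg (regSignDeriv_nonneg _)]
        exact mul_le_mul (regSignDeriv_le hε _) (abs_rpow_mul_inner_sub_le hm _ _) (abs_nonneg _)
          (by positivity)
      have e5 : |g z.1 z.2 * regSign ε (v z.1 z.2 - k z.2)| ≤ Cg := by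
        rw [abs_mul, ← mul_one Cg]
        exact mul_le_mul (hCg _ _) (abs_regSign_le hε _) (abs_nonneg _) hCg0
      have e6 := mul_le_mul_of_nonneg_left (abs_le.1 e4).1 (hζ0 z.1)
      have e7 := mul_le_mul_of_nonneg_left (abs_le.1 e5).2 (hζ0 z.1)
      unfold katoIntegrand
      linarith
    refine le_trans (sub_le_sub_left ?_ _) hK
    by_cases hzδ : z.1 < δ
    · rw [indicator_of_mem (s := {z : ℝ × Space N | z.1 < δ}) hzδ]
      exact mul_le_of_le_one_left (by positivity) (hζ1 _ hz.1.2.le)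
    · rw [hζδ _ (not_lt.1 hzδ), zero_mul]
      exact indicator_nonneg (fun z _ => by positivity) z
  have i12 : Integrable (fun z : ℝ × Space N => ρ z.1 * |α (v z.1 z.2) - α (k z.2)| -
      ρ z.1 * (|α (v₀ z.2) - α (k z.2)| + 4 * L * ε)) (cylinder Ω M) := i1.sub i2
  rw [integral_sub i12 i3, integral_sub i1 i2, integral_mollifier_mul hρ hδ
    (fun x => |α (v₀ x) - α (k x)| + 4 * L * ε), integral_add ?_ (integrable_const _),
    integral_const, smul_eq_mul] at hle
  · linarith
  · refine Integrable.of_bound (Measurable.aestronglyMeasurable (continuous_abs.measurable.comp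
      ((hαm.comp hsol.measurable_init).sub (hαm.comp hk)))) (L * (C₀ + Ck)) (ae_of_all _ fun x => ?_)
    rw [Real.norm_eq_abs, abs_abs]
    exact hb (hC₀ _) (hCk _)

/-- The initial datum is attained in `L^1`. -/
lemma exists_integral_mollifier_le (hΩ : IsOpen Ω) [IsFiniteMeasure (volume.restrict Ω)]
    (hM : 0 < M) (hm : 2 ≤ m) {L : ℝ≥0}
    (hL : LipschitzWith L α) (hα : Monotone α) (hsol : RegularSolution Ω M m α v₀ v G g)
    {η : ℝ} (hη : 0 < η) : ∃ δ₀ > 0, ∀ δ ρ ρ', IsTimeMollifier δ ρ ρ' → δ ≤ δ₀ →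
      ∫ z, ρ z.1 * |α (v z.1 z.2) - α (v₀ z.2)| ∂(cylinder Ω M) ≤ η := by
  obtain ⟨Cv, hCv⟩ := hsol.bound
  obtain ⟨C₀, hC₀⟩ := hsol.bound_init
  set A := (volume.restrict Ω).real univ
  have hA : 0 ≤ A := measureReal_nonneg
  have hL0 : (0 : ℝ) ≤ L := L.coe_nonneg
  have hv₀ : MemLp v₀ 2 (volume.restrict Ω) :=
    MemLp.of_bound hsol.measurable_init.aestronglyMeasurable C₀ (ae_of_all _ hC₀)
  obtain ⟨φ, hφ, hφη⟩ := exists_testFunction_integral_sub_lt hΩ hv₀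
    (show 0 < η / (8 * (L + 1)) by positivity)
  -- The budget is η/8 twice for replacing v₀ by φ, η/4 for the entropy error 4LεA, and η/2 for the
  -- layer term. Since W depends on φ and ε, these are fixed before δ₀ is chosen.
  set ε : ℝ := η / (16 * (L + 1) * (A + 1)) with hε_def
  have hε : 0 < ε := by positivity
  obtain ⟨Ck, hCk⟩ := hφ.1.continuous.bounded_above_of_compact_support hφ.2.1
  have hφm := hφ.1.continuous.measurable
  obtain ⟨W, iW, hW0, hW⟩ := integral_mollifier_sub_le hm hL hα hsol hφm ⟨Ck, hCk⟩
    hφ.continuous_gradient.measurable hφ.memW0 hε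
  have hlim : Tendsto (fun δ => ∫ z, {z : ℝ × Space N | z.1 < δ}.indicator W z ∂(cylinder Ω M))
      (𝓝[>] 0) (𝓝 (∫ _, (0 : ℝ) ∂(cylinder Ω M))) := by
    refine tendsto_integral_filter_of_dominated_convergence W
      (Eventually.of_forall fun δ => (iW.indicator
        (measurableSet_lt measurable_fst measurable_const)).aestronglyMeasurable)
      (Eventually.of_forall fun δ => ae_of_all _ fun z => ?_) iW ?_
    · rw [Real.norm_of_nonneg (indicator_nonneg (fun z _ => hW0 z) z)]
      exact indicator_le_self' (fun z _ => hW0 z) z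
    · rw [cylinder_eq_restrict]
      filter_upwards [ae_restrict_mem measurableSet_timeStrip] with z hz
      refine tendsto_const_nhds.congr' ?_
      filter_upwards [Ioo_mem_nhdsGT hz.1.1] with δ hδ
      rw [indicator_of_notMem]
      exact not_lt.2 hδ.2.le
  rw [integral_zero] at hlim
  obtain ⟨δ₀, hδ₀, hδ₀W⟩ : ∃ δ₀ > 0, δ₀ ≤ M ∧
      ∫ z, {z : ℝ × Space N | z.1 < δ₀}.indicator W z ∂(cylinder Ω M) ≤ η / 2 := by
    obtain ⟨δ, h1, h2⟩ := ((hlim.eventually_le_const (by positivity : 0 < η / 2)).and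
      (Ioo_mem_nhdsGT hM)).exists
    exact ⟨δ, h2.1, h2.2.le, h1⟩
  refine ⟨δ₀, hδ₀, fun δ ρ ρ' hρ hδ => ?_⟩
  have hδM := hδ.trans hδ₀W.1
  have hαm := hL.continuous.measurable
  have hρm := hρ.continuous.measurable
  obtain ⟨Cρ, -, hCρ⟩ := exists_bound_on_Icc hρ.continuous 0 M
  have hLip : ∀ a b, |α a - α b| ≤ L * |a - b| := fun a b => by
    simpa [Real.dist_eq] using hL.dist_le_mul a b
  have hb : ∀ {a b A B : ℝ}, |a| ≤ A → |b| ≤ B → |α a - α b| ≤ L * (A + B) := by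
    intro a b A B ha hb
    refine (hLip a b).trans ?_
    gcongr
    exact (abs_sub _ _).trans (add_le_add ha hb)
  have hCρ' : ∀ z : ℝ × Space N, z.1 ∈ Ioo 0 M → |ρ z.1| ≤ Cρ :=
    fun z hz => hCρ _ (Ioo_subset_Icc_self hz)
  have i1 : Integrable (fun z : ℝ × Space N => ρ z.1 * |α (v z.1 z.2) - α (φ z.2)|)
      (cylinder Ω M) := by
    refine integrable_cylinder_of_bound ((hρm.comp measurable_fst).mul
      (continuous_abs.measurable.comp ((hαm.comp hsol.measurable).sub
        (hαm.comp (hφm.comp measurable_snd))))) (C := Cρ * (L * (Cv + Ck))) fun z hz => ?_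
    rw [abs_mul, abs_abs]
    exact mul_le_mul (hCρ' z hz) (hb (hCv _ _) (hCk _)) (abs_nonneg _)
      ((abs_nonneg _).trans (hCρ' z hz))
  have i2 : Integrable (fun z : ℝ × Space N => ρ z.1 * |α (v₀ z.2) - α (φ z.2)|)
      (cylinder Ω M) := by
    refine integrable_cylinder_of_bound ((hρm.comp measurable_fst).mul
      (continuous_abs.measurable.comp ((hαm.comp (hsol.measurable_init.comp measurable_snd)).sub
        (hαm.comp (hφm.comp measurable_snd))))) (C := Cρ * (L * (C₀ + Ck))) fun z hz => ?_
    rw [abs_mul, abs_abs]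
    exact mul_le_mul (hCρ' z hz) (hb (hC₀ _) (hCk _)) (abs_nonneg _)
      ((abs_nonneg _).trans (hCρ' z hz))
  have hint : IntegrableOn (fun x => |v₀ x - φ x|) Ω :=
    ((hv₀.sub (hφ.memLp 2)).integrable (by norm_num)).abs
  have h1 : ∫ x in Ω, |α (v₀ x) - α (φ x)| ≤ L * (η / (8 * (L + 1))) := by
    refine le_trans (integral_mono_of_nonneg (ae_of_all _ fun x => abs_nonneg _) (hint.const_mul L)
      (ae_of_all _ fun x => hLip _ _)) ?_
    rw [integral_const_mul]
    exact mul_le_mul_of_nonneg_left hφη.le hL0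
  have h2 : (L : ℝ) * (η / (8 * (L + 1))) ≤ η / 8 := by
    rw [← mul_div_assoc, div_le_div_iff₀ (by positivity) (by positivity)]
    nlinarith
  have h3 : 4 * L * ε * A ≤ η / 4 := by
    rw [hε_def, ← mul_div_assoc, div_mul_eq_mul_div, div_le_div_iff₀ (by positivity) (by positivity)]
    have : (L : ℝ) * A ≤ (L + 1) * (A + 1) := by nlinarith
    nlinarith
  have h4 : ∫ z, {z : ℝ × Space N | z.1 < δ}.indicator W z ∂(cylinder Ω M) ≤ η / 2 := by
    refine le_trans (integral_mono
      (iW.indicator (measurableSet_lt measurable_fst measurable_const))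
      (iW.indicator (measurableSet_lt measurable_fst measurable_const)) fun z => ?_) hδ₀W.2
    have hsub : {z : ℝ × Space N | z.1 < δ} ⊆ {z : ℝ × Space N | z.1 < δ₀} :=
      fun z hz => lt_of_lt_of_le (b := δ) hz hδ
    exact indicator_le_indicator_of_subset hsub (f := W) hW0 z
  calc ∫ z, ρ z.1 * |α (v z.1 z.2) - α (v₀ z.2)| ∂(cylinder Ω M)
      ≤ ∫ z, (ρ z.1 * |α (v z.1 z.2) - α (φ z.2)| + ρ z.1 * |α (v₀ z.2) - α (φ z.2)|)
          ∂(cylinder Ω M) := by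
        refine integral_mono_of_nonneg (ae_of_all _ fun z => mul_nonneg (hρ.nonneg _) (abs_nonneg _))
          (i1.add i2) (ae_of_all _ fun z => ?_)
        beta_reduce
        rw [← mul_add]
        refine mul_le_mul_of_nonneg_left ?_ (hρ.nonneg _)
        rw [abs_sub_comm (α (v₀ z.2))]
        exact abs_sub_le _ _ _
    _ = ∫ z, ρ z.1 * |α (v z.1 z.2) - α (φ z.2)| ∂(cylinder Ω M) +
          ∫ x in Ω, |α (v₀ x) - α (φ x)| := by
        rw [integral_add i1 i2, integral_mollifier_mul hρ hδM (fun x => |α (v₀ x) - α (φ x)|)]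
    _ ≤ η := by
        have := hW δ ρ ρ' hρ hδM
        linarith

end InitialTrace

/-! ### Integrals over the doubled cylinder. -/

section DoubleIntegrals

variable {N : ℕ} {Ω : Set (Space N)} {M : ℝ}

lemma integrable_double_of_bound [IsFiniteMeasure (volume.restrict Ω)]
    {F : ℝ × (ℝ × Space N) → ℝ} (hF : Measurable F) {C : ℝ}
    (hC : ∀ q : ℝ × (ℝ × Space N), q.1 ∈ Ioo 0 M → q.2.1 ∈ Ioo 0 M → |F q| ≤ C) :
    Integrable F (doubleCylinder Ω M) := by
  refine Integrable.of_bound hF.aestronglyMeasurable C ?_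
  filter_upwards [ae_doubleCylinder_mem] with q hq using hC q hq.1 hq.2

lemma integral_double_mul_right [IsFiniteMeasure (volume.restrict Ω)] {h : ℝ × Space N → ℝ}
    {k : ℝ → ℝ → ℝ} (hi : Integrable (fun q : ℝ × (ℝ × Space N) => h q.2 * k q.1 q.2.1)
      (doubleCylinder Ω M)) :
    ∫ q, h q.2 * k q.1 q.2.1 ∂(doubleCylinder Ω M) =
      ∫ z, h z * (∫ s in Ioo 0 M, k s z.1) ∂(cylinder Ω M) := by
  rw [doubleCylinder, integral_prod_symm _ hi]
  simp_rw [integral_const_mul]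

lemma integral_double_mul_left [IsFiniteMeasure (volume.restrict Ω)] {h : ℝ × Space N → ℝ}
    {k : ℝ → ℝ → ℝ} (hi : Integrable (fun q : ℝ × (ℝ × Space N) => h (q.1, q.2.2) * k q.2.1 q.1)
      (doubleCylinder Ω M)) :
    ∫ q, h (q.1, q.2.2) * k q.2.1 q.1 ∂(doubleCylinder Ω M) =
      ∫ z, h z * (∫ s in Ioo 0 M, k s z.1) ∂(cylinder Ω M) := by
  have h1 := (measurePreserving_swapTimes (Ω := Ω) (M := M)).integral_comp'
    (fun q => h (q.1, q.2.2) * k q.2.1 q.1)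
  rw [← h1]
  exact integral_double_mul_right
    ((measurePreserving_swapTimes (Ω := Ω) (M := M)).integrable_comp_of_integrable hi)

lemma integral_double_nonpos_of_slice [IsFiniteMeasure (volume.restrict Ω)]
    {F : ℝ × (ℝ × Space N) → ℝ} (hi : Integrable F (doubleCylinder Ω M))
    (hF : ∀ τ ∈ Ioo 0 M, ∀ t ∈ Ioo 0 M, ∫ x in Ω, F (τ, (t, x)) ≤ 0) :
    ∫ q, F q ∂(doubleCylinder Ω M) ≤ 0 := by
  rw [doubleCylinder] at hi ⊢
  rw [integral_prod _ hi]
  refine integral_nonpos_of_ae ?_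
  filter_upwards [hi.prod_right_ae, ae_restrict_mem measurableSet_Ioo] with τ h1 hτ
  rw [cylinder] at h1 ⊢
  rw [integral_prod _ h1]
  refine integral_nonpos_of_ae ?_
  filter_upwards [ae_restrict_mem measurableSet_Ioo] with t ht using hF τ hτ t ht

lemma IsTimeMollifier.integral_Ioo_sub {δ : ℝ} {ρ ρ' : ℝ → ℝ} (h : IsTimeMollifier δ ρ ρ') {τ : ℝ}
    (hτ : 0 ≤ τ) (hM : τ + δ ≤ M) : ∫ t in Ioo 0 M, ρ (t - τ) = 1 := by
  rw [setIntegral_eq_integral_of_forall_compl_eq_zero, integral_sub_right_eq_self (fun t => ρ t) τ,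
    h.integral_eq_one]
  intro t ht
  rw [mem_Ioo, not_and_or, not_lt, not_lt] at ht
  rcases ht with ht | ht
  · exact h.eq_zero_of_nonpos _ (by linarith)
  · exact h.eq_zero_of_le _ (by linarith)

lemma setIntegral_Ioo_deriv (hM : 0 < M) {F F' : ℝ → ℝ} (hF : ∀ t, HasDerivAt F (F' t) t)
    (hc : Continuous F') : ∫ t in Ioo 0 M, F' t = F M - F 0 := by
  rw [← integral_Ioc_eq_integral_Ioo, ← intervalIntegral.integral_of_le hM.le]
  exact intervalIntegral.integral_eq_sub_of_hasDerivAt (fun x _ => hF x)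
    (hc.intervalIntegrable _ _)

/-- Time translations of a bounded function are continuous in the mean. -/
lemma exists_integral_double_sub_le [IsFiniteMeasure (volume.restrict Ω)] {h : ℝ × Space N → ℝ}
    (hh : Measurable h) (hb : ∃ C, ∀ z, |h z| ≤ C) {η : ℝ} (hη : 0 < η) :
    ∃ δ₀ > 0, ∀ δ ρ ρ', IsTimeMollifier δ ρ ρ' → δ ≤ δ₀ →
      ∫ q : ℝ × (ℝ × Space N), |h q.2 - h (q.1, q.2.2)| * ρ (q.2.1 - q.1)
        ∂(doubleCylinder Ω M) ≤ η := by
  obtain ⟨C, hC⟩ := hb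
  set f : ℝ × Space N → ℝ := (Ioo 0 M ×ˢ univ).indicator h with hf
  have hfm : Measurable f := hh.indicator measurableSet_timeStrip
  have hfL : MemLp f 1 (volume.prod (volume.restrict Ω)) := by
    rw [hf, memLp_indicator_iff_restrict measurableSet_timeStrip, ← cylinder_eq_restrict]
    exact MemLp.of_bound hh.aestronglyMeasurable C (ae_of_all _ hC)
  have hlim := tendsto_eLpNorm_timeShift_sub le_rfl ENNReal.one_ne_top hfL
  obtain ⟨δ₀, hδ₀, hδ⟩ := Metric.eventually_nhds_iff.1
    (hlim.eventually_le_const (ENNReal.ofReal_pos.2 hη))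
  refine ⟨δ₀, hδ₀, fun δ ρ ρ' hρ hδδ => ?_⟩
  have hρm := hρ.continuous.measurable
  have m1 : Measurable fun q : ℝ × (ℝ × Space N) =>
      |h q.2 - h (q.1, q.2.2)| * ρ (q.2.1 - q.1) :=
    (continuous_abs.measurable.comp ((hh.comp measurable_snd).sub
      (hh.comp (measurable_fst.prodMk (measurable_snd.comp measurable_snd))))).mul
      (hρm.comp ((measurable_fst.comp measurable_snd).sub measurable_fst))
  have m2 : Measurable fun q : ℝ × (ℝ × Space N) =>
      ‖f q.2 - f (q.1, q.2.2)‖ₑ * ENNReal.ofReal (ρ (q.2.1 - q.1)) :=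
    ((hfm.comp measurable_snd).sub
      (hfm.comp (measurable_fst.prodMk (measurable_snd.comp measurable_snd)))).enorm.mul
      (hρm.comp ((measurable_fst.comp measurable_snd).sub measurable_fst)).ennreal_ofReal
  have m3 : Measurable fun q : (ℝ × Space N) × ℝ =>
      ‖f q.1 - f (q.1.1 - q.2, q.1.2)‖ₑ * ENNReal.ofReal (ρ q.2) :=
    ((hfm.comp measurable_fst).sub
      (hfm.comp (((measurable_fst.comp measurable_fst).sub measurable_snd).prodMk
        (measurable_snd.comp measurable_fst)))).enorm.mul
      (hρm.comp measurable_snd).ennreal_ofReal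
  rw [integral_eq_lintegral_of_nonneg_ae (ae_of_all _ fun q => mul_nonneg (abs_nonneg _)
    (hρ.nonneg _)) m1.aestronglyMeasurable]
  refine ENNReal.toReal_le_of_le_ofReal hη.le ?_
  -- Cutting h off to f allows both times to range over ℝ. The substitution r = t - τ and Tonelli
  -- then give the ρ-average over r of the L¹ distance between f and its translate by -r, which is
  -- at most η for 0 < r < δ ≤ δ₀.
  calc ∫⁻ q : ℝ × (ℝ × Space N), ENNReal.ofReal (|h q.2 - h (q.1, q.2.2)| * ρ (q.2.1 - q.1))
        ∂(doubleCylinder Ω M)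
      = ∫⁻ q : ℝ × (ℝ × Space N), ‖f q.2 - f (q.1, q.2.2)‖ₑ * ENNReal.ofReal (ρ (q.2.1 - q.1))
        ∂(doubleCylinder Ω M) := by
        refine lintegral_congr_ae ?_
        filter_upwards [ae_doubleCylinder_mem] with q hq
        rw [hf, indicator_of_mem (show q.2 ∈ Ioo 0 M ×ˢ univ from ⟨hq.2, trivial⟩),
          indicator_of_mem (show (q.1, q.2.2) ∈ Ioo 0 M ×ˢ univ from ⟨hq.1, trivial⟩),
          ENNReal.ofReal_mul (abs_nonneg _), ← Real.norm_eq_abs, ofReal_norm]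
    _ ≤ ∫⁻ q : ℝ × (ℝ × Space N), ‖f q.2 - f (q.1, q.2.2)‖ₑ * ENNReal.ofReal (ρ (q.2.1 - q.1))
        ∂((volume : Measure ℝ).prod ((volume : Measure ℝ).prod (volume.restrict Ω))) :=
        lintegral_mono' (Measure.prod_mono Measure.restrict_le_self
          (Measure.prod_mono Measure.restrict_le_self le_rfl)) le_rfl
    _ = ∫⁻ z : ℝ × Space N, (∫⁻ r : ℝ, ‖f z - f (z.1 - r, z.2)‖ₑ * ENNReal.ofReal (ρ r))
        ∂((volume : Measure ℝ).prod (volume.restrict Ω)) := by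
        rw [lintegral_prod_symm _ m2.aemeasurable]
        refine lintegral_congr fun z => ?_
        rw [← lintegral_sub_left_eq_self _ z.1]
        simp only [sub_sub_cancel]
    _ = ∫⁻ r : ℝ, (∫⁻ z : ℝ × Space N, ‖f z - f (z.1 - r, z.2)‖ₑ
        ∂((volume : Measure ℝ).prod (volume.restrict Ω))) * ENNReal.ofReal (ρ r) := by
        rw [lintegral_lintegral_swap m3.aemeasurable]
        refine lintegral_congr fun r => ?_
        rw [lintegral_mul_const']
        exact ENNReal.ofReal_ne_top
    _ ≤ ∫⁻ r : ℝ, ENNReal.ofReal η * ENNReal.ofReal (ρ r) := by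
        refine lintegral_mono fun r => ?_
        by_cases hr : ρ r = 0
        · simp [hr]
        · have h0 : 0 < r := not_le.1 fun h => hr (hρ.eq_zero_of_nonpos r h)
          have h1 : r < δ := not_le.1 fun h => hr (hρ.eq_zero_of_le r h)
          gcongr
          have h2 := hδ (y := -r) (by
            rw [Real.dist_eq, sub_zero, abs_neg, abs_of_pos h0]; exact h1.trans_le hδδ)
          rw [eLpNorm_one_eq_lintegral_enorm] at h2
          refine le_trans (lintegral_mono fun z => ?_) h2
          rw [← sub_eq_add_neg, ← enorm_neg, neg_sub]
    _ = ENNReal.ofReal η := by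
        rw [lintegral_const_mul' _ _ ENNReal.ofReal_ne_top,
          ← ofReal_integral_eq_lintegral_ofReal hρ.integrable (ae_of_all _ hρ.nonneg),
          hρ.integral_eq_one, ENNReal.ofReal_one, mul_one]

end DoubleIntegrals

/-! ### From doubled to single time: the L¹ contraction. -/

section Contraction

variable {N : ℕ} {Ω : Set (Space N)} {M m K : ℝ} {α : ℝ → ℝ} {v₀ u₀ : Space N → ℝ}
  {v u : ℝ → Space N → ℝ} {Gv Gu : ℝ → Space N → Space N} {gv gu : ℝ → Space N → ℝ}

/-- The test function is ζ(t, τ) = ψ(τ) ρ(t - τ). In ∂_t ζ + ∂_τ ζ the derivative of ρ cancels and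
ψ'ρ = -(Kψ + χ)ρ remains; its part with K absorbs the source. The term with v₀ vanishes on
integrating ∂_t ζ over (0, M), since ρ(-τ) = 0 and ζ(M, τ) = 0. In the term with u₀ the integral of
∂_τ ζ is -ψ(0) ρ(t). -/
lemma integral_double_mollifier_le [IsFiniteMeasure (volume.restrict Ω)] (hM : 0 < M) (hm : 2 ≤ m)
    {L : ℝ≥0} (hL : LipschitzWith L α) (hα : Monotone α)
    (hv : RegularSolution Ω M m α v₀ v Gv gv) (hu : RegularSolution Ω M m α u₀ u Gu gu)
    (hsrc : ∀ t τ, ∫ x in Ω, |gv t x - gu τ x| ≤ K * ∫ x in Ω, |α (v t x) - α (u τ x)|)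
    {δ M' : ℝ} {ρ ρ' ψ χ : ℝ → ℝ} (hρ : IsTimeMollifier δ ρ ρ') (hδ : 0 < δ) (hM' : M' + δ ≤ M)
    (hψ : ∀ τ, HasDerivAt ψ (-(K * ψ τ) - χ τ) τ) (hχ : Continuous χ) (hψ0 : ∀ τ, 0 ≤ ψ τ)
    (hψM : ∀ τ, M' ≤ τ → ψ τ = 0) :
    ∫ q : ℝ × (ℝ × Space N), |α (v q.2.1 q.2.2) - α (u q.1 q.2.2)| * (χ q.1 * ρ (q.2.1 - q.1))
      ∂(doubleCylinder Ω M) ≤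
      ψ 0 * ∫ z, ρ z.1 * |α (v z.1 z.2) - α (u₀ z.2)| ∂(cylinder Ω M) := by
  obtain ⟨Cv, hCv⟩ := hv.bound
  obtain ⟨Cu, hCu⟩ := hu.bound
  obtain ⟨Cv₀, hCv₀⟩ := hv.bound_init
  obtain ⟨Cu₀, hCu₀⟩ := hu.bound_init
  obtain ⟨Dv, hDv⟩ := hv.bound_source
  obtain ⟨Du, hDu⟩ := hu.bound_source
  have hψc : Continuous ψ := continuous_iff_continuousAt.2 fun t => (hψ t).continuousAt
  have hρc := hρ.continuous
  have hρ'c := hρ.continuous_deriv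
  set ζ : ℝ → ℝ → ℝ := fun t τ => ψ τ * ρ (t - τ) with hζ_def
  set ζ₁ : ℝ → ℝ → ℝ := fun t τ => ψ τ * ρ' (t - τ) with hζ₁_def
  set ζ₂ : ℝ → ℝ → ℝ := fun t τ => (-(K * ψ τ) - χ τ) * ρ (t - τ) - ψ τ * ρ' (t - τ) with hζ₂_def
  have hζ₁ : ∀ t τ, HasDerivAt (fun t => ζ t τ) (ζ₁ t τ) t := fun t τ => by
    have h1 : HasDerivAt (fun t => ρ (t - τ)) (ρ' (t - τ)) t := by
      simpa using (hρ.hasDerivAt (t - τ)).comp_sub_const t τ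
    exact h1.const_mul _
  have hζ₂ : ∀ t τ, HasDerivAt (fun τ => ζ t τ) (ζ₂ t τ) τ := fun t τ => by
    have h1 : HasDerivAt (fun τ => ρ (t - τ)) (-ρ' (t - τ)) τ := by
      simpa using (hρ.hasDerivAt (t - τ)).comp_const_sub t τ
    refine ((hψ τ).mul h1).congr_deriv ?_
    rw [hζ₂_def]; ring
  have hζc : Continuous (Function.uncurry ζ) := by
    rw [hζ_def]; unfold Function.uncurry; fun_prop
  have hζ₁c : Continuous (Function.uncurry ζ₁) := by
    rw [hζ₁_def]; unfold Function.uncurry; fun_prop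
  have hζ₂c : Continuous (Function.uncurry ζ₂) := by
    rw [hζ₂_def]; unfold Function.uncurry; fun_prop
  have hζ0 : ∀ t τ, 0 ≤ ζ t τ := fun t τ => mul_nonneg (hψ0 _) (hρ.nonneg _)
  have hζM : ∀ t τ, M ≤ t → ζ t τ = 0 := fun t τ ht => by
    rcases le_or_gt M' τ with h | h
    · simp only [hζ_def, hψM _ h, zero_mul]
    · simp only [hζ_def, hρ.eq_zero_of_le (t - τ) (by linarith), mul_zero]
  have hζM' : ∀ t τ, M ≤ τ → ζ t τ = 0 := fun t τ ht => by
    simp only [hζ_def, hψM τ (by linarith), zero_mul]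
  have key := integral_double_nonpos hm hL hα hv hu hζ₁ hζ₂ hζc hζ₁c hζ₂c hζ0 hζM hζM'
  have hαm := hL.continuous.measurable
  have hLip : ∀ a b, |α a - α b| ≤ L * |a - b| := fun a b => by
    simpa [Real.dist_eq] using hL.dist_le_mul a b
  have hb : ∀ {a b A B : ℝ}, |a| ≤ A → |b| ≤ B → |α a - α b| ≤ L * (A + B) := by
    intro a b A B ha hb
    refine (hLip a b).trans ?_
    gcongr
    exact (abs_sub _ _).trans (add_le_add ha hb)
  have habs : Measurable fun x : ℝ => |x| := continuous_abs.measurable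
  have mvt : Measurable fun q : ℝ × (ℝ × Space N) => v q.2.1 q.2.2 := hv.measurable.comp measurable_snd
  have muτ : Measurable fun q : ℝ × (ℝ × Space N) => u q.1 q.2.2 :=
    hu.measurable.comp (measurable_fst.prodMk (measurable_snd.comp measurable_snd))
  have mgv : Measurable fun q : ℝ × (ℝ × Space N) => gv q.2.1 q.2.2 :=
    hv.measurable_source.comp measurable_snd
  have mgu : Measurable fun q : ℝ × (ℝ × Space N) => gu q.1 q.2.2 :=
    hu.measurable_source.comp (measurable_fst.prodMk (measurable_snd.comp measurable_snd))
  have mx : Measurable fun q : ℝ × (ℝ × Space N) => q.2.2 := measurable_snd.comp measurable_snd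
  have mt : Measurable fun q : ℝ × (ℝ × Space N) => (q.2.1, q.1) :=
    (measurable_fst.comp measurable_snd).prodMk measurable_fst
  have bounded : ∀ {F : ℝ × (ℝ × Space N) → ℝ} {k : ℝ → ℝ → ℝ} {C : ℝ}, Measurable F →
      (∀ q, |F q| ≤ C) → Continuous (Function.uncurry k) →
      Integrable (fun q : ℝ × (ℝ × Space N) => F q * k q.2.1 q.1) (doubleCylinder Ω M) := by
    intro F k C hF hC hk
    obtain ⟨D, -, hD⟩ := exists_bound_on_square hk M
    refine integrable_double_of_bound (hF.mul (hk.measurable.comp mt)) (C := C * D)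
      fun q h1 h2 => ?_
    rw [abs_mul]
    exact mul_le_mul (hC q) (hD _ h2 _ h1) (abs_nonneg _) ((abs_nonneg _).trans (hC q))
  have ma : Measurable fun q : ℝ × (ℝ × Space N) => |α (v q.2.1 q.2.2) - α (u q.1 q.2.2)| :=
    habs.comp ((hαm.comp mvt).sub (hαm.comp muτ))
  have ha : ∀ q : ℝ × (ℝ × Space N), |(|α (v q.2.1 q.2.2) - α (u q.1 q.2.2)|)| ≤ L * (Cv + Cu) :=
    fun q => by rw [abs_abs]; exact hb (hCv _ _) (hCu _ _)
  have hχρ : Continuous (Function.uncurry fun t τ => χ τ * ρ (t - τ)) := by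
    unfold Function.uncurry; fun_prop
  have ia := bounded ma ha hχρ
  have iaζ := bounded ma ha hζc
  have ib : Integrable (fun q : ℝ × (ℝ × Space N) =>
      |α (v₀ q.2.2) - α (u q.1 q.2.2)| * ζ₁ q.2.1 q.1) (doubleCylinder Ω M) :=
    bounded (habs.comp ((hαm.comp (hv.measurable_init.comp mx)).sub (hαm.comp muτ)))
      (fun q => by rw [abs_abs]; exact hb (hCv₀ _) (hCu _ _)) hζ₁c
  have ic : Integrable (fun q : ℝ × (ℝ × Space N) =>
      |α (v q.2.1 q.2.2) - α (u₀ q.2.2)| * ζ₂ q.2.1 q.1) (doubleCylinder Ω M) :=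
    bounded (habs.comp ((hαm.comp mvt).sub (hαm.comp (hu.measurable_init.comp mx))))
      (fun q => by rw [abs_abs]; exact hb (hCv _ _) (hCu₀ _)) hζ₂c
  have id' : Integrable (fun q : ℝ × (ℝ × Space N) =>
      |gv q.2.1 q.2.2 - gu q.1 q.2.2| * ζ q.2.1 q.1) (doubleCylinder Ω M) :=
    bounded (habs.comp (mgv.sub mgu)) (C := Dv + Du)
      (fun q => by rw [abs_abs]; exact (abs_sub _ _).trans (add_le_add (hDv _ _) (hDu _ _))) hζc
  have hb0 : ∫ q : ℝ × (ℝ × Space N), |α (v₀ q.2.2) - α (u q.1 q.2.2)| * ζ₁ q.2.1 q.1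
      ∂(doubleCylinder Ω M) = 0 := by
    rw [integral_double_mul_left (h := fun z => |α (v₀ z.2) - α (u z.1 z.2)|) ib]
    refine integral_eq_zero_of_ae ?_
    rw [cylinder_eq_restrict]
    filter_upwards [ae_restrict_mem measurableSet_timeStrip] with z hz
    rw [setIntegral_Ioo_deriv hM (fun t => hζ₁ t z.1) (by rw [hζ₁_def]; fun_prop),
      hζM _ _ le_rfl]
    simp only [hζ_def, hρ.eq_zero_of_nonpos (0 - z.1) (by linarith [hz.1.1]), mul_zero, sub_zero,
      Pi.zero_apply]
  have hc0 : ∫ q : ℝ × (ℝ × Space N), |α (v q.2.1 q.2.2) - α (u₀ q.2.2)| * ζ₂ q.2.1 q.1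
      ∂(doubleCylinder Ω M) =
      -(ψ 0 * ∫ z, ρ z.1 * |α (v z.1 z.2) - α (u₀ z.2)| ∂(cylinder Ω M)) := by
    rw [integral_double_mul_right (h := fun z => |α (v z.1 z.2) - α (u₀ z.2)|)
      (k := fun τ t => ζ₂ t τ) ic, ← integral_const_mul, ← integral_neg]
    refine integral_congr_ae (ae_of_all _ fun z => ?_)
    beta_reduce
    rw [setIntegral_Ioo_deriv hM (fun τ => hζ₂ z.1 τ) (by rw [hζ₂_def]; fun_prop),
      hζM' _ _ le_rfl]
    simp only [hζ_def, sub_zero]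
    ring
  have hd0 : ∫ q : ℝ × (ℝ × Space N), (|gv q.2.1 q.2.2 - gu q.1 q.2.2| * ζ q.2.1 q.1 -
      K * (|α (v q.2.1 q.2.2) - α (u q.1 q.2.2)| * ζ q.2.1 q.1)) ∂(doubleCylinder Ω M) ≤ 0 := by
    refine integral_double_nonpos_of_slice (id'.sub (iaζ.const_mul K)) fun τ _ t _ => ?_
    have e1 : ∀ x, |gv t x - gu τ x| * ζ t τ - K * (|α (v t x) - α (u τ x)| * ζ t τ) =
        (|gv t x - gu τ x| - K * |α (v t x) - α (u τ x)|) * ζ t τ := fun x => by ring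
    simp only [e1]
    rw [integral_mul_const]
    refine mul_nonpos_of_nonpos_of_nonneg ?_ (hζ0 _ _)
    have i1 : IntegrableOn (fun x => |gv t x - gu τ x|) Ω := by
      refine Integrable.of_bound (Measurable.aestronglyMeasurable (habs.comp
        ((hv.measurable_source.comp measurable_prodMk_left).sub
          (hu.measurable_source.comp measurable_prodMk_left)))) (Dv + Du) (ae_of_all _ fun x => ?_)
      rw [Real.norm_eq_abs, abs_abs]
      exact (abs_sub _ _).trans (add_le_add (hDv _ _) (hDu _ _))
    have i2 : IntegrableOn (fun x => |α (v t x) - α (u τ x)|) Ω := by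
      refine Integrable.of_bound (Measurable.aestronglyMeasurable (habs.comp
        ((hαm.comp (hv.measurable.comp measurable_prodMk_left)).sub
          (hαm.comp (hu.measurable.comp measurable_prodMk_left))))) (L * (Cv + Cu))
        (ae_of_all _ fun x => ?_)
      rw [Real.norm_eq_abs, abs_abs]
      exact hb (hCv _ _) (hCu _ _)
    rw [integral_sub i1 (i2.const_mul K), integral_const_mul]
    linarith [hsrc t τ]
  rw [integral_sub id' (iaζ.const_mul K), integral_const_mul] at hd0
  have e2 : ∀ q : ℝ × (ℝ × Space N),
      (-((|α (v q.2.1 q.2.2) - α (u q.1 q.2.2)| - |α (v₀ q.2.2) - α (u q.1 q.2.2)|) * ζ₁ q.2.1 q.1) -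
        (|α (v q.2.1 q.2.2) - α (u q.1 q.2.2)| - |α (v q.2.1 q.2.2) - α (u₀ q.2.2)|) * ζ₂ q.2.1 q.1 -
        |gv q.2.1 q.2.2 - gu q.1 q.2.2| * ζ q.2.1 q.1) =
      |α (v q.2.1 q.2.2) - α (u q.1 q.2.2)| * (χ q.1 * ρ (q.2.1 - q.1)) +
        K * (|α (v q.2.1 q.2.2) - α (u q.1 q.2.2)| * ζ q.2.1 q.1) +
        |α (v₀ q.2.2) - α (u q.1 q.2.2)| * ζ₁ q.2.1 q.1 +
        |α (v q.2.1 q.2.2) - α (u₀ q.2.2)| * ζ₂ q.2.1 q.1 -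
        |gv q.2.1 q.2.2 - gu q.1 q.2.2| * ζ q.2.1 q.1 := fun q => by
    simp only [hζ_def, hζ₁_def, hζ₂_def]; ring
  simp only [e2] at key
  have i2 : Integrable (fun q : ℝ × (ℝ × Space N) =>
      |α (v q.2.1 q.2.2) - α (u q.1 q.2.2)| * (χ q.1 * ρ (q.2.1 - q.1)) +
        K * (|α (v q.2.1 q.2.2) - α (u q.1 q.2.2)| * ζ q.2.1 q.1)) (doubleCylinder Ω M) :=
    ia.add (iaζ.const_mul K)
  have i3 : Integrable (fun q : ℝ × (ℝ × Space N) =>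
      |α (v q.2.1 q.2.2) - α (u q.1 q.2.2)| * (χ q.1 * ρ (q.2.1 - q.1)) +
        K * (|α (v q.2.1 q.2.2) - α (u q.1 q.2.2)| * ζ q.2.1 q.1) +
        |α (v₀ q.2.2) - α (u q.1 q.2.2)| * ζ₁ q.2.1 q.1) (doubleCylinder Ω M) := i2.add ib
  have i4 : Integrable (fun q : ℝ × (ℝ × Space N) =>
      |α (v q.2.1 q.2.2) - α (u q.1 q.2.2)| * (χ q.1 * ρ (q.2.1 - q.1)) +
        K * (|α (v q.2.1 q.2.2) - α (u q.1 q.2.2)| * ζ q.2.1 q.1) +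
        |α (v₀ q.2.2) - α (u q.1 q.2.2)| * ζ₁ q.2.1 q.1 +
        |α (v q.2.1 q.2.2) - α (u₀ q.2.2)| * ζ₂ q.2.1 q.1) (doubleCylinder Ω M) := i3.add ic
  rw [integral_sub i4 id', integral_add i3 ic, integral_add i2 ib,
    integral_add ia (iaζ.const_mul K), hb0, hc0, integral_const_mul] at key
  linarith

/-- The limit δ → 0 of the doubled estimate. On the left v(t) is replaced by v(τ), by continuity of
translations in L¹. On the right v(t) is replaced by v₀, by the initial trace. Each replacement
costs η/2. -/
lemma integral_mul_abs_sub_le [IsFiniteMeasure (volume.restrict Ω)] (hΩ : IsOpen Ω) (hM : 0 < M)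
    (hm : 2 ≤ m) {L : ℝ≥0} (hL : LipschitzWith L α) (hα : Monotone α)
    (hv : RegularSolution Ω M m α v₀ v Gv gv) (hu : RegularSolution Ω M m α u₀ u Gu gu)
    (hsrc : ∀ t τ, ∫ x in Ω, |gv t x - gu τ x| ≤ K * ∫ x in Ω, |α (v t x) - α (u τ x)|)
    {M' : ℝ} {ψ χ : ℝ → ℝ} (hM' : M' < M)
    (hψ : ∀ τ, HasDerivAt ψ (-(K * ψ τ) - χ τ) τ) (hχ : Continuous χ) (hχ0 : ∀ τ, 0 ≤ χ τ)
    (hχM : ∀ τ, M' ≤ τ → χ τ = 0) (hψ0 : ∀ τ, 0 ≤ ψ τ) (hψM : ∀ τ, M' ≤ τ → ψ τ = 0) :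
    ∫ z, |α (v z.1 z.2) - α (u z.1 z.2)| * χ z.1 ∂(cylinder Ω M) ≤
      ψ 0 * ∫ x in Ω, |α (v₀ x) - α (u₀ x)| := by
  obtain ⟨Cv, hCv⟩ := hv.bound
  obtain ⟨Cu, hCu⟩ := hu.bound
  obtain ⟨Cv₀, hCv₀⟩ := hv.bound_init
  obtain ⟨Cu₀, hCu₀⟩ := hu.bound_init
  obtain ⟨D, hD0, hD⟩ := exists_bound_on_Icc hχ 0 M
  have hαm := hL.continuous.measurable
  have hLip : ∀ a b, |α a - α b| ≤ L * |a - b| := fun a b => by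
    simpa [Real.dist_eq] using hL.dist_le_mul a b
  have hb : ∀ {a b A B : ℝ}, |a| ≤ A → |b| ≤ B → |α a - α b| ≤ L * (A + B) := by
    intro a b A B ha hb
    refine (hLip a b).trans ?_
    gcongr
    exact (abs_sub _ _).trans (add_le_add ha hb)
  have habs : Measurable fun x : ℝ => |x| := continuous_abs.measurable
  have hαb : ∃ C, ∀ z : ℝ × Space N, |α (v z.1 z.2)| ≤ C :=
    ⟨L * Cv + |α 0|, fun z => by
      have h1 : |α (v z.1 z.2) - α 0| ≤ L * (Cv + 0) := hb (hCv _ _) (by simp)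
      have h2 := abs_sub_abs_le_abs_sub (α (v z.1 z.2)) (α 0)
      linarith⟩
  refine le_of_forall_pos_le_add fun η hη => ?_
  obtain ⟨δ₁, hδ₁, H1⟩ := exists_integral_mollifier_le hΩ hM hm hL hα hv
    (show 0 < η / (2 * (ψ 0 + 1)) by have := hψ0 0; positivity)
  obtain ⟨δ₂, hδ₂, H2⟩ := exists_integral_double_sub_le (Ω := Ω) (M := M)
    (hαm.comp hv.measurable) hαb (show 0 < η / (2 * (D + 1)) by positivity)
  set δ := min (min δ₁ δ₂) (M - M') with hδ_def
  have hδ : 0 < δ := lt_min (lt_min hδ₁ hδ₂) (by linarith)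
  have hδM : M' + δ ≤ M := by have := min_le_right (min δ₁ δ₂) (M - M'); linarith
  obtain ⟨ρ, ρ', hρ⟩ := exists_isTimeMollifier hδ
  have h1 := H1 δ ρ ρ' hρ ((min_le_left _ _).trans (min_le_left _ _))
  have h2 := H2 δ ρ ρ' hρ ((min_le_left _ _).trans (min_le_right _ _))
  have h3 := integral_double_mollifier_le hM hm hL hα hv hu hsrc hρ hδ hδM hψ hχ hψ0 hψM
  have hρm := hρ.continuous.measurable
  obtain ⟨R, hR0, hR⟩ := exists_bound_on_Icc hρ.continuous 0 M
  have hRall : ∀ t, t ≤ M → ρ t ≤ R := fun t ht => by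
    rcases le_or_gt t 0 with h | h
    · rw [hρ.eq_zero_of_nonpos t h]; exact hR0
    · exact (le_abs_self _).trans (hR t ⟨h.le, ht⟩)
  have hRabs : ∀ t, t ≤ M → |ρ t| ≤ R := fun t ht => by
    rw [abs_of_nonneg (hρ.nonneg t)]; exact hRall t ht
  have mvt : Measurable fun q : ℝ × (ℝ × Space N) => α (v q.2.1 q.2.2) :=
    hαm.comp (hv.measurable.comp measurable_snd)
  have mvτ : Measurable fun q : ℝ × (ℝ × Space N) => α (v q.1 q.2.2) :=
    hαm.comp (hv.measurable.comp (measurable_fst.prodMk (measurable_snd.comp measurable_snd)))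
  have muτ : Measurable fun q : ℝ × (ℝ × Space N) => α (u q.1 q.2.2) :=
    hαm.comp (hu.measurable.comp (measurable_fst.prodMk (measurable_snd.comp measurable_snd)))
  have mχ : Measurable fun q : ℝ × (ℝ × Space N) => χ q.1 := hχ.measurable.comp measurable_fst
  have mρ : Measurable fun q : ℝ × (ℝ × Space N) => ρ (q.2.1 - q.1) :=
    hρm.comp ((measurable_fst.comp measurable_snd).sub measurable_fst)
  have bnd : ∀ {F : ℝ × (ℝ × Space N) → ℝ} {C : ℝ}, Measurable F → (∀ q, |F q| ≤ C) →
      Integrable (fun q => F q * (χ q.1 * ρ (q.2.1 - q.1))) (doubleCylinder Ω M) := by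
    intro F C hF hC
    refine integrable_double_of_bound (hF.mul (mχ.mul mρ)) (C := C * (D * R)) fun q h1 h2 => ?_
    rw [abs_mul, abs_mul]
    have h5 := hD q.1 (Ioo_subset_Icc_self h1)
    exact mul_le_mul (hC q) (mul_le_mul h5 (hRabs _ (by linarith [h1.1, h2.2]))
      (abs_nonneg _) hD0) (by positivity) ((abs_nonneg _).trans (hC q))
  have i1 := bnd (habs.comp (mvt.sub muτ)) (C := L * (Cv + Cu))
    (fun q => by rw [Function.comp_apply, abs_abs]; exact hb (hCv _ _) (hCu _ _))
  have i2 := bnd (habs.comp (mvτ.sub muτ)) (C := L * (Cv + Cu))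
    (fun q => by rw [Function.comp_apply, abs_abs]; exact hb (hCv _ _) (hCu _ _))
  have i3 := bnd (habs.comp (mvt.sub mvτ)) (C := L * (Cv + Cv))
    (fun q => by rw [Function.comp_apply, abs_abs]; exact hb (hCv _ _) (hCv _ _))
  have i4 : Integrable (fun q : ℝ × (ℝ × Space N) =>
      |α (v q.2.1 q.2.2) - α (v q.1 q.2.2)| * ρ (q.2.1 - q.1)) (doubleCylinder Ω M) := by
    refine integrable_double_of_bound ((habs.comp (mvt.sub mvτ)).mul mρ)
      (C := L * (Cv + Cv) * R) fun q h1 h2 => ?_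
    rw [abs_mul, abs_abs]
    exact mul_le_mul (hb (hCv _ _) (hCv _ _)) (hRabs _ (by linarith [h1.1, h2.2]))
      (abs_nonneg _) ((abs_nonneg _).trans (hb (hCv q.1 q.2.2) (hCv q.1 q.2.2)))
  have e1 : ∫ q : ℝ × (ℝ × Space N), |α (v q.1 q.2.2) - α (u q.1 q.2.2)| *
      (χ q.1 * ρ (q.2.1 - q.1)) ∂(doubleCylinder Ω M) =
      ∫ z, |α (v z.1 z.2) - α (u z.1 z.2)| * χ z.1 ∂(cylinder Ω M) := by
    rw [integral_double_mul_left (h := fun z => |α (v z.1 z.2) - α (u z.1 z.2)|)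
      (k := fun t τ => χ τ * ρ (t - τ)) i2]
    refine integral_congr_ae ?_
    rw [cylinder_eq_restrict]
    filter_upwards [ae_restrict_mem measurableSet_timeStrip] with z hz
    rw [integral_const_mul]
    rcases le_or_gt M' z.1 with h | h
    · rw [hχM _ h, zero_mul]
    · rw [hρ.integral_Ioo_sub hz.1.1.le (by linarith), mul_one]
  have e2 : ∫ q : ℝ × (ℝ × Space N), |α (v q.2.1 q.2.2) - α (v q.1 q.2.2)| *
      (χ q.1 * ρ (q.2.1 - q.1)) ∂(doubleCylinder Ω M) ≤ η / 2 := by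
    have e3 : ∫ q : ℝ × (ℝ × Space N), |α (v q.2.1 q.2.2) - α (v q.1 q.2.2)| *
        (χ q.1 * ρ (q.2.1 - q.1)) ∂(doubleCylinder Ω M) ≤ ∫ q : ℝ × (ℝ × Space N),
        D * (|α (v q.2.1 q.2.2) - α (v q.1 q.2.2)| * ρ (q.2.1 - q.1)) ∂(doubleCylinder Ω M) := by
      refine integral_mono_ae i3 (i4.const_mul D) ?_
      filter_upwards [ae_doubleCylinder_mem] with q hq
      have h5 := (le_abs_self _).trans (hD q.1 (Ioo_subset_Icc_self hq.1))
      have h6 := mul_le_mul_of_nonneg_right h5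
        (mul_nonneg (abs_nonneg (α (v q.2.1 q.2.2) - α (v q.1 q.2.2))) (hρ.nonneg (q.2.1 - q.1)))
      linarith
    rw [integral_const_mul] at e3
    refine e3.trans ((mul_le_mul_of_nonneg_left h2 hD0).trans ?_)
    rw [← mul_div_assoc, div_le_div_iff₀ (by positivity) (by positivity)]
    nlinarith
  have e4 : ∫ z, |α (v z.1 z.2) - α (u z.1 z.2)| * χ z.1 ∂(cylinder Ω M) ≤
      ∫ q : ℝ × (ℝ × Space N), |α (v q.2.1 q.2.2) - α (u q.1 q.2.2)| *
        (χ q.1 * ρ (q.2.1 - q.1)) ∂(doubleCylinder Ω M) + η / 2 := by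
    rw [← e1]
    refine le_trans ?_ (add_le_add_right e2 _)
    refine le_trans (integral_mono i2 (i1.add i3) fun q => ?_) (integral_add i1 i3).le
    simp only [Function.comp_apply, Pi.sub_apply, Pi.add_apply]
    rw [← add_mul]
    refine mul_le_mul_of_nonneg_right ?_ (mul_nonneg (hχ0 _) (hρ.nonneg _))
    rw [add_comm, abs_sub_comm (α (v q.2.1 q.2.2)) (α (v q.1 q.2.2))]
    exact abs_sub_le _ _ _
  have mz1 : Measurable fun z : ℝ × Space N => ρ z.1 := hρm.comp measurable_fst
  have mz2 : Measurable fun z : ℝ × Space N => α (v z.1 z.2) := hαm.comp hv.measurable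
  have mz3 : Measurable fun z : ℝ × Space N => α (v₀ z.2) :=
    hαm.comp (hv.measurable_init.comp measurable_snd)
  have mz4 : Measurable fun z : ℝ × Space N => α (u₀ z.2) :=
    hαm.comp (hu.measurable_init.comp measurable_snd)
  have bndz : ∀ {F : ℝ × Space N → ℝ} {C : ℝ}, Measurable F → (∀ z, |F z| ≤ C) →
      Integrable (fun z => ρ z.1 * F z) (cylinder Ω M) := by
    intro F C hF hC
    refine integrable_cylinder_of_bound (mz1.mul hF) (C := R * C) fun z hz => ?_
    rw [abs_mul]
    exact mul_le_mul (hRabs _ hz.2.le) (hC z) (abs_nonneg _) hR0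
  have j1 := bndz (habs.comp (mz2.sub mz4)) (C := L * (Cv + Cu₀))
    (fun q => by rw [Function.comp_apply, abs_abs]; exact hb (hCv _ _) (hCu₀ _))
  have j2 := bndz (habs.comp (mz2.sub mz3)) (C := L * (Cv + Cv₀))
    (fun q => by rw [Function.comp_apply, abs_abs]; exact hb (hCv _ _) (hCv₀ _))
  have j3 := bndz (habs.comp (mz3.sub mz4)) (C := L * (Cv₀ + Cu₀))
    (fun q => by rw [Function.comp_apply, abs_abs]; exact hb (hCv₀ _) (hCu₀ _))
  -- A negative M' permits δ > M, and then ρ need not have mass one on (0, M); but in that case ψ(0)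
  -- = 0.
  have hδM2 : δ ≤ M ∨ M' < 0 := by
    rcases le_or_gt 0 M' with h | h
    · exact Or.inl (by linarith)
    · exact Or.inr h
  have e5 : ∫ z, ρ z.1 * |α (v z.1 z.2) - α (u₀ z.2)| ∂(cylinder Ω M) ≤
      ∫ z, ρ z.1 * |α (v z.1 z.2) - α (v₀ z.2)| ∂(cylinder Ω M) +
        ∫ z, ρ z.1 * |α (v₀ z.2) - α (u₀ z.2)| ∂(cylinder Ω M) := by
    refine le_trans (integral_mono j1 (j2.add j3) fun z => ?_) (integral_add j2 j3).le
    simp only [Function.comp_apply, Pi.sub_apply, Pi.add_apply]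
    rw [← mul_add]
    exact mul_le_mul_of_nonneg_left (abs_sub_le _ _ _) (hρ.nonneg _)
  have e6 : ψ 0 * ∫ z, ρ z.1 * |α (v₀ z.2) - α (u₀ z.2)| ∂(cylinder Ω M) =
      ψ 0 * ∫ x in Ω, |α (v₀ x) - α (u₀ x)| := by
    rcases hδM2 with h | h
    · rw [integral_mollifier_mul hρ h (fun x => |α (v₀ x) - α (u₀ x)|)]
    · rw [hψM 0 h.le, zero_mul, zero_mul]
  have e7 : ψ 0 * (η / (2 * (ψ 0 + 1))) ≤ η / 2 := by
    have := hψ0 0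
    rw [← mul_div_assoc, div_le_div_iff₀ (by positivity) (by positivity)]
    nlinarith
  have e8 := mul_le_mul_of_nonneg_left e5 (hψ0 0)
  have e9 := mul_le_mul_of_nonneg_left h1 (hψ0 0)
  rw [mul_add, e6] at e8
  linarith

/-- Testing with normalised bumps centred at s gives averages of F around s, which converge to F(s)
at almost every s. The bumps are admissible once their radius is less than M - s. -/
lemma ae_nonneg_of_forall_continuous {F : ℝ → ℝ} (hF : Measurable F)
    (hFb : ∃ C, ∀ s ∈ Ioo 0 M, |F s| ≤ C)
    (h : ∀ (φ : ℝ → ℝ) (M' : ℝ), M' < M → Continuous φ → (∀ s, 0 ≤ φ s) →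
      (∀ s, M' ≤ s → φ s = 0) → 0 ≤ ∫ s in Ioo 0 M, φ s * F s) :
    ∀ᵐ s ∂(volume.restrict (Ioo 0 M)), 0 ≤ F s := by
  obtain ⟨C, hC⟩ := hFb
  set g : ℝ → ℝ := (Ioo 0 M).indicator F with hg
  have hgi : Integrable g := by
    rw [hg, integrable_indicator_iff measurableSet_Ioo]
    refine Integrable.of_bound hF.aestronglyMeasurable C ?_
    filter_upwards [ae_restrict_mem measurableSet_Ioo] with s hs using hC s hs
  let b : ℕ → ContDiffBump (0 : ℝ) := fun n =>
    ⟨1 / (n + 1), 2 * (1 / (n + 1)), by positivity, by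
      have : (0 : ℝ) < 1 / (n + 1) := by positivity
      linarith⟩
  have hb0 : Tendsto (fun n => (b n).rOut) atTop (𝓝 0) := by
    have h1 := (tendsto_one_div_add_atTop_nhds_zero_nat (𝕜 := ℝ)).const_mul 2
    rwa [mul_zero] at h1
  -- The constant 2 is the fixed ratio of outer to inner radius, which the differentiation theorem
  -- needs bounded.
  have hconv := ContDiffBump.ae_convolution_tendsto_right_of_locallyIntegrable (μ := volume)
    (K := 2) hb0 (Eventually.of_forall fun n => le_rfl) hgi.locallyIntegrable
  rw [ae_restrict_iff' measurableSet_Ioo]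
  filter_upwards [hconv] with s hs hsM
  rw [hg, indicator_of_mem hsM, ← hg] at hs
  refine ge_of_tendsto hs ?_
  have hev : ∀ᶠ n in atTop, (b n).rOut < M - s := hb0.eventually_lt_const (by linarith [hsM.2])
  filter_upwards [hev] with n hn
  rw [convolution_def]
  have hφ := h (fun t => (b n).normed volume (s - t)) (s + (b n).rOut) (by linarith)
    ((b n).continuous_normed.comp (continuous_const.sub continuous_id))
    (fun t => (b n).nonneg_normed _) (fun t ht => by
      have : s - t ∉ Function.support ((b n).normed volume) := by
        rw [(b n).support_normed_eq, Metric.mem_ball, Real.dist_eq, sub_zero, not_lt]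
        rw [abs_sub_comm]
        exact le_trans (by linarith) (le_abs_self _)
      simpa using this)
  refine hφ.trans_eq ?_
  rw [← integral_indicator measurableSet_Ioo, ← integral_sub_left_eq_self (μ := volume)
    (fun t => ContinuousLinearMap.lsmul ℝ ℝ ((b n).normed volume t) (g (s - t))) s]
  refine integral_congr_ae (ae_of_all _ fun t => ?_)
  simp only [sub_sub_cancel, ContinuousLinearMap.lsmul_apply, smul_eq_mul, hg]
  by_cases ht : t ∈ Ioo 0 M
  · rw [indicator_of_mem ht, indicator_of_mem ht]
  · rw [indicator_of_notMem ht, indicator_of_notMem ht, mul_zero]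

/-- The `L^1`-contraction estimate for solutions with source terms that are Lipschitz in
`α`-distance. -/
theorem RegularSolution.ae_integral_abs_sub_le [IsFiniteMeasure (volume.restrict Ω)]
    (hΩ : IsOpen Ω) (hM : 0 < M) (hm : 2 ≤ m) {L : ℝ≥0} (hL : LipschitzWith L α) (hα : Monotone α)
    (hv : RegularSolution Ω M m α v₀ v Gv gv) (hu : RegularSolution Ω M m α u₀ u Gu gu)
    (hsrc : ∀ t τ, ∫ x in Ω, |gv t x - gu τ x| ≤ K * ∫ x in Ω, |α (v t x) - α (u τ x)|) :
    ∀ᵐ s ∂(volume.restrict (Ioo 0 M)), ∫ x in Ω, |α (v s x) - α (u s x)| ≤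
      Real.exp (K * s) * ∫ x in Ω, |α (v₀ x) - α (u₀ x)| := by
  obtain ⟨Cv, hCv⟩ := hv.bound
  obtain ⟨Cu, hCu⟩ := hu.bound
  have hαm := hL.continuous.measurable
  have hLip : ∀ a b, |α a - α b| ≤ L * |a - b| := fun a b => by
    simpa [Real.dist_eq] using hL.dist_le_mul a b
  have hb : ∀ {a b A B : ℝ}, |a| ≤ A → |b| ≤ B → |α a - α b| ≤ L * (A + B) := by
    intro a b A B ha hb
    refine (hLip a b).trans ?_
    gcongr
    exact (abs_sub _ _).trans (add_le_add ha hb)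
  have mE : Measurable fun z : ℝ × Space N => |α (v z.1 z.2) - α (u z.1 z.2)| :=
    continuous_abs.measurable.comp ((hαm.comp hv.measurable).sub (hαm.comp hu.measurable))
  set Y : ℝ → ℝ := fun s => ∫ x in Ω, |α (v s x) - α (u s x)| with hY
  set y₀ : ℝ := ∫ x in Ω, |α (v₀ x) - α (u₀ x)| with hy₀
  have mY : Measurable Y := (mE.stronglyMeasurable.integral_prod_right).measurable
  have bY : ∀ s, |Y s| ≤ L * (Cv + Cu) * (volume.restrict Ω).real univ := fun s => by
    refine norm_integral_le_of_norm_le_const (μ := volume.restrict Ω)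
      (f := fun x => |α (v s x) - α (u s x)|) (ae_of_all _ fun x => ?_)
    rw [Real.norm_eq_abs, abs_abs]
    exact hb (hCv _ _) (hCu _ _)
  have mexp : Measurable fun s : ℝ => Real.exp (-(K * s)) := by fun_prop
  obtain ⟨D, hD0, hD⟩ := exists_bound_on_Icc
    (show Continuous fun s : ℝ => Real.exp (-(K * s)) by fun_prop) 0 M
  have key := ae_nonneg_of_forall_continuous (F := fun s => y₀ - Real.exp (-(K * s)) * Y s)
    (measurable_const.sub (mexp.mul mY))
    ⟨|y₀| + D * (L * (Cv + Cu) * (volume.restrict Ω).real univ), fun s hs => by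
      refine (abs_sub _ _).trans (add_le_add le_rfl ?_)
      rw [abs_mul]
      exact mul_le_mul (hD s (Ioo_subset_Icc_self hs)) (bY s) (abs_nonneg _) hD0⟩ ?_
  · filter_upwards [key] with s hs
    have h1 : Real.exp (K * s) * Real.exp (-(K * s)) = 1 := by
      rw [← Real.exp_add, add_neg_cancel, Real.exp_zero]
    have h2 := mul_nonneg (Real.exp_pos (K * s)).le hs
    have h3 : Real.exp (K * s) * (y₀ - Real.exp (-(K * s)) * Y s) =
        Real.exp (K * s) * y₀ - Real.exp (K * s) * Real.exp (-(K * s)) * Y s := by ring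
    rw [h3, h1, one_mul] at h2
    exact sub_nonneg.1 h2
  intro φ M' hM' hφ hφ0 hφM
  -- Gronwall's lemma in dual form: ψ(τ) = e^(-Kτ) ∫_τ^M φ solves ψ' = -Kψ - χ with χ = e^(-Kτ) φ,
  -- and ψ(0) = ∫ φ. The estimate therefore says that y₀ - e^(-Ks) Y(s) has a nonnegative integral
  -- against every such φ.
  have hΦd : ∀ τ, HasDerivAt (fun τ => Real.exp (-(K * τ)) * ∫ s in τ..M, φ s)
      (-(K * (Real.exp (-(K * τ)) * ∫ s in τ..M, φ s)) - Real.exp (-(K * τ)) * φ τ) τ := by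
    intro τ
    have h1 : HasDerivAt (fun τ : ℝ => Real.exp (-(K * τ))) (Real.exp (-(K * τ)) * -(K * 1)) τ :=
      (((hasDerivAt_id τ).const_mul K).neg).exp
    have h2 : HasDerivAt (fun τ => ∫ s in τ..M, φ s) (-φ τ) τ :=
      intervalIntegral.integral_hasDerivAt_left (hφ.intervalIntegrable _ _)
        (hφ.stronglyMeasurableAtFilter _ _) hφ.continuousAt
    refine (h1.mul h2).congr_deriv ?_
    ring
  have hΦ0 : ∀ τ, M' ≤ τ → ∫ s in τ..M, φ s = 0 := fun τ hτ => by
    rw [← intervalIntegral.integral_zero (a := τ) (b := M)]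
    exact intervalIntegral.integral_congr fun s hs => hφM s ((le_min hτ hM'.le).trans hs.1)
  have main := integral_mul_abs_sub_le hΩ hM hm hL hα hv hu hsrc hM' hΦd
    (show Continuous fun τ => Real.exp (-(K * τ)) * φ τ by fun_prop)
    (fun τ => mul_nonneg (Real.exp_pos _).le (hφ0 τ))
    (fun τ hτ => by rw [hφM τ hτ, mul_zero])
    (fun τ => mul_nonneg (Real.exp_pos _).le (by
      rcases le_total τ M with h | h
      · exact intervalIntegral.integral_nonneg h fun s _ => hφ0 s
      · exact (hΦ0 τ (hM'.le.trans h)).ge))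
    (fun τ hτ => by rw [hΦ0 τ hτ, mul_zero])
  rw [mul_zero, neg_zero, Real.exp_zero, one_mul, intervalIntegral.integral_of_le hM.le,
    integral_Ioc_eq_integral_Ioo, ← hy₀] at main
  have hφi : IntegrableOn φ (Ioo 0 M) :=
    (hφ.integrableOn_Icc (a := 0) (b := M)).mono_set Ioo_subset_Icc_self
  obtain ⟨R, hR0, hR⟩ := exists_bound_on_Icc hφ 0 M
  have hi : Integrable (fun z : ℝ × Space N => |α (v z.1 z.2) - α (u z.1 z.2)| *
      (Real.exp (-(K * z.1)) * φ z.1)) (cylinder Ω M) := by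
    refine integrable_cylinder_of_bound (mE.mul ((mexp.comp measurable_fst).mul
      (hφ.measurable.comp measurable_fst))) (C := L * (Cv + Cu) * (D * R)) fun z hz => ?_
    rw [abs_mul, abs_abs, abs_mul]
    exact mul_le_mul (hb (hCv _ _) (hCu _ _)) (mul_le_mul (hD _ (Ioo_subset_Icc_self hz))
      (hR _ (Ioo_subset_Icc_self hz)) (abs_nonneg _) hD0) (by positivity)
      ((abs_nonneg _).trans (hb (hCv z.1 z.2) (hCu z.1 z.2)))
  rw [cylinder] at hi main
  rw [integral_prod _ hi] at main
  have hi2 := hi.integral_prod_left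
  simp only [integral_mul_const] at main hi2
  have e1 : ∀ s, φ s * (y₀ - Real.exp (-(K * s)) * Y s) =
      φ s * y₀ - Y s * (Real.exp (-(K * s)) * φ s) := fun s => by ring
  simp only [e1]
  rw [integral_sub (hφi.mul_const y₀) hi2, integral_mul_const]
  linarith

end Contraction

/-! ### Regular representatives and the nonlocal source. -/

section Representatives

/-- A measurable representative is truncated at the essential supremum. Bounds valid everywhere let
the source estimate hold for all pairs of times t, τ, without exceptional sets in the doubled
domain. -/
lemma exists_measurable_bounded_ae_eq {β : Type*} [MeasurableSpace β] {μ : Measure β} {F : β → ℝ}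
    (hF : MemLp F ∞ μ) : ∃ F' : β → ℝ, Measurable F' ∧ (∃ C, ∀ z, |F' z| ≤ C) ∧ F =ᵐ[μ] F' := by
  set C : ℝ := (eLpNorm F ∞ μ).toReal
  have hC : 0 ≤ C := ENNReal.toReal_nonneg
  have hle : ∀ᵐ z ∂μ, |F z| ≤ C := by
    have h1 := ae_le_eLpNormEssSup (f := F) (μ := μ)
    filter_upwards [h1] with z hz
    rw [← eLpNorm_exponent_top] at hz
    have := ENNReal.toReal_mono hF.2.ne hz
    rwa [toReal_enorm, Real.norm_eq_abs] at this
  refine ⟨fun z => max (-C) (min C (hF.1.mk F z)),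
    measurable_const.max (measurable_const.min hF.1.stronglyMeasurable_mk.measurable),
    ⟨C, fun z => abs_le.2 ⟨le_max_left _ _, max_le (by linarith) (min_le_left _ _)⟩⟩, ?_⟩
  filter_upwards [hF.1.ae_eq_mk, hle] with z h1 h2
  rw [← h1, min_eq_right (abs_le.1 h2).2, max_eq_right (abs_le.1 h2).1]

variable {N : ℕ} {Ω : Set (Space N)} {M m κ σ : ℝ} {α f : ℝ → ℝ} {v₀ : Space N → ℝ}
  {v : ℝ → Space N → ℝ}

/-- The nonlocal source term. -/
noncomputable def source (Ω : Set (Space N)) (κ : ℝ) (f : ℝ → ℝ) (v : ℝ → Space N → ℝ)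
    (t : ℝ) (x : Space N) : ℝ :=
  κ * (f (v t x) / (∫ y in Ω, f (v t y)) ^ 2)

lemma exists_bound_comp (hf : Continuous f) {β : Type*} {a : β → ℝ} (ha : ∃ C, ∀ x, |a x| ≤ C) :
    ∃ C, ∀ x, |f (a x)| ≤ C := by
  obtain ⟨C, hC⟩ := ha
  obtain ⟨D, -, hD⟩ := exists_bound_on_Icc hf (-C) C
  exact ⟨D, fun x => hD _ (abs_le.1 (hC x))⟩

lemma integrable_comp_of_bound [IsFiniteMeasure (volume.restrict Ω)] (hf : Continuous f)
    {a : Space N → ℝ} (ha : Measurable a) (hab : ∃ C, ∀ x, |a x| ≤ C) :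
    IntegrableOn (fun x => f (a x)) Ω := by
  obtain ⟨D, hD⟩ := exists_bound_comp hf hab
  exact Integrable.of_bound (hf.measurable.comp ha).aestronglyMeasurable D (ae_of_all _ hD)

lemma mul_measureReal_le_integral_comp [IsFiniteMeasure (volume.restrict Ω)] (hf : Continuous f)
    (hσ : ∀ s, σ ≤ f s) {a : Space N → ℝ} (ha : Measurable a) (hab : ∃ C, ∀ x, |a x| ≤ C) :
    σ * (volume.restrict Ω).real univ ≤ ∫ x in Ω, f (a x) := by
  have h := integral_mono (integrable_const (μ := volume.restrict Ω) σ)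
    (integrable_comp_of_bound hf ha hab) (fun x => hσ (a x))
  rwa [integral_const, smul_eq_mul, mul_comm] at h

/-- Every term of the weak formulation is insensitive to null sets, including the nonlocal integral,
which changes only for a null set of times. The source is bounded because its denominator is at
least (σ|Ω|)². -/
lemma IsBoundedWeakSolution.exists_regularSolution [IsFiniteMeasure (volume.restrict Ω)]
    (hf : Continuous f) (hσ0 : 0 < σ) (hσ : ∀ s, σ ≤ f s)
    (hA : 0 < (volume.restrict Ω).real univ) (hv₀ : MemLp v₀ ∞ (volume.restrict Ω))
    (h : IsBoundedWeakSolution Ω M m κ α f v₀ v) :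
    ∃ (v₀' : Space N → ℝ) (v' : ℝ → Space N → ℝ) (G : ℝ → Space N → Space N),
      RegularSolution Ω M m α v₀' v' G (source Ω κ f v') ∧ v₀ =ᵐ[volume.restrict Ω] v₀' ∧
      ∀ᵐ s ∂(volume.restrict (Ioo 0 M)), v s =ᵐ[volume.restrict Ω] v' s := by
  obtain ⟨hvb, Gv, ⟨-, hG, hW⟩, -, ξ₀, ξ₁, -, heq, hinit⟩ := h
  obtain ⟨v₀', hv₀m, hv₀b, hv₀e⟩ := exists_measurable_bounded_ae_eq hv₀
  obtain ⟨F, hFm, ⟨C, hC⟩, hFe⟩ := exists_measurable_bounded_ae_eq hvb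
  set v' : ℝ → Space N → ℝ := fun t x => F (t, x)
  set G : ℝ → Space N → Space N := fun t x => hG.1.mk _ (t, x) with hG_def
  have hGm : Measurable fun z : ℝ × Space N => G z.1 z.2 := hG.1.stronglyMeasurable_mk.measurable
  have hGe : (fun z : ℝ × Space N => Gv z.1 z.2) =ᵐ[cylinder Ω M] fun z => G z.1 z.2 :=
    hG.1.ae_eq_mk
  have hvs : ∀ᵐ s ∂(volume.restrict (Ioo 0 M)), v s =ᵐ[volume.restrict Ω] v' s :=
    Measure.ae_ae_of_ae_prod hFe
  have hGs : ∀ᵐ s ∂(volume.restrict (Ioo 0 M)), Gv s =ᵐ[volume.restrict Ω] G s :=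
    Measure.ae_ae_of_ae_prod hGe
  have hfv : Measurable fun z : ℝ × Space N => f (v' z.1 z.2) := hf.measurable.comp hFm
  have hv'm : ∀ t, Measurable (v' t) := fun t => hFm.comp measurable_prodMk_left
  have hlow : ∀ t, σ * (volume.restrict Ω).real univ ≤ ∫ y in Ω, f (v' t y) := fun t =>
    mul_measureReal_le_integral_comp hf hσ (hv'm t) ⟨C, fun x => hC _⟩
  have hint : ∀ᵐ z ∂(cylinder Ω M), ∫ y in Ω, f (v z.1 y) = ∫ y in Ω, f (v' z.1 y) := by
    have : ∀ᵐ s ∂(volume.restrict (Ioo 0 M)), ∫ y in Ω, f (v s y) = ∫ y in Ω, f (v' s y) := by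
      filter_upwards [hvs] with s hs
      refine integral_congr_ae ?_
      filter_upwards [hs] with x hx
      rw [hx]
    exact Measure.quasiMeasurePreserving_fst.ae this
  refine ⟨v₀', v', G, ?_, hv₀e, hvs⟩
  refine ⟨hv₀m, hv₀b, hFm, ⟨C, fun t x => hC _⟩, hGm, hG.ae_eq hGe, ?_, ?_, ?_, ?_⟩
  · filter_upwards [hW, hvs, hGs] with s h1 h2 h3 using h1.congr h2 h3
  · exact (hfv.div (((StronglyMeasurable.integral_prod_right (f := fun t y => f (v' t y))
      hfv.stronglyMeasurable).measurable.comp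
      measurable_fst).pow_const 2)).const_mul κ
  · obtain ⟨D, hD⟩ := exists_bound_comp hf ⟨C, hC⟩
    refine ⟨|κ| * (D / (σ * (volume.restrict Ω).real univ) ^ 2), fun t x => ?_⟩
    have h1 : |f (v' t x)| ≤ D := hD (t, x)
    have h2 : 0 ≤ D := (abs_nonneg _).trans h1
    have h3 : 0 < σ * (volume.restrict Ω).real univ := mul_pos hσ0 hA
    rw [source, abs_mul, abs_div, abs_pow, abs_of_nonneg (h3.le.trans (hlow t))]
    gcongr
    exact hlow t
  · intro w wt G' hw hwb hwt
    have h1 := heq w G' hw hwb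
    -- The dual element ξ is eliminated: for test functions admissible in both identities, its
    -- pairing is the integral against the time derivative.
    rw [hinit w wt G' hw hwt] at h1
    have e1 : ∫ z, (α (v z.1 z.2) - α (v₀ z.2)) * wt z.1 z.2 ∂(cylinder Ω M) =
        ∫ z, (α (v' z.1 z.2) - α (v₀' z.2)) * wt z.1 z.2 ∂(cylinder Ω M) := by
      refine integral_congr_ae ?_
      have h2 : ∀ᵐ z ∂(cylinder Ω M), v₀ z.2 = v₀' z.2 :=
        Measure.quasiMeasurePreserving_snd.ae hv₀e
      filter_upwards [hFe, h2] with z h3 h4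
      rw [h4, h3]
    have e2 : ∫ z, ‖Gv z.1 z.2‖ ^ (m - 2) * inner ℝ (Gv z.1 z.2) (G' z.1 z.2) ∂(cylinder Ω M) =
        ∫ z, ‖G z.1 z.2‖ ^ (m - 2) * inner ℝ (G z.1 z.2) (G' z.1 z.2) ∂(cylinder Ω M) := by
      refine integral_congr_ae ?_
      filter_upwards [hGe] with z h3
      rw [h3]
    have e3 : κ * ∫ z, f (v z.1 z.2) / (∫ y in Ω, f (v z.1 y)) ^ 2 * w z.1 z.2 ∂(cylinder Ω M) =
        ∫ z, source Ω κ f v' z.1 z.2 * w z.1 z.2 ∂(cylinder Ω M) := by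
      rw [← integral_const_mul]
      refine integral_congr_ae ?_
      filter_upwards [hFe, hint] with z h3 h4
      rw [h4, h3, source]
      ring
    rw [← e1, ← e2, ← e3, h1]

lemma abs_div_sq_sub_div_sq_le {p q P Q : ℝ} (hq : 0 ≤ q) (hP : 0 < P) :
    |p / P ^ 2 - q / Q ^ 2| ≤ |p - q| / P ^ 2 + q * |1 / P ^ 2 - 1 / Q ^ 2| := by
  have h1 : p / P ^ 2 - q / Q ^ 2 = (p - q) / P ^ 2 + q * (1 / P ^ 2 - 1 / Q ^ 2) := by ring
  rw [h1]
  refine (abs_add_le _ _).trans ?_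
  rw [abs_div, abs_mul, abs_of_nonneg hq, abs_of_pos (show 0 < P ^ 2 by positivity)]

/-- Here P and Q stand for the integrals of f over Ω. The factor Q cancels against 1/P² - 1/Q² = (Q
- P)(1/P² + 1/(PQ))/Q, so only a lower bound enters, and K becomes independent of the size of the
solutions. -/
lemma mul_abs_one_div_sq_sub_le {P Q c : ℝ} (hc : 0 < c) (hP : c ≤ P) (hQ : c ≤ Q) :
    Q * |1 / P ^ 2 - 1 / Q ^ 2| ≤ 2 / c ^ 2 * |P - Q| := by
  have hP0 : 0 < P := hc.trans_le hP
  have hQ0 : 0 < Q := hc.trans_le hQ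
  have h1 : 1 / P ^ 2 - 1 / Q ^ 2 = (Q - P) * ((1 / P ^ 2 + 1 / (P * Q)) / Q) := by
    field_simp
    ring
  rw [h1, abs_mul, abs_sub_comm Q P, abs_of_pos (show 0 < (1 / P ^ 2 + 1 / (P * Q)) / Q by positivity)]
  have h2 : 1 / P ^ 2 ≤ 1 / c ^ 2 := by gcongr
  have h3 : 1 / (P * Q) ≤ 1 / c ^ 2 := by rw [sq]; gcongr
  calc Q * (|P - Q| * ((1 / P ^ 2 + 1 / (P * Q)) / Q))
      = (1 / P ^ 2 + 1 / (P * Q)) * |P - Q| := by field_simp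
    _ ≤ (1 / c ^ 2 + 1 / c ^ 2) * |P - Q| := by gcongr
    _ = 2 / c ^ 2 * |P - Q| := by ring

/-- The nonlocal source is Lipschitz with respect to the distance of `α(v)` in `L^1(Ω)`. -/
lemma integral_abs_source_sub_le [IsFiniteMeasure (volume.restrict Ω)] (hκ : 0 ≤ κ)
    (hα : Continuous α) (hf : Continuous f) (hσ0 : 0 < σ) (hσ : ∀ s, σ ≤ f s)
    (hA : 0 < (volume.restrict Ω).real univ) {L₂ : ℝ}
    (hfα : ∀ a b : ℝ, |f a - f b| ≤ L₂ * |α a - α b|) {v u : ℝ → Space N → ℝ} {t τ : ℝ}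
    (hv : Measurable (v t)) (hvb : ∃ C, ∀ x, |v t x| ≤ C)
    (hu : Measurable (u τ)) (hub : ∃ C, ∀ x, |u τ x| ≤ C) :
    ∫ x in Ω, |source Ω κ f v t x - source Ω κ f u τ x| ≤
      3 * κ * L₂ / (σ * (volume.restrict Ω).real univ) ^ 2 *
        ∫ x in Ω, |α (v t x) - α (u τ x)| := by
  set c := σ * (volume.restrict Ω).real univ
  have hc : 0 < c := mul_pos hσ0 hA
  have hP : c ≤ ∫ x in Ω, f (v t x) := mul_measureReal_le_integral_comp hf hσ hv hvb
  have hQ : c ≤ ∫ x in Ω, f (u τ x) := mul_measureReal_le_integral_comp hf hσ hu hub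
  have ip := integrable_comp_of_bound (Ω := Ω) hf hv hvb
  have iq := integrable_comp_of_bound (Ω := Ω) hf hu hub
  have ia := integrable_comp_of_bound (Ω := Ω) hα hv hvb
  have ib := integrable_comp_of_bound (Ω := Ω) hα hu hub
  set P := ∫ x in Ω, f (v t x) with hP_def
  set Q := ∫ x in Ω, f (u τ x) with hQ_def
  set S := ∫ x in Ω, |f (v t x) - f (u τ x)| with hS_def
  have hP0 : 0 < P := hc.trans_le hP
  have hS0 : 0 ≤ S := integral_nonneg fun x => abs_nonneg _
  have ipq : IntegrableOn (fun x => |f (v t x) - f (u τ x)|) Ω := (ip.sub iq).abs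
  have hPQ : |P - Q| ≤ S := by
    rw [hP_def, hQ_def, ← integral_sub ip iq]
    exact abs_integral_le_integral_abs
  have hSE : S ≤ L₂ * ∫ x in Ω, |α (v t x) - α (u τ x)| := by
    rw [← integral_const_mul]
    exact integral_mono ipq ((ia.sub ib).abs.const_mul L₂) fun x => hfα _ _
  have ij : IntegrableOn (fun x => κ * (|f (v t x) - f (u τ x)| / P ^ 2 +
      f (u τ x) * |1 / P ^ 2 - 1 / Q ^ 2|)) Ω :=
    ((ipq.div_const _).add (iq.mul_const _)).const_mul κ
  have h1 : ∫ x in Ω, |source Ω κ f v t x - source Ω κ f u τ x| ≤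
      ∫ x in Ω, κ * (|f (v t x) - f (u τ x)| / P ^ 2 +
        f (u τ x) * |1 / P ^ 2 - 1 / Q ^ 2|) := by
    refine integral_mono_of_nonneg (ae_of_all _ fun x => abs_nonneg _) ij (ae_of_all _ fun x => ?_)
    simp only [source]
    rw [← hP_def, ← hQ_def, ← mul_sub, abs_mul, abs_of_nonneg hκ]
    exact mul_le_mul_of_nonneg_left
      (abs_div_sq_sub_div_sq_le (hσ0.le.trans (hσ _)) hP0) hκ
  refine h1.trans ?_
  rw [integral_const_mul, integral_add (ipq.div_const _) (iq.mul_const _), integral_div,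
    integral_mul_const, ← hQ_def, ← hS_def]
  have h2 : S / P ^ 2 ≤ 1 / c ^ 2 * S := by
    rw [one_div_mul_eq_div]
    gcongr
  have h3 := mul_abs_one_div_sq_sub_le hc hP hQ
  have h4 : 2 / c ^ 2 * |P - Q| ≤ 2 / c ^ 2 * S := by gcongr
  -- The factor 3 is 1 from the numerators plus 2 from the denominators.
  calc κ * (S / P ^ 2 + Q * |1 / P ^ 2 - 1 / Q ^ 2|)
      ≤ κ * (3 / c ^ 2 * S) := by
        refine mul_le_mul_of_nonneg_left ?_ hκ
        have : 3 / c ^ 2 * S = 1 / c ^ 2 * S + 2 / c ^ 2 * S := by ring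
        linarith
    _ ≤ κ * (3 / c ^ 2 * (L₂ * ∫ x in Ω, |α (v t x) - α (u τ x)|)) := by gcongr
    _ = 3 * κ * L₂ / c ^ 2 * ∫ x in Ω, |α (v t x) - α (u τ x)| := by ring

end Representatives

/-! ### The L¹ distance, continuous representatives, and the conclusion. -/

section Main

variable {N : ℕ} {Ω : Set (Space N)} {M : ℝ}

lemma distL1_eq_ofReal {g h g' h' : Space N → ℝ} (hg : g =ᵐ[volume.restrict Ω] g')
    (hh : h =ᵐ[volume.restrict Ω] h') (hg' : IntegrableOn g' Ω) (hh' : IntegrableOn h' Ω) :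
    distL1 Ω g h = ENNReal.ofReal (∫ x in Ω, |g' x - h' x|) := by
  have h1 : distL1 Ω g h = eLpNorm (fun x => g' x - h' x) 1 (volume.restrict Ω) :=
    eLpNorm_congr_ae (hg.sub hh)
  have h2 : Integrable (fun x => g' x - h' x) (volume.restrict Ω) := hg'.sub hh'
  rw [h1, eLpNorm_one_eq_lintegral_enorm, ← ofReal_integral_norm_eq_lintegral_enorm h2]
  rfl

lemma distL1_coeFn (a b : Lp ℝ 1 (volume.restrict Ω)) :
    distL1 Ω a b = ENNReal.ofReal ‖a - b‖ := by
  rw [Lp.norm_def, ENNReal.ofReal_toReal (Lp.memLp _).2.ne]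
  exact eLpNorm_congr_ae (Lp.coeFn_sub a b).symm

/-- The positive part of ‖bv(s) - bu(s)‖ - B(s) is continuous on [0, M] and vanishes almost
everywhere there, hence everywhere, endpoints included. -/
lemma IsContinuousRepr.le_of_ae_le {α : ℝ → ℝ} {v u : ℝ → Space N → ℝ}
    {bv bu : ℝ → Lp ℝ 1 (volume.restrict Ω)} (hM : 0 < M)
    (hbv : IsContinuousRepr Ω M α v bv) (hbu : IsContinuousRepr Ω M α u bu) {B : ℝ → ℝ}
    (hB : Continuous B) (hB0 : ∀ s, 0 ≤ B s)
    (h : ∀ᵐ s ∂(volume.restrict (Ioo 0 M)),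
      distL1 Ω (fun x => α (v s x)) (fun x => α (u s x)) ≤ ENNReal.ofReal (B s)) :
    ∀ s ∈ Icc 0 M, distL1 Ω (bv s) (bu s) ≤ ENNReal.ofReal (B s) := by
  have h1 : (fun s => max (‖bv s - bu s‖ - B s) 0) =ᵐ[volume.restrict (Icc 0 M)] fun _ => 0 := by
    rw [← Measure.restrict_congr_set Ioo_ae_eq_Icc]
    filter_upwards [h, hbv.2, hbu.2] with s h2 h3 h4
    have h5 : distL1 Ω (bv s) (bu s) = distL1 Ω (fun x => α (v s x)) (fun x => α (u s x)) :=
      eLpNorm_congr_ae (EventuallyEq.sub h3 h4)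
    rw [← h5, distL1_coeFn, ENNReal.ofReal_le_ofReal_iff (hB0 s)] at h2
    exact max_eq_right (by linarith)
  have hc : ContinuousOn (fun s => max (‖bv s - bu s‖ - B s) 0) (Icc 0 M) :=
    ContinuousOn.sup (((hbv.1.sub hbu.1).norm).sub hB.continuousOn) continuousOn_const
  have h2 := Measure.eqOn_Icc_of_ae_eq volume hM.ne h1 hc continuousOn_const
  intro s hs
  rw [distL1_coeFn]
  refine ENNReal.ofReal_le_ofReal ?_
  have h3 : max (‖bv s - bu s‖ - B s) 0 = 0 := h2 hs
  linarith [le_max_left (‖bv s - bu s‖ - B s) 0]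

end Main

end Thermistor

theorem mainTheorem5 {N : ℕ} (hN : 1 ≤ N)
    (Ω : Set (Thermistor.Space N)) (hΩ : IsOpen Ω) (hΩb : Bornology.IsBounded Ω)
    (m : ℝ) (hm : 2 ≤ m) (κ : ℝ) (hκ : 0 ≤ κ) (α f : ℝ → ℝ)
    (hα : Thermistor.AlphaAssumption α) (hf : Thermistor.ResistanceAssumption f)
    (L₂ : ℝ) (hL₂ : 0 < L₂) (hfα : ∀ a b : ℝ, |f a - f b| ≤ L₂ * |α a - α b|) :
    ∃ K : ℝ, 0 < K ∧
      ∀ (M : ℝ), 0 < M →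
      ∀ (v₀ u₀ : Thermistor.Space N → ℝ) (v u : ℝ → Thermistor.Space N → ℝ),
        MemLp v₀ ∞ (volume.restrict Ω) → MemLp u₀ ∞ (volume.restrict Ω) →
        Thermistor.IsBoundedWeakSolution Ω M m κ α f v₀ v →
        Thermistor.IsBoundedWeakSolution Ω M m κ α f u₀ u →
        (∀ᵐ s ∂(volume.restrict (Ioo 0 M)),
          Thermistor.distL1 Ω (fun x => α (v s x)) (fun x => α (u s x)) ≤
            ENNReal.ofReal (Real.exp (K * s)) *
              Thermistor.distL1 Ω (fun x => α (v₀ x)) (fun x => α (u₀ x))) ∧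
        (∀ bv bu : ℝ → Lp ℝ 1 (volume.restrict Ω),
          Thermistor.IsContinuousRepr Ω M α v bv → Thermistor.IsContinuousRepr Ω M α u bu →
          ∀ s ∈ Icc 0 M,
            Thermistor.distL1 Ω (bv s) (bu s) ≤
              ENNReal.ofReal (Real.exp (K * s)) *
                Thermistor.distL1 Ω (fun x => α (v₀ x)) (fun x => α (u₀ x))) := by
  obtain ⟨L, hL⟩ := hα.lipschitz
  obtain ⟨Lf, hLf⟩ := hf.lipschitz
  obtain ⟨σ, hσ0, hσ⟩ := hf.lower_bound
  have hfin : IsFiniteMeasure (volume.restrict Ω) :=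
    isFiniteMeasure_restrict.2 hΩb.measure_lt_top.ne
  set A := (volume.restrict Ω).real univ with hA_def
  -- The Lipschitz constant of the source, enlarged by 1 so that K > 0 also when κ = 0 or |Ω| = 0.
  refine ⟨3 * κ * L₂ / (σ * A) ^ 2 + 1, by positivity, fun M hM v₀ u₀ v u hv₀ hu₀ hv hu => ?_⟩
  -- If Ω is a null set all distances are zero. Otherwise |Ω| > 0, which the lower bound σ|Ω| for ∫
  -- f requires.
  rcases eq_or_ne (volume.restrict Ω) 0 with h0 | h0
  · have hd : ∀ g h : Thermistor.Space N → ℝ, Thermistor.distL1 Ω g h = 0 := fun g h => by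
      rw [Thermistor.distL1, h0, eLpNorm_measure_zero]
    exact ⟨ae_of_all _ fun s => by rw [hd]; exact zero_le,
      fun bv bu _ _ s _ => by rw [hd]; exact zero_le⟩
  have hA : 0 < A := by
    rw [hA_def, measureReal_def]
    exact ENNReal.toReal_pos (by rwa [ne_eq, Measure.measure_univ_eq_zero]) (measure_ne_top _ _)
  obtain ⟨v₀', v', Gv, hv', hv₀e, hve⟩ :=
    hv.exists_regularSolution hLf.continuous hσ0 hσ hA hv₀
  obtain ⟨u₀', u', Gu, hu', hu₀e, hue⟩ :=
    hu.exists_regularSolution hLf.continuous hσ0 hσ hA hu₀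
  have hslice : ∀ {w : ℝ → Thermistor.Space N → ℝ},
      (Measurable fun z : ℝ × Thermistor.Space N => w z.1 z.2) → ∀ t, Measurable (w t) :=
    fun hw t => hw.comp measurable_prodMk_left
  have hcontr := hv'.ae_integral_abs_sub_le hΩ hM hm hL hα.increasing hu'
    (K := 3 * κ * L₂ / (σ * A) ^ 2 + 1) fun t τ => by
      obtain ⟨Cv, hCv⟩ := hv'.bound
      obtain ⟨Cu, hCu⟩ := hu'.bound
      have h1 := Thermistor.integral_abs_source_sub_le hκ hL.continuous hLf.continuous hσ0 hσ hA hfα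
        (hslice hv'.measurable t) ⟨Cv, hCv t⟩ (hslice hu'.measurable τ) ⟨Cu, hCu τ⟩
      have h2 : 0 ≤ ∫ x in Ω, |α (v' t x) - α (u' τ x)| := integral_nonneg fun x => abs_nonneg _
      linarith
  have hint : ∀ {w : Thermistor.Space N → ℝ}, Measurable w → (∃ C, ∀ x, |w x| ≤ C) →
      IntegrableOn (fun x => α (w x)) Ω := fun hw hwb =>
    Thermistor.integrable_comp_of_bound hL.continuous hw hwb
  have hcomp : ∀ {w w' : Thermistor.Space N → ℝ}, w =ᵐ[volume.restrict Ω] w' →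
      (fun x => α (w x)) =ᵐ[volume.restrict Ω] fun x => α (w' x) := fun h => h.fun_comp α
  rw [Thermistor.distL1_eq_ofReal (hcomp hv₀e) (hcomp hu₀e)
    (hint hv'.measurable_init hv'.bound_init) (hint hu'.measurable_init hu'.bound_init)]
  simp only [← ENNReal.ofReal_mul (Real.exp_pos _).le]
  have hae : ∀ᵐ s ∂(volume.restrict (Ioo 0 M)),
      Thermistor.distL1 Ω (fun x => α (v s x)) (fun x => α (u s x)) ≤
        ENNReal.ofReal (Real.exp ((3 * κ * L₂ / (σ * A) ^ 2 + 1) * s) *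
          ∫ x in Ω, |α (v₀' x) - α (u₀' x)|) := by
    obtain ⟨Cv, hCv⟩ := hv'.bound
    obtain ⟨Cu, hCu⟩ := hu'.bound
    filter_upwards [hcontr, hve, hue] with s h1 h2 h3
    rw [Thermistor.distL1_eq_ofReal (hcomp h2) (hcomp h3)
      (hint (hslice hv'.measurable s) ⟨Cv, hCv s⟩) (hint (hslice hu'.measurable s) ⟨Cu, hCu s⟩)]
    exact ENNReal.ofReal_le_ofReal h1
  exact ⟨hae, fun bv bu hbv hbu => hbv.le_of_ae_le hM hbu (by fun_prop)
    (fun s => mul_nonneg (Real.exp_pos _).le (integral_nonneg fun x => abs_nonneg _)) hae⟩
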